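/- **Theorem (Atomicity of ARES-TREAS).** Every execution of the algorithm ARES-TREAS, described below, is atomic: ARES-TREAS implements a reconfigurable atomic read/write storage object. Moreover object values never pass through a reconfiguration client: no message sent by or to a reconfiguration client carries a coded element of a value. *Model.* Writers, readers, reconfigurers (the clients) and servers are asynchronous processes that may crash and that exchange messages over reliable channels (no loss, duplication or corruption, arbitrary delays). Values come from a set $\mathcal V$ with initial value $v_0$. Tags are pairs $(z,w)$, $z\in\mathbb N$, $w$ a writer identifier from a totally ordered set (or $\bot$, below all of them), ordered lexicographically; $t_0=(0,\bot)$. A configuration identifier $c$ determines a finite set $S_c$ of $n_c$ servers, a system of pairwise intersecting quorums $Q\subseteq S_c$, an $[n_c,k_c]$ MDS code with $1\le k_c\le n_c$ (an encoder $\Phi_c$ giving each $s\in S_c$ a coded element $\Phi_{c,s}(v)$, and a decoder that recovers $v$ from any $k_c$ of these), a number $\delta_c\ge 0$, and a consensus object $Con(c)$ (agreement and validity). There is an initial configuration $c_0$. A client invokes an operation only when it has none pending: writers $\mathrm{write}(v)$, readers $\mathrm{read}()$, reconfigurers $\mathrm{reconfig}(c)$; each configuration $c\ne c_0$ is submitted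 to $\mathrm{reconfig}$ at most once and $c_0$ never. Replies are matched to requests by a phase counter of the client. Put $\theta_c=\lceil (n_c+k_c)/2\rceil$. *Servers.* For each configuration $c$ a server $s$ keeps $nextC$ (initially $\bot$), a set $List$ of pairs (tag, coded element or $\bot$), initially $\{(t_0,\Phi_{c,s}(v_0))\}$, a set $D$ of received coded elements (with tag and origin), initially holding only the coded element of $v_0$ for $t_0$, and a set $Recons$ of reconfigurers, initially empty. It sends $nextC$, the largest tag in $List$, or $List$ on request. On $\text{write-config}(x)$, with $x=\langle d,\text{status}\rangle$, it sets $nextC\leftarrow x$ unless $nextC$ is already finalized, and acknowledges. On $\text{put-data}(t,e)$ it adds $(t,e)$ to $List$; if more than $\delta_c+1$ coded elements are then present, those of the smallest such tag are replaced by $\bot$ (the tag stays); it acknowledges. On $\text{req-fw-code-elem}(t,C')$ from $rc$, if some $(t,e)\in List$ with $e\neq\bot$, it sends $\text{fwd-code-elem}(t,e,rc)$ to all servers of $C'$. On $\text{fwd-code-elem}(t,e,rc)$ from a server of $C$, a server $s'$ of $C'$ ignores it if $rc\in Recons$; otherwise, if $t$ does not occur in $List$, it adds $e$ to $D$ and,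 once $D$ holds elements for $t$ from $k_C$ distinct servers of $C$, decodes a value $v$ with the code of $C$, erases the elements for $t$ in $D$, and inserts $(t,\Phi_{C',s'}(v))$ into $List$ as for put-data; then, if $t$ occurs in $List$, it adds $rc$ to $Recons$ and acknowledges to $rc$. *Data access primitives.* $c.\text{get-tag}$ returns the largest of the tags sent by $\theta_c$ servers of $c$. $c.\text{get-data}$ takes the lists of $\theta_c$ servers; if the largest tag $t$ that occurs in at least $k_c$ of them is also the largest tag that occurs in at least $k_c$ of them with a coded element, it returns $(t,v)$ with $v$ decoded from $k_c$ elements for $t$ (otherwise it does not return on these lists). $c.\text{put-data}(t,v)$ sends $(t,\Phi_{c,s}(v))$ to each $s\in S_c$ and awaits $\theta_c$ acknowledgements. *Clients.* Each keeps a sequence $cseq$ of pairs (configuration, status $P$ or $F$), initially $\langle c_0,F\rangle$; $\mu$ denotes the index of its last entry with status $F$ and $\nu$ its last index. $\text{put-config}(c,x)$ sends $\text{write-config}(x)$ to the servers of $c$ and awaits acknowledgements of a quorum. $\text{read-config}$ starts at $i=\mu$ and repeats: read $nextC$ at a quorum of $cseq[i]$; if all answers are $\bot$, stop; otherwise take a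 non-$\bot$ answer (with status $F$ if there is one), store it as $cseq[i+1]$, perform put-config of it in $cseq[i]$, and set $i\leftarrow i+1$. A write of $v$ by $w$ performs read-config, then get-tag in all $cseq[i]$, $\mu\le i\le\nu$, forms $t=(z+1,w)$ from the largest tag $(z,\cdot)$ obtained, and then alternates put-data$(t,v)$ in $cseq[\nu]$ with read-config until $\nu$ does not change. A read performs read-config, then get-data in all $cseq[i]$, $\mu\le i\le\nu$, propagates a pair $(t,v)$ with largest tag in the same loop, and returns $v$. $\text{reconfig}(c)$ performs read-config; proposes $c$ to $Con(cseq[\nu])$, appends the decision $\langle d,P\rangle$ to $cseq$ and performs put-config of it in the preceding configuration; then *update-config*: get-tag in all $cseq[i]$, $\mu\le i\le\nu$; for a pair $(\tau,C)$ of a largest tag and a configuration that returned it, send $\text{req-fw-code-elem}(\tau,C')$, where $C'=cseq[\nu]$, by an all-or-none multicast (md-primitive) to the servers of $C$, and await acknowledgements of $\theta_{C'}$ servers of $C'$; finally set the status of $cseq[\nu]$ to $F$ and perform put-config of it in $cseq[\nu-1]$. *Atomicity.* There are a set $\Pi$, consisting of all complete read and write operations of the execution and possibly some incomplete writes, and an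 irreflexive partial order $\prec$ on $\Pi$ such that for all $\pi,\pi'\in\Pi$: (A1) if $\pi$ completes before $\pi'$ is invoked, then not $\pi'\prec\pi$; (A2) if $\pi$ is a write and $\pi'\ne\pi$, then $\pi\prec\pi'$ or $\pi'\prec\pi$; (A3) a complete read returns the value written by the $\prec$-last write that precedes it in $\prec$, or $v_0$ if no write precedes it. -/

import Mathlib

namespace AresTreas

/-! ### Tags, configurations, processes -/

/-- Tags `(z, w)` ordered lexicographically; `w = ⊥` occurs in the initial tag only. -/
abbrev Tag (W : Type*) := ℕ ×ₗ WithBot W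

/-- The initial tag. -/
def tag0 {W : Type*} : Tag W := toLex (0, ⊥)

/-- The tag that writer `w` generates from the largest tag it has discovered. -/
def Tag.inc {W : Type*} (t : Tag W) (w : W) : Tag W := toLex ((ofLex t).1 + 1, (w : WithBot W))

/-- Status of an entry of a configuration sequence: pending or finalized. -/
inductive Status
  | P
  | F

/-- The data described by a configuration identifier: its servers, its quorum system, and the
parameters of the erasure-coded storage algorithm that runs on it, namely an `[n, k]` MDS code
(`n` the number of servers, `enc s v` the coded element of the value `v` kept by the server `s`,
`dec` a decoder that recovers a value from any `k` of its coded elements) and the bound `δ + 1` on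
the number of coded elements that a server keeps. -/
structure Config (V S E : Type*) where
  servers : Finset S
  quorums : Set (Finset S)
  quorum_subset : ∀ Q ∈ quorums, Q ⊆ servers
  quorum_inter : ∀ Q ∈ quorums, ∀ Q' ∈ quorums, ∃ s ∈ Q, s ∈ Q'
  k : ℕ
  k_pos : 0 < k
  k_le : k ≤ servers.card
  enc : S → V → E
  dec : Finset (S × E) → V
  dec_enc : ∀ (v : V) (A : Finset (S × E)), A.card = k →
    (∀ a ∈ A, a.1 ∈ servers ∧ a.2 = enc a.1 v) → dec A = v
  δ : ℕ

/-- The number `⌈(n + k) / 2⌉` of servers that a data access primitive waits for. -/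
def Config.threshold {V S E : Type*} (c : Config V S E) : ℕ := (c.servers.card + c.k) ⌈/⌉ 2

/-- `v` is the result of decoding some `k` of the coded elements in `X`, of distinct servers. -/
def Config.Decodes {V S E : Type*} (c : Config V S E) (X : Set (S × E)) (v : V) : Prop :=
  ∃ A : Finset (S × E), (A : Set (S × E)) ⊆ X ∧ A.card = c.k ∧
    Set.InjOn Prod.fst (A : Set (S × E)) ∧ c.dec A = v

/-- A system: the configuration named by each identifier, the initial configuration, and the
initial value of the object. -/
structure System (V S C E : Type*) where
  cfg : C → Config V S E
  c0 : C
  v0 : V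

/-- Clients are writers, readers and reconfigurers. -/
inductive Client (W R G : Type*)
  | writer (w : W)
  | reader (r : R)
  | recon (g : G)

/-- Operations that a client may invoke. -/
inductive Op (V C : Type*)
  | read
  | write (v : V)
  | reconfig (c : C)

/-- Responses of operations. -/
inductive Res (V : Type*)
  | value (v : V)
  | done

/-- External events. -/
inductive Event (V W R G C : Type*)
  | inv (p : Client W R G) (o : Op V C)
  | resp (p : Client W R G) (r : Res V)

/-- Readers read, writers write, reconfigurers reconfigure. -/
def Permits {V W R G C : Type*} : Client W R G → Op V C → Prop
  | .reader _, .read => True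
  | .writer _, .write _ => True
  | .recon _, .reconfig _ => True
  | _, _ => False

/-! ### Messages -/

/-- The variable `List` of a server: pairs of a tag and a coded element, which may have been
erased (`none`). -/
abbrev TagList (W E : Type*) := Finset (Tag W × Option E)

/-- Bodies of the messages that clients send to servers. -/
inductive Req (W C E : Type*)
  | readConfig
  | writeConfig (x : C × Status)
  | queryTag
  | queryList
  | putData (t : Tag W) (e : E)
  | reqFwd (t : Tag W) (c' : C)

/-- Bodies of the messages that servers send to clients. -/
inductive Rep (W C E : Type*)
  | nextC (x : Option (C × Status))
  | tag (t : Tag W)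
  | list (L : TagList W E)
  | ack

/-- Messages. `req p ph s c b` goes from the client `p` to the server `s` acting for the
configuration `c`; `rep p ph s b` goes from the server `s` to the client `p`, where `ph` is the
communication phase of `p` that the reply belongs to. `fwd s c t e s' c' g ph` goes from the
server `s` of configuration `c` to the server `s'` of configuration `c'`; it carries the coded
element `e` for the tag `t`, and the reconfigurer `g` that asked for it in its phase `ph`. -/
inductive Msg (W R G S C E : Type*)
  | req (p : Client W R G) (ph : ℕ) (s : S) (c : C) (b : Req W C E)
  | rep (p : Client W R G) (ph : ℕ) (s : S) (b : Rep W C E)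
  | fwd (s : S) (c : C) (t : Tag W) (e : E) (s' : S) (c' : C) (g : G) (ph : ℕ)

/-- The message is sent by or addressed to the client `p`. -/
def Msg.Touches {W R G S C E : Type*} (p : Client W R G) : Msg W R G S C E → Prop
  | .req q _ _ _ _ => q = p
  | .rep q _ _ _ => q = p
  | .fwd .. => False

/-- The message carries coded elements of object values. -/
def Msg.CarriesData {W R G S C E : Type*} : Msg W R G S C E → Prop
  | .req _ _ _ _ (.putData _ _) => True
  | .rep _ _ _ (.list _) => True
  | .fwd .. => True
  | _ => False

/-! ### Servers -/

/-- The state that a server keeps for a configuration. An entry `(t, c, s, e)` of `D` is the coded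
element `e` for the tag `t` received from the server `s` of the configuration `c` (`none` if it
has been erased). -/
structure SrvState (W G S C E : Type*) where
  nextC : Option (C × Status)
  list : TagList W E
  D : Set (Tag W × C × S × Option E)
  recons : Set G

/-- Initial state of the server `s` for the configuration `c`. -/
def SrvState.init {V W G S C E : Type*} (sys : System V S C E) (s : S) (c : C) :
    SrvState W G S C E where
  nextC := none
  list := {(tag0, some ((sys.cfg c).enc s sys.v0))}
  D := {(tag0, c, s, some ((sys.cfg c).enc s sys.v0))}
  recons := ∅

/-- The value of `nextC` after the receipt of `x`: a finalized pointer is never altered. -/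
def updNext {C : Type*} : Option (C × Status) → C × Status → Option (C × Status)
  | some (d, .F), _ => some (d, .F)
  | _, x => some x

/-- `t` is the smallest tag that still has a coded element in `L`. -/
def IsOldest {W E : Type*} [LinearOrder W] (L : TagList W E) (t : Tag W) : Prop :=
  IsLeast {t | ∃ e, (t, some e) ∈ L} t

open Classical in
/-- Insert `(t, e)` into `L`; if `L` then holds more than `δ + 1` coded elements, erase those of
the smallest tag, keeping the tag itself. -/
noncomputable def insertTrim {W E : Type*} [LinearOrder W] (δ : ℕ) (L : TagList W E)
    (t : Tag W) (e : E) : TagList W E :=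
  let L' := insert (t, some e) L
  if δ + 1 < (L'.filter fun x => x.2 ≠ none).card then
    L'.image fun x => if IsOldest L' x.1 then (x.1, none) else x
  else L'

/-- `SrvRecv sys s c st p ph b st' out`: the server `s`, acting for `c` in the state `st`, receives
the request `b` of the phase `ph` of the client `p`, moves to the state `st'` and sends the
messages `out`. -/
inductive SrvRecv {V W R G S C E : Type*} [LinearOrder W] (sys : System V S C E) (s : S) (c : C)
    (st : SrvState W G S C E) : Client W R G → ℕ → Req W C E → SrvState W G S C E →
      Multiset (Msg W R G S C E) → Prop
  | readConfig (p : Client W R G) (ph : ℕ) :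
      SrvRecv sys s c st p ph .readConfig st {.rep p ph s (.nextC st.nextC)}
  | writeConfig (p : Client W R G) (ph : ℕ) (x : C × Status) :
      SrvRecv sys s c st p ph (.writeConfig x) { st with nextC := updNext st.nextC x }
        {.rep p ph s .ack}
  | queryTag (p : Client W R G) (ph : ℕ) (t : Tag W)
      (ht : IsGreatest {t | ∃ o, (t, o) ∈ st.list} t) :
      SrvRecv sys s c st p ph .queryTag st {.rep p ph s (.tag t)}
  | queryList (p : Client W R G) (ph : ℕ) :
      SrvRecv sys s c st p ph .queryList st {.rep p ph s (.list st.list)}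
  | putData (p : Client W R G) (ph : ℕ) (t : Tag W) (e : E) :
      SrvRecv sys s c st p ph (.putData t e)
        { st with list := insertTrim (sys.cfg c).δ st.list t e } {.rep p ph s .ack}
  | reqFwd_send (g : G) (ph : ℕ) (t : Tag W) (c' : C) (e : E) (he : (t, some e) ∈ st.list) :
      SrvRecv sys s c st (.recon g) ph (.reqFwd t c') st
        ((sys.cfg c').servers.val.map fun s' => .fwd s c t e s' c' g ph)
  | reqFwd_skip (p : Client W R G) (ph : ℕ) (t : Tag W) (c' : C)
      (he : ∀ e, (t, some e) ∉ st.list) :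
      SrvRecv sys s c st p ph (.reqFwd t c') st 0

open Classical in
/-- Erase the coded elements for the tag `t` in `D`. -/
noncomputable def eraseElems {W S C E : Type*} (D : Set (Tag W × C × S × Option E)) (t : Tag W) :
    Set (Tag W × C × S × Option E) :=
  (fun x => if x.1 = t then (x.1, x.2.1, x.2.2.1, none) else x) '' D

/-- `FwdStore sys s' c' st s c t e st₁`: the part of the receipt of a forwarded coded element
in which the server `s'` of `c'` tries to decode and re-encode the value; it changes its state
from `st` to `st₁`. -/
inductive FwdStore {V W G S C E : Type*} [LinearOrder W] (sys : System V S C E) (s' : S) (c' : C)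
    (st : SrvState W G S C E) (s : S) (c : C) (t : Tag W) (e : E) : SrvState W G S C E → Prop
  /-- The tag is already in `List`. -/
  | known (h : ∃ o, (t, o) ∈ st.list) : FwdStore sys s' c' st s c t e st
  /-- The elements from `c` do not yet suffice to decode. -/
  | collect (D' : Set (Tag W × C × S × Option E)) (h : ∀ o, (t, o) ∉ st.list)
      (hD : D' = insert (t, c, s, some e) st.D)
      (hdec : ∀ v, ¬ (sys.cfg c).Decodes {a | (t, c, a.1, some a.2) ∈ D'} v) :
      FwdStore sys s' c' st s c t e { st with D := D' }
  /-- Decode with the code of `c`, re-encode with the code of `c'`. -/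
  | decode (D' : Set (Tag W × C × S × Option E)) (v : V) (h : ∀ o, (t, o) ∉ st.list)
      (hD : D' = insert (t, c, s, some e) st.D)
      (hdec : (sys.cfg c).Decodes {a | (t, c, a.1, some a.2) ∈ D'} v) :
      FwdStore sys s' c' st s c t e
        { st with
          D := eraseElems D' t
          list := insertTrim (sys.cfg c').δ st.list t ((sys.cfg c').enc s' v) }

/-- The server `s'` of `c'` receives the forwarded coded element `e` for the tag `t` from the
server `s` of `c`, on behalf of the phase `ph` of the reconfigurer `g`. -/
inductive SrvFwd {V W R G S C E : Type*} [LinearOrder W] (sys : System V S C E) (s' : S) (c' : C)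
    (st : SrvState W G S C E) (s : S) (c : C) (t : Tag W) (e : E) (g : G) (ph : ℕ) :
    SrvState W G S C E → Multiset (Msg W R G S C E) → Prop
  /-- `g` has been served before. -/
  | ignore (h : g ∈ st.recons) : SrvFwd sys s' c' st s c t e g ph st 0
  /-- The tag is not in `List` yet. -/
  | wait (st₁ : SrvState W G S C E) (h : g ∉ st.recons)
      (h₁ : FwdStore sys s' c' st s c t e st₁) (hl : ∀ o, (t, o) ∉ st₁.list) :
      SrvFwd sys s' c' st s c t e g ph st₁ 0
  /-- The tag is in `List`: acknowledge to `g`. -/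
  | ack (st₁ : SrvState W G S C E) (h : g ∉ st.recons)
      (h₁ : FwdStore sys s' c' st s c t e st₁) (hl : ∃ o, (t, o) ∈ st₁.list) :
      SrvFwd sys s' c' st s c t e g ph { st₁ with recons := insert g st₁.recons }
        {.rep (.recon g) ph s' .ack}

/-! ### Clients -/

/-- Where `read-config` returns to: the start of an operation, or the propagation loop of a read or
write, which has just put the pair `(t, v)` into the configuration with index `ν`. -/
inductive Cont (V W C : Type*)
  | start (o : Op V C)
  | check (o : Op V C) (t : Tag W) (v : V) (ν : ℕ)

/-- Control state of a client. In all states but `idle`, `propose`, `decide` and `ret` the client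
waits for replies of servers.
* `readNext κ i`, `putNext κ i`: in `read-config`, at `read-next-config` in the `i`-th
  configuration, resp. at `put-config` of the `(i+1)`-st entry into the `i`-th configuration;
* `getTag o M i`, `getData M i`: querying the `i`-th configuration, `M` collected before;
* `putData o t v`: propagating `(t, v)` to the last configuration;
* `propose c`, `decide c`, `putNew c`: in `add-config`, about to propose `c`, awaiting the
  decision, and at `put-config`;
* `forward t c`: in `update-config`, awaiting the forwarding of `t` from `c`;
* `putFinal`: at `put-config` in `finalize-config`;
* `ret r`: about to respond. -/
inductive PC (V W C : Type*)
  | idle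
  | readNext (κ : Cont V W C) (i : ℕ)
  | putNext (κ : Cont V W C) (i : ℕ)
  | getTag (o : Op V C) (M : Set (Tag W × C)) (i : ℕ)
  | getData (M : Set (Tag W × V)) (i : ℕ)
  | putData (o : Op V C) (t : Tag W) (v : V)
  | propose (c : C)
  | decide (c : C)
  | putNew (c : C)
  | forward (t : Tag W) (c : C)
  | putFinal
  | ret (r : Res V)

/-- Local state of a client: its configuration sequence, control state, the number of its current
communication phase, and the replies received in that phase. -/
structure ClState (V W S C E : Type*) where
  cseq : List (C × Status)
  pc : PC V W C
  phase : ℕ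
  replies : S → Option (Rep W C E)

/-- Array assignment `q[j] ← x`, extending the sequence if `j` is the first free index. -/
def assign {α : Type*} (q : List α) (j : ℕ) (x : α) : List α :=
  if j < q.length then q.set j x else q ++ [x]

open Classical in
/-- The index `μ` of the last finalized entry. -/
noncomputable def lastFinal {C : Type*} (q : List (C × Status)) : ℕ :=
  Nat.findGreatest (fun j => ∃ c, q[j]? = some (c, .F)) q.length

/-- All servers in some quorum of `c` have acknowledged. -/
def AckedByQuorum {V W S C E : Type*} (sys : System V S C E) (cl : ClState V W S C E) (c : C) :
    Prop :=
  ∃ Q ∈ (sys.cfg c).quorums, ∀ s ∈ Q, cl.replies s = some .ack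

/-- `⌈(n + k) / 2⌉` servers of `c` have acknowledged. -/
def AckedByThreshold {V W S C E : Type*} (sys : System V S C E) (cl : ClState V W S C E) (c : C) :
    Prop :=
  ∃ T ⊆ (sys.cfg c).servers, T.card = (sys.cfg c).threshold ∧ ∀ s ∈ T, cl.replies s = some .ack

/-- `read-next-config` on `c` may return `x`. -/
def NextResult {V W S C E : Type*} (sys : System V S C E) (cl : ClState V W S C E) (c : C)
    (x : Option (C × Status)) : Prop :=
  ∃ Q ∈ (sys.cfg c).quorums, ∃ y : S → Option (C × Status),
    (∀ s ∈ Q, cl.replies s = some (.nextC (y s))) ∧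
    ((∃ s ∈ Q, ∃ d, y s = some (d, .F) ∧ x = some (d, .F)) ∨
     ((∀ s ∈ Q, ∀ d, y s ≠ some (d, .F)) ∧ ∃ s ∈ Q, ∃ d, y s = some (d, .P) ∧ x = some (d, .P)) ∨
     ((∀ s ∈ Q, y s = none) ∧ x = none))

/-- `get-tag` on `c` may return `t`: the largest tag in the replies of `⌈(n + k) / 2⌉` servers. -/
def TagResult {V W S C E : Type*} [LinearOrder W] (sys : System V S C E) (cl : ClState V W S C E)
    (c : C) (t : Tag W) : Prop :=
  ∃ T ⊆ (sys.cfg c).servers, T.card = (sys.cfg c).threshold ∧ ∃ τ : S → Tag W,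
    (∀ s ∈ T, cl.replies s = some (.tag (τ s))) ∧ IsGreatest {t | ∃ s ∈ T, t = τ s} t

open Classical in
/-- `get-data` on `c` may return `(t, v)`: among the lists of `⌈(n + k) / 2⌉` servers, `t` is both
the largest tag that appears in at least `k` lists and the largest tag that appears in at least `k`
lists with a coded element, and `v` is decoded from coded elements for `t`. -/
def DataResult {V W S C E : Type*} [LinearOrder W] (sys : System V S C E) (cl : ClState V W S C E)
    (c : C) (t : Tag W) (v : V) : Prop :=
  ∃ T ⊆ (sys.cfg c).servers, T.card = (sys.cfg c).threshold ∧ ∃ L : S → TagList W E,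
    (∀ s ∈ T, cl.replies s = some (.list (L s))) ∧
    IsGreatest {t | (sys.cfg c).k ≤ (T.filter fun s => ∃ o, (t, o) ∈ L s).card} t ∧
    IsGreatest {t | (sys.cfg c).k ≤ (T.filter fun s => ∃ e, (t, some e) ∈ L s).card} t ∧
    (sys.cfg c).Decodes {a | a.1 ∈ T ∧ (t, some a.2) ∈ L a.1} v

/-- `(t, x)` is an element of `M` with the largest tag. -/
def IsMaxPair {W X : Type*} [LinearOrder W] (M : Set (Tag W × X)) (t : Tag W) (x : X) : Prop :=
  (t, x) ∈ M ∧ ∀ y ∈ M, y.1 ≤ t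

/-- The response of a read or write that has used the pair with value `v`. -/
def result {V C : Type*} : Op V C → V → Res V
  | .read, v => .value v
  | _, _ => .done

/-! ### The algorithm as a transition system -/

/-- Global states. `net` holds the messages in transit; `proposed c` and `decided c` are the values
proposed to and decided by the consensus instance of `c`; `introduced` holds the initial
configuration and those for which a reconfiguration has been invoked. -/
structure State (V W R G S C E : Type*) where
  cl : Client W R G → ClState V W S C E
  srv : S → C → SrvState W G S C E
  net : Multiset (Msg W R G S C E)
  proposed : C → Set C
  decided : C → Option C
  introduced : Set C

/-- The initial state. -/
def State.init {V W R G S C E : Type*} (sys : System V S C E) : State V W R G S C E where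
  cl := fun _ => { cseq := [(sys.c0, .F)], pc := .idle, phase := 0, replies := fun _ => none }
  srv := fun s c => SrvState.init sys s c
  net := 0
  proposed := fun _ => ∅
  decided := fun _ => none
  introduced := {sys.c0}

open Classical in
/-- The client `p` sets its configuration sequence to `q` and its control state to `pc`. -/
noncomputable def State.goto {V W R G S C E : Type*} (σ : State V W R G S C E)
    (p : Client W R G) (q : List (C × Status)) (pc : PC V W C) : State V W R G S C E :=
  { σ with cl := Function.update σ.cl p { σ.cl p with cseq := q, pc := pc } }

open Classical in
/-- As `goto`; moreover `p` starts a new communication phase by sending `b s` to every server `s`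
of `c`. -/
noncomputable def State.call {V W R G S C E : Type*} (sys : System V S C E)
    (σ : State V W R G S C E) (p : Client W R G) (q : List (C × Status)) (pc : PC V W C) (c : C)
    (b : S → Req W C E) : State V W R G S C E :=
  { σ with
    cl := Function.update σ.cl p
      { cseq := q, pc := pc, phase := (σ.cl p).phase + 1, replies := fun _ => none }
    net := σ.net +
      (sys.cfg c).servers.val.map fun s => .req p ((σ.cl p).phase + 1) s c (b s) }

open Classical in
/-- The server `s`, acting for `c`, moves to the state `st'`; the messages in transit become `N`. -/
noncomputable def State.serve {V W R G S C E : Type*} (σ : State V W R G S C E) (s : S) (c : C)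
    (st' : SrvState W G S C E) (N : Multiset (Msg W R G S C E)) : State V W R G S C E :=
  { σ with srv := Function.update σ.srv s (Function.update (σ.srv s) c st'), net := N }

open Classical in
/-- The client `p` receives a reply of the server `s`; replies of earlier phases are dropped. -/
noncomputable def State.receive {V W R G S C E : Type*} (σ : State V W R G S C E)
    (p : Client W R G) (ph : ℕ) (s : S) (r : Rep W C E) (N : Multiset (Msg W R G S C E)) :
    State V W R G S C E :=
  { σ with
    cl := if ph = (σ.cl p).phase then
        Function.update σ.cl p
          { σ.cl p with replies := Function.update (σ.cl p).replies s (some r) }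
      else σ.cl
    net := N }

open Classical in
/-- The steps of the algorithm; `none` labels internal steps. A step is a step of one client or
the delivery of one message. A process that crashes is one that takes no further steps; as no
fairness is imposed on executions, every pattern of crashes and of message delays is covered. -/
inductive Step {V W R G S C E : Type*} [LinearOrder W] (sys : System V S C E) :
    State V W R G S C E → Option (Event V W R G C) → State V W R G S C E → Prop
  /- An idle client invokes an operation and starts `read-config`. The same configuration is
  offered for reconfiguration at most once. -/
  | invoke (σ : State V W R G S C E) (p : Client W R G) (o : Op V C) (q : List (C × Status))
      (x : C × Status) (hq : (σ.cl p).cseq = q) (hpc : (σ.cl p).pc = .idle) (hp : Permits p o)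
      (hfresh : ∀ c, o = .reconfig c → c ∉ σ.introduced) (hx : q[lastFinal q]? = some x) :
      Step sys σ (some (.inv p o))
        { σ.call sys p q (.readNext (.start o) (lastFinal q)) x.1 (fun _ => .readConfig) with
          introduced := σ.introduced ∪ {c | o = .reconfig c} }
  /- `read-config`: a next configuration has been found. -/
  | readNext_some (σ : State V W R G S C E) (p : Client W R G) (κ : Cont V W C) (i : ℕ)
      (q : List (C × Status)) (x y : C × Status) (hq : (σ.cl p).cseq = q)
      (hpc : (σ.cl p).pc = .readNext κ i) (hx : q[i]? = some x)
      (hy : NextResult sys (σ.cl p) x.1 (some y)) :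
      Step sys σ none
        (σ.call sys p (assign q (i + 1) y) (.putNext κ i) x.1 (fun _ => .writeConfig y))
  | putNext_done (σ : State V W R G S C E) (p : Client W R G) (κ : Cont V W C) (i : ℕ)
      (q : List (C × Status)) (x y : C × Status) (hq : (σ.cl p).cseq = q)
      (hpc : (σ.cl p).pc = .putNext κ i) (hx : q[i]? = some x) (hy : q[i + 1]? = some y)
      (hack : AckedByQuorum sys (σ.cl p) x.1) :
      Step sys σ none (σ.call sys p q (.readNext κ (i + 1)) y.1 (fun _ => .readConfig))
  /- `read-config` returns at the start of a read, a write, a reconfiguration. -/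
  | start_read (σ : State V W R G S C E) (p : Client W R G) (i : ℕ)
      (q : List (C × Status)) (x y : C × Status) (hq : (σ.cl p).cseq = q)
      (hpc : (σ.cl p).pc = .readNext (.start .read) i) (hx : q[i]? = some x)
      (hn : NextResult sys (σ.cl p) x.1 none) (hy : q[lastFinal q]? = some y) :
      Step sys σ none (σ.call sys p q (.getData ∅ (lastFinal q)) y.1 (fun _ => .queryList))
  | start_write (σ : State V W R G S C E) (p : Client W R G) (v : V) (i : ℕ)
      (q : List (C × Status)) (x y : C × Status) (hq : (σ.cl p).cseq = q)
      (hpc : (σ.cl p).pc = .readNext (.start (.write v)) i) (hx : q[i]? = some x)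
      (hn : NextResult sys (σ.cl p) x.1 none) (hy : q[lastFinal q]? = some y) :
      Step sys σ none
        (σ.call sys p q (.getTag (.write v) ∅ (lastFinal q)) y.1 (fun _ => .queryTag))
  | start_reconfig (σ : State V W R G S C E) (p : Client W R G) (c : C) (i : ℕ)
      (q : List (C × Status)) (x : C × Status) (hq : (σ.cl p).cseq = q)
      (hpc : (σ.cl p).pc = .readNext (.start (.reconfig c)) i) (hx : q[i]? = some x)
      (hn : NextResult sys (σ.cl p) x.1 none) :
      Step sys σ none (σ.goto p q (.propose c))
  /- `read-config` returns in the propagation loop: no new configuration, resp. a new one. -/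
  | check_done (σ : State V W R G S C E) (p : Client W R G) (o : Op V C) (t : Tag W) (v : V)
      (ν i : ℕ) (q : List (C × Status)) (x : C × Status) (hq : (σ.cl p).cseq = q)
      (hpc : (σ.cl p).pc = .readNext (.check o t v ν) i) (hx : q[i]? = some x)
      (hn : NextResult sys (σ.cl p) x.1 none) (hν : q.length - 1 = ν) :
      Step sys σ none (σ.goto p q (.ret (result o v)))
  | check_again (σ : State V W R G S C E) (p : Client W R G) (o : Op V C) (t : Tag W) (v : V)
      (ν i : ℕ) (q : List (C × Status)) (x y : C × Status) (hq : (σ.cl p).cseq = q)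
      (hpc : (σ.cl p).pc = .readNext (.check o t v ν) i) (hx : q[i]? = some x)
      (hn : NextResult sys (σ.cl p) x.1 none) (hν : q.length - 1 ≠ ν)
      (hy : q.getLast? = some y) :
      Step sys σ none
        (σ.call sys p q (.putData o t v) y.1 (fun s => .putData t ((sys.cfg y.1).enc s v)))
  /- `get-tag` of a write or of `update-config`. -/
  | getTag_next (σ : State V W R G S C E) (p : Client W R G) (o : Op V C)
      (M : Set (Tag W × C)) (i : ℕ) (q : List (C × Status)) (x y : C × Status) (t : Tag W)
      (hq : (σ.cl p).cseq = q) (hpc : (σ.cl p).pc = .getTag o M i) (hx : q[i]? = some x)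
      (ht : TagResult sys (σ.cl p) x.1 t) (hy : q[i + 1]? = some y) :
      Step sys σ none
        (σ.call sys p q (.getTag o (insert (t, x.1) M) (i + 1)) y.1 (fun _ => .queryTag))
  | getTag_write (σ : State V W R G S C E) (w : W) (v : V) (M : Set (Tag W × C)) (i : ℕ)
      (q : List (C × Status)) (x : C × Status) (t tm : Tag W) (cm : C)
      (hq : (σ.cl (.writer w)).cseq = q) (hpc : (σ.cl (.writer w)).pc = .getTag (.write v) M i)
      (hx : q[i]? = some x) (hi : i + 1 = q.length)
      (ht : TagResult sys (σ.cl (.writer w)) x.1 t) (hm : IsMaxPair (insert (t, x.1) M) tm cm) :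
      Step sys σ none
        (σ.call sys (.writer w) q (.putData (.write v) (tm.inc w) v) x.1
          (fun s => .putData (tm.inc w) ((sys.cfg x.1).enc s v)))
  /- `update-config`: ask all servers of `cm` at once to forward their coded elements for the
  largest tag `tm` to the last configuration. -/
  | getTag_reconfig (σ : State V W R G S C E) (p : Client W R G) (c : C) (M : Set (Tag W × C))
      (i : ℕ) (q : List (C × Status)) (x : C × Status) (t tm : Tag W) (cm : C)
      (hq : (σ.cl p).cseq = q) (hpc : (σ.cl p).pc = .getTag (.reconfig c) M i)
      (hx : q[i]? = some x) (hi : i + 1 = q.length)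
      (ht : TagResult sys (σ.cl p) x.1 t) (hm : IsMaxPair (insert (t, x.1) M) tm cm) :
      Step sys σ none (σ.call sys p q (.forward tm cm) cm (fun _ => .reqFwd tm x.1))
  /- `get-data` of a read. -/
  | getData_next (σ : State V W R G S C E) (p : Client W R G) (M : Set (Tag W × V)) (i : ℕ)
      (q : List (C × Status)) (x y : C × Status) (t : Tag W) (v : V)
      (hq : (σ.cl p).cseq = q) (hpc : (σ.cl p).pc = .getData M i) (hx : q[i]? = some x)
      (hd : DataResult sys (σ.cl p) x.1 t v) (hy : q[i + 1]? = some y) :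
      Step sys σ none
        (σ.call sys p q (.getData (insert (t, v) M) (i + 1)) y.1 (fun _ => .queryList))
  | getData_last (σ : State V W R G S C E) (p : Client W R G) (M : Set (Tag W × V)) (i : ℕ)
      (q : List (C × Status)) (x : C × Status) (t tm : Tag W) (v vm : V)
      (hq : (σ.cl p).cseq = q) (hpc : (σ.cl p).pc = .getData M i) (hx : q[i]? = some x)
      (hi : i + 1 = q.length)
      (hd : DataResult sys (σ.cl p) x.1 t v) (hm : IsMaxPair (insert (t, v) M) tm vm) :
      Step sys σ none
        (σ.call sys p q (.putData .read tm vm) x.1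
          (fun s => .putData tm ((sys.cfg x.1).enc s vm)))
  /- `put-data` is complete: check for new configurations. -/
  | putData_done (σ : State V W R G S C E) (p : Client W R G) (o : Op V C) (t : Tag W) (v : V)
      (q : List (C × Status)) (x y : C × Status) (hq : (σ.cl p).cseq = q)
      (hpc : (σ.cl p).pc = .putData o t v) (hx : q.getLast? = some x)
      (hack : AckedByThreshold sys (σ.cl p) x.1) (hy : q[lastFinal q]? = some y) :
      Step sys σ none
        (σ.call sys p q (.readNext (.check o t v (q.length - 1)) (lastFinal q)) y.1
          (fun _ => .readConfig))
  /- `add-config`: the consensus instance of the last configuration decides one of the values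
  proposed to it, the same one for all. -/
  | propose (σ : State V W R G S C E) (p : Client W R G) (c : C) (q : List (C × Status))
      (x : C × Status) (hq : (σ.cl p).cseq = q) (hpc : (σ.cl p).pc = .propose c)
      (hx : q.getLast? = some x) :
      Step sys σ none
        { σ.goto p q (.decide c) with
          proposed := Function.update σ.proposed x.1 (insert c (σ.proposed x.1)) }
  | decide (σ : State V W R G S C E) (p : Client W R G) (c d : C) (q : List (C × Status))
      (x : C × Status) (hq : (σ.cl p).cseq = q) (hpc : (σ.cl p).pc = .decide c)
      (hx : q.getLast? = some x)
      (hd : σ.decided x.1 = some d ∨ (σ.decided x.1 = none ∧ d ∈ σ.proposed x.1)) :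
      Step sys σ none
        { σ.call sys p (q ++ [(d, .P)]) (.putNew c) x.1 (fun _ => .writeConfig (d, .P)) with
          decided := Function.update σ.decided x.1 (some d) }
  | putNew_done (σ : State V W R G S C E) (p : Client W R G) (c : C) (q : List (C × Status))
      (x y : C × Status) (hq : (σ.cl p).cseq = q) (hpc : (σ.cl p).pc = .putNew c)
      (hx : q[q.length - 2]? = some x) (hack : AckedByQuorum sys (σ.cl p) x.1)
      (hy : q[lastFinal q]? = some y) :
      Step sys σ none
        (σ.call sys p q (.getTag (.reconfig c) ∅ (lastFinal q)) y.1 (fun _ => .queryTag))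
  /- `update-config` is complete: `finalize-config`. -/
  | forward_done (σ : State V W R G S C E) (p : Client W R G) (t : Tag W) (cm : C)
      (q : List (C × Status)) (x y : C × Status) (hq : (σ.cl p).cseq = q)
      (hpc : (σ.cl p).pc = .forward t cm) (hx : q.getLast? = some x)
      (hack : AckedByThreshold sys (σ.cl p) x.1) (hy : q[q.length - 2]? = some y) :
      Step sys σ none
        (σ.call sys p (q.set (q.length - 1) (x.1, .F)) .putFinal y.1
          (fun _ => .writeConfig (x.1, .F)))
  | putFinal_done (σ : State V W R G S C E) (p : Client W R G) (q : List (C × Status))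
      (x : C × Status) (hq : (σ.cl p).cseq = q) (hpc : (σ.cl p).pc = .putFinal)
      (hx : q[q.length - 2]? = some x) (hack : AckedByQuorum sys (σ.cl p) x.1) :
      Step sys σ none (σ.goto p q (.ret .done))
  /- The operation returns. -/
  | respond (σ : State V W R G S C E) (p : Client W R G) (r : Res V) (q : List (C × Status))
      (hq : (σ.cl p).cseq = q) (hpc : (σ.cl p).pc = .ret r) :
      Step sys σ (some (.resp p r)) (σ.goto p q .idle)
  /- Delivery of messages. -/
  | deliver_req (σ : State V W R G S C E) (p : Client W R G) (ph : ℕ) (s : S) (c : C)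
      (b : Req W C E) (N out : Multiset (Msg W R G S C E)) (st' : SrvState W G S C E)
      (hnet : σ.net = .req p ph s c b ::ₘ N)
      (h : SrvRecv sys s c (σ.srv s c) p ph b st' out) :
      Step sys σ none (σ.serve s c st' (N + out))
  | deliver_fwd (σ : State V W R G S C E) (s : S) (c : C) (t : Tag W) (e : E) (s' : S) (c' : C)
      (g : G) (ph : ℕ) (N out : Multiset (Msg W R G S C E)) (st' : SrvState W G S C E)
      (hnet : σ.net = .fwd s c t e s' c' g ph ::ₘ N)
      (h : SrvFwd sys s' c' (σ.srv s' c') s c t e g ph st' out) :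
      Step sys σ none (σ.serve s' c' st' (N + out))
  | deliver_rep (σ : State V W R G S C E) (p : Client W R G) (ph : ℕ) (s : S)
      (r : Rep W C E) (N : Multiset (Msg W R G S C E)) (hnet : σ.net = .rep p ph s r ::ₘ N) :
      Step sys σ none (σ.receive p ph s r N)

/-- Executions, finite or infinite: a finite execution is continued by idling forever. -/
structure Execution {V S C E : Type*} (W R G : Type*) [LinearOrder W] (sys : System V S C E) where
  st : ℕ → State V W R G S C E
  ev : ℕ → Option (Event V W R G C)
  init : st 0 = State.init sys
  step : ∀ n, Step sys (st n) (ev n) (st (n + 1)) ∨ (ev n = none ∧ st (n + 1) = st n)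

/-! ### Atomicity

An operation of an execution is identified with the index of its invocation. -/

namespace Execution

variable {V W R G S C E : Type*} [LinearOrder W] {sys : System V S C E}

/-- The event with index `i` is the invocation of a read. -/
def IsRead (ξ : Execution W R G sys) (i : ℕ) : Prop := ∃ p, ξ.ev i = some (.inv p .read)

/-- The event with index `i` is the invocation of a write of `v`. -/
def IsWriteOf (ξ : Execution W R G sys) (i : ℕ) (v : V) : Prop :=
  ∃ p, ξ.ev i = some (.inv p (.write v))

/-- The event with index `i` is the invocation of a write. -/
def IsWrite (ξ : Execution W R G sys) (i : ℕ) : Prop := ∃ v, ξ.IsWriteOf i v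

/-- The operation invoked at `i` receives its response `r` at `j`. -/
def Responds (ξ : Execution W R G sys) (i j : ℕ) (r : Res V) : Prop :=
  i < j ∧ ∃ p o, ξ.ev i = some (.inv p o) ∧ ξ.ev j = some (.resp p r) ∧
    ∀ m, i < m → m < j → ∀ r', ξ.ev m ≠ some (.resp p r')

/-- The operation invoked at `i` is complete. -/
def Complete (ξ : Execution W R G sys) (i : ℕ) : Prop := ∃ j r, ξ.Responds i j r

/-- The operation invoked at `i` completes before the one invoked at `i'` is invoked. -/
def Precedes (ξ : Execution W R G sys) (i i' : ℕ) : Prop := ∃ j r, ξ.Responds i j r ∧ j < i'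

/-- The execution is atomic: there is an irreflexive partial order `lt` on a set `Ops` that consists
of all complete reads and writes and of some incomplete writes such that (A1) `lt` does not
contradict the real-time order, (A2) a write is comparable with every other operation, and (A3) a
read returns the value of the last write that precedes it, or the initial value if there is none. -/
def Atomic (ξ : Execution W R G sys) : Prop :=
  ∃ (Ops : Set ℕ) (lt : ℕ → ℕ → Prop),
    (∀ i ∈ Ops, ξ.IsRead i ∨ ξ.IsWrite i) ∧
    (∀ i, (ξ.IsRead i ∨ ξ.IsWrite i) → ξ.Complete i → i ∈ Ops) ∧
    (∀ i ∈ Ops, ¬ ξ.Complete i → ξ.IsWrite i) ∧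
    (∀ i ∈ Ops, ¬ lt i i) ∧
    (∀ i ∈ Ops, ∀ j ∈ Ops, ∀ l ∈ Ops, lt i j → lt j l → lt i l) ∧
    (∀ i ∈ Ops, ∀ j ∈ Ops, ξ.Precedes i j → ¬ lt j i) ∧
    (∀ i ∈ Ops, ∀ j ∈ Ops, ξ.IsWrite i → i ≠ j → lt i j ∨ lt j i) ∧
    (∀ i ∈ Ops, ξ.IsRead i → ∀ j r, ξ.Responds i j r → ∃ v, r = .value v ∧
      ((∃ w ∈ Ops, ξ.IsWriteOf w v ∧ lt w i ∧
          ∀ w' ∈ Ops, ξ.IsWrite w' → lt w' i → w' ≠ w → lt w' w) ∨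
        ((∀ w ∈ Ops, ξ.IsWrite w → ¬ lt w i) ∧ v = sys.v0)))

/-- No message that a reconfigurer sends or is sent carries coded elements of object values. -/
def ValuesBypassReconfigurers (ξ : Execution W R G sys) : Prop :=
  ∀ (n : ℕ) (g : G), ∀ m ∈ (ξ.st n).net, m.Touches (.recon g) → ¬ m.CarriesData

end Execution

end AresTreas

/-!
Every tag that a read or write propagates is compared with the tags of earlier operations through
*milestones*. The consensus instances arrange all configurations in one global sequence (`Conf`), of
which every client knows an initial segment (`conf_of_cseq`); a configuration is *linked* once the
servers of some quorum know its successor. A milestone (`Milestone`) is a moment at which a tag is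
stored by `⌈(n + k) / 2⌉` servers of a configuration that is not linked, while all configurations
before it are. A read or write returns only after its tag has passed one (`Active.ret`): it has put
its tag into its last configuration, and the final `read-config` shows by quorum intersection that
this configuration was not linked when that phase began.

A later operation finds the tag of a milestone, or a larger one (`Milestone.exists_le`). It begins
with `read-config`, which stops at a configuration that was not linked, hence not before the one of
the milestone. If its query starts at or before that configuration, the sets of servers involved
have `k` members in common (`Config.k_le_card_filter`), so the tag is seen. If it starts at a later
configuration, that one has been finalized, and every configuration beyond the milestone has taken
over the tag before it was finalized (`Milestone.stored_of_finalizes`). The latter holds by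
induction on time: the reconfigurer has queried for tags after its last configuration had been
linked from the preceding ones, hence after the milestone, so that the same case distinction
applies to it, with an earlier finalization in the second case.

Hence tags do not decrease along the real-time order, and they increase at writes
(`Precedes.tag_le`). As a writer runs its operations one after the other, different writes have
different tags (`write_eq_of_tag_eq`), and a tag determines a value (`Val.unique`). All coded
elements in the system are those of the values of their tags (`valInv`), since every set of `k` of
them for the same tag decodes to that value, at readers and at servers that re-encode. Ordering
operations by their tags, a write before the reads with the same tag, gives atomicity.

For the second claim, a request names the control state of its sender (`req_origin`), and the
requests that carry coded elements, or ask for lists, are sent in control states that occur in reads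
and writes only. Elements are forwarded from server to server.
-/

namespace AresTreas

variable {V W R G S C E : Type*}

/-! ### The local view of a step -/

/-- The control states in which a client waits for replies of servers. -/
def PC.Waits : PC V W C → Prop
  | .idle | .propose _ | .decide _ | .ret _ => False
  | _ => True

/-- A client with configuration sequence `q` in a waiting control state has sent the request `b s`
to every server `s` of the configuration `c`. -/
def Asks (sys : System V S C E) (q : List (C × Status)) :
    PC V W C → C → (S → Req W C E) → Prop
  | .readNext _ i, c, b => ∃ x, q[i]? = some x ∧ c = x.1 ∧ b = fun _ => .readConfig
  | .putNext _ i, c, b =>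
      ∃ x y, q[i]? = some x ∧ q[i + 1]? = some y ∧ c = x.1 ∧ b = fun _ => .writeConfig y
  | .getTag _ _ i, c, b => ∃ x, q[i]? = some x ∧ c = x.1 ∧ b = fun _ => .queryTag
  | .getData _ i, c, b => ∃ x, q[i]? = some x ∧ c = x.1 ∧ b = fun _ => .queryList
  | .putData _ t v, c, b =>
      ∃ x, q.getLast? = some x ∧ c = x.1 ∧ b = fun s => .putData t ((sys.cfg x.1).enc s v)
  | .putNew _, c, b | .putFinal, c, b =>
      ∃ x y, q[q.length - 2]? = some x ∧ q.getLast? = some y ∧ c = x.1 ∧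
        b = fun _ => .writeConfig y
  | .forward t cm, c, b => ∃ x, q.getLast? = some x ∧ c = cm ∧ b = fun _ => .reqFwd t x.1
  | _, _, _ => False

/-- `Move sys σ σ' p ev pc q`: a step from `σ` to `σ'`, labelled `ev`, in which the client `p`
passes to the control state `pc` and the configuration sequence `q`. It records those premises of
the steps that the correctness of the algorithm rests on, but not the messages sent, for which see
`Asks`. -/
inductive Move [LinearOrder W] (sys : System V S C E) (σ σ' : State V W R G S C E)
    (p : Client W R G) : Option (Event V W R G C) → PC V W C → List (C × Status) → Prop
  | invoke (o : Op V C) (q : List (C × Status)) (hq : (σ.cl p).cseq = q)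
      (hpc : (σ.cl p).pc = .idle) (hp : Permits p o)
      (hfresh : ∀ c, o = .reconfig c → c ∉ σ.introduced) :
      Move sys σ σ' p (some (.inv p o)) (.readNext (.start o) (lastFinal q)) q
  | readNext_some (κ : Cont V W C) (i : ℕ) (q : List (C × Status)) (x y : C × Status)
      (hq : (σ.cl p).cseq = q) (hpc : (σ.cl p).pc = .readNext κ i) (hx : q[i]? = some x)
      (hy : NextResult sys (σ.cl p) x.1 (some y)) :
      Move sys σ σ' p none (.putNext κ i) (assign q (i + 1) y)
  | putNext_done (κ : Cont V W C) (i : ℕ) (q : List (C × Status)) (x y : C × Status)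
      (hq : (σ.cl p).cseq = q) (hpc : (σ.cl p).pc = .putNext κ i) (hx : q[i]? = some x)
      (hy : q[i + 1]? = some y) (hack : AckedByQuorum sys (σ.cl p) x.1) :
      Move sys σ σ' p none (.readNext κ (i + 1)) q
  | start_read (i : ℕ) (q : List (C × Status)) (x : C × Status) (hq : (σ.cl p).cseq = q)
      (hpc : (σ.cl p).pc = .readNext (.start .read) i) (hx : q[i]? = some x)
      (hn : NextResult sys (σ.cl p) x.1 none) :
      Move sys σ σ' p none (.getData ∅ (lastFinal q)) q
  | start_write (v : V) (i : ℕ) (q : List (C × Status)) (x : C × Status)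
      (hq : (σ.cl p).cseq = q) (hpc : (σ.cl p).pc = .readNext (.start (.write v)) i)
      (hx : q[i]? = some x) (hn : NextResult sys (σ.cl p) x.1 none) :
      Move sys σ σ' p none (.getTag (.write v) ∅ (lastFinal q)) q
  | start_reconfig (c : C) (i : ℕ) (q : List (C × Status)) (hq : (σ.cl p).cseq = q)
      (hpc : (σ.cl p).pc = .readNext (.start (.reconfig c)) i) :
      Move sys σ σ' p none (.propose c) q
  | check_done (o : Op V C) (t : Tag W) (v : V) (ν i : ℕ) (q : List (C × Status))
      (x : C × Status) (hq : (σ.cl p).cseq = q)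
      (hpc : (σ.cl p).pc = .readNext (.check o t v ν) i) (hx : q[i]? = some x)
      (hn : NextResult sys (σ.cl p) x.1 none) (hν : q.length - 1 = ν) :
      Move sys σ σ' p none (.ret (result o v)) q
  | check_again (o : Op V C) (t : Tag W) (v : V) (ν i : ℕ) (q : List (C × Status))
      (hq : (σ.cl p).cseq = q) (hpc : (σ.cl p).pc = .readNext (.check o t v ν) i) :
      Move sys σ σ' p none (.putData o t v) q
  | getTag_next (o : Op V C) (M : Set (Tag W × C)) (i : ℕ) (q : List (C × Status))
      (x y : C × Status) (t : Tag W) (hq : (σ.cl p).cseq = q)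
      (hpc : (σ.cl p).pc = .getTag o M i) (hx : q[i]? = some x)
      (ht : TagResult sys (σ.cl p) x.1 t) (hy : q[i + 1]? = some y) :
      Move sys σ σ' p none (.getTag o (insert (t, x.1) M) (i + 1)) q
  | getTag_write (w : W) (hp : p = .writer w) (v : V) (M : Set (Tag W × C)) (i : ℕ)
      (q : List (C × Status)) (x : C × Status) (t tm : Tag W) (cm : C)
      (hq : (σ.cl p).cseq = q) (hpc : (σ.cl p).pc = .getTag (.write v) M i)
      (hx : q[i]? = some x) (hi : i + 1 = q.length)
      (ht : TagResult sys (σ.cl p) x.1 t) (hm : IsMaxPair (insert (t, x.1) M) tm cm) :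
      Move sys σ σ' p none (.putData (.write v) (tm.inc w) v) q
  | getTag_reconfig (c : C) (M : Set (Tag W × C)) (i : ℕ) (q : List (C × Status))
      (x : C × Status) (t tm : Tag W) (cm : C) (hq : (σ.cl p).cseq = q)
      (hpc : (σ.cl p).pc = .getTag (.reconfig c) M i)
      (hx : q[i]? = some x) (hi : i + 1 = q.length)
      (ht : TagResult sys (σ.cl p) x.1 t) (hm : IsMaxPair (insert (t, x.1) M) tm cm) :
      Move sys σ σ' p none (.forward tm cm) q
  | getData_next (M : Set (Tag W × V)) (i : ℕ) (q : List (C × Status)) (x y : C × Status)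
      (t : Tag W) (v : V) (hq : (σ.cl p).cseq = q) (hpc : (σ.cl p).pc = .getData M i)
      (hx : q[i]? = some x) (hd : DataResult sys (σ.cl p) x.1 t v) (hy : q[i + 1]? = some y) :
      Move sys σ σ' p none (.getData (insert (t, v) M) (i + 1)) q
  | getData_last (M : Set (Tag W × V)) (i : ℕ) (q : List (C × Status)) (x : C × Status)
      (t tm : Tag W) (v vm : V) (hq : (σ.cl p).cseq = q) (hpc : (σ.cl p).pc = .getData M i)
      (hx : q[i]? = some x) (hi : i + 1 = q.length)
      (hd : DataResult sys (σ.cl p) x.1 t v) (hm : IsMaxPair (insert (t, v) M) tm vm) :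
      Move sys σ σ' p none (.putData .read tm vm) q
  | putData_done (o : Op V C) (t : Tag W) (v : V) (q : List (C × Status)) (x : C × Status)
      (hq : (σ.cl p).cseq = q) (hpc : (σ.cl p).pc = .putData o t v)
      (hx : q.getLast? = some x) (hack : AckedByThreshold sys (σ.cl p) x.1) :
      Move sys σ σ' p none (.readNext (.check o t v (q.length - 1)) (lastFinal q)) q
  | propose (c : C) (q : List (C × Status)) (hq : (σ.cl p).cseq = q)
      (hpc : (σ.cl p).pc = .propose c) :
      Move sys σ σ' p none (.decide c) q
  | decide (c d : C) (q : List (C × Status)) (x : C × Status) (hq : (σ.cl p).cseq = q)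
      (hpc : (σ.cl p).pc = .decide c) (hx : q.getLast? = some x)
      (hd : σ'.decided x.1 = some d) :
      Move sys σ σ' p none (.putNew c) (q ++ [(d, .P)])
  | putNew_done (c : C) (q : List (C × Status)) (x : C × Status) (hq : (σ.cl p).cseq = q)
      (hpc : (σ.cl p).pc = .putNew c) (hx : q[q.length - 2]? = some x)
      (hack : AckedByQuorum sys (σ.cl p) x.1) :
      Move sys σ σ' p none (.getTag (.reconfig c) ∅ (lastFinal q)) q
  | forward_done (t : Tag W) (cm : C) (q : List (C × Status)) (x : C × Status)
      (hq : (σ.cl p).cseq = q) (hpc : (σ.cl p).pc = .forward t cm)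
      (hx : q.getLast? = some x) (hack : AckedByThreshold sys (σ.cl p) x.1) :
      Move sys σ σ' p none .putFinal (q.set (q.length - 1) (x.1, .F))
  | putFinal_done (q : List (C × Status)) (hq : (σ.cl p).cseq = q)
      (hpc : (σ.cl p).pc = .putFinal) :
      Move sys σ σ' p none (.ret .done) q
  | respond (r : Res V) (q : List (C × Status)) (hq : (σ.cl p).cseq = q)
      (hpc : (σ.cl p).pc = .ret r) :
      Move sys σ σ' p (some (.resp p r)) .idle q

/-- In the state `σ` the server `s`, acting for `c`, may receive a message, upon which it moves to
the state `st'` and sends the messages `out`. -/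
def Serves [LinearOrder W] (sys : System V S C E) (σ : State V W R G S C E) (s : S) (c : C)
    (st' : SrvState W G S C E) (out : Multiset (Msg W R G S C E)) : Prop :=
  (∃ p ph b, .req p ph s c b ∈ σ.net ∧ SrvRecv sys s c (σ.srv s c) p ph b st' out) ∨
  ∃ s₀ c₀ t e g ph, .fwd s₀ c₀ t e s c g ph ∈ σ.net ∧
    SrvFwd sys s c (σ.srv s c) s₀ c₀ t e g ph st' out

/-- Between `σ` and `σ'` the client `p` has at most received a reply; the reply belongs to its
current phase, as others are dropped. -/
structure Rests (σ σ' : State V W R G S C E) (p : Client W R G)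
    (ev : Option (Event V W R G C)) : Prop where
  pc : (σ'.cl p).pc = (σ.cl p).pc
  cseq : (σ'.cl p).cseq = (σ.cl p).cseq
  phase : (σ'.cl p).phase = (σ.cl p).phase
  replies : ∀ s r, (σ'.cl p).replies s = some r →
    (σ.cl p).replies s = some r ∨ .rep p (σ.cl p).phase s r ∈ σ.net
  inv : ∀ o, ev ≠ some (.inv p o)
  resp : ∀ r, ev ≠ some (.resp p r)

/-- Between `σ` and `σ'` the client `p` has performed a step of its own. The step starts a new
communication phase if and only if the client waits afterwards. -/
structure Moves [LinearOrder W] (sys : System V S C E) (σ σ' : State V W R G S C E)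
    (p : Client W R G) (ev : Option (Event V W R G C)) : Prop where
  move : Move sys σ σ' p ev (σ'.cl p).pc (σ'.cl p).cseq
  phase : ((σ'.cl p).phase = (σ.cl p).phase ∧ ¬ (σ'.cl p).pc.Waits) ∨
    ((σ'.cl p).phase = (σ.cl p).phase + 1 ∧ (∀ s, (σ'.cl p).replies s = none) ∧
      (σ'.cl p).pc.Waits)
  replies : ∀ s r, (σ'.cl p).replies s = some r → (σ.cl p).replies s = some r

variable [LinearOrder W] {sys : System V S C E}

theorem getElem?_assign {α : Type*} (q : List α) (j : ℕ) (x : α) (hj : j ≤ q.length) (i : ℕ) :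
    (assign q j x)[i]? = if i = j then some x else q[i]? := by
  unfold assign
  split_ifs with h1 h2 h2
  · subst h2; simp [h1]
  · rw [List.getElem?_set_ne (Ne.symm h2)]
  · subst h2
    have : i = q.length := by omega
    subst this; simp
  · have : j = q.length := by omega
    subst this
    rcases lt_or_gt_of_ne h2 with h | h
    · rw [List.getElem?_append_left h]
    · rw [List.getElem?_eq_none (by simp; omega), List.getElem?_eq_none (by omega)]

theorem length_assign {α : Type*} (q : List α) (j : ℕ) (x : α) (hj : j ≤ q.length) :
    (assign q j x).length = max q.length (j + 1) := by
  unfold assign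
  split_ifs with h1
  · simp; omega
  · simp; omega

theorem lt_length_of_getElem? {α : Type*} {q : List α} {i : ℕ} {x : α} (h : q[i]? = some x) :
    i < q.length := by
  by_contra hc
  rw [List.getElem?_eq_none (by omega)] at h
  cases h

theorem getLast?_eq_some_of_getElem? {α : Type*} {q : List α} {i : ℕ} {x : α}
    (h : q[i]? = some x) (hi : i + 1 = q.length) : q.getLast? = some x := by
  rw [List.getLast?_eq_getElem?, ← h]; congr 1; omega

theorem getElem?_length_append_singleton {α : Type*} {q : List α} {x : α}
    (h : q.getLast? = some x) (y : α) : (q ++ [y])[(q ++ [y]).length - 2]? = some x := by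
  rw [List.getLast?_eq_getElem?] at h
  have := lt_length_of_getElem? h
  rw [List.getElem?_append_left (by simp; omega), ← h]
  congr 1; simp

theorem getLast?_set_last {α : Type*} {q : List α} {x : α} (h : q.getLast? = some x) (y : α) :
    (q.set (q.length - 1) y).getLast? = some y := by
  rw [List.getLast?_eq_getElem?] at h ⊢
  have := lt_length_of_getElem? h
  simp only [List.length_set, List.getElem?_set_self', Option.map_eq_map]
  rw [h]; rfl

theorem getElem?_set_last {q : List (C × Status)} {x y : C × Status} (h : q.getLast? = some x)
    (hy : q[q.length - 2]? = some y) (f : Status) :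
    ∃ z, (q.set (q.length - 1) (x.1, f))[(q.set (q.length - 1) (x.1, f)).length - 2]? = some z ∧
      y.1 = z.1 := by
  rw [List.getLast?_eq_getElem?] at h
  have := lt_length_of_getElem? h
  by_cases h2 : q.length - 1 = q.length - 2
  · rw [h2] at h ⊢
    rw [h] at hy; cases hy
    exact ⟨(x.1, f), by rw [List.length_set, List.getElem?_set_self', h]; rfl, rfl⟩
  · exact ⟨y, by rw [List.length_set, List.getElem?_set_ne h2, hy], rfl⟩

theorem moves_call {σ σ' : State V W R G S C E} {ev : Option (Event V W R G C)}
    {p₀ : Client W R G} {q : List (C × Status)} {pc : PC V W C} {c : C} {b : S → Req W C E}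
    (hσ : σ'.cl = (σ.call sys p₀ q pc c b).cl) (hm : Move sys σ σ' p₀ ev pc q) (hw : pc.Waits)
    (hev : ∀ p, p ≠ p₀ → (∀ o, ev ≠ some (.inv p o)) ∧ ∀ r, ev ≠ some (.resp p r))
    (p : Client W R G) : Rests σ σ' p ev ∨ Moves sys σ σ' p ev := by
  by_cases hp : p = p₀
  · subst hp
    right
    have h : σ'.cl p = ⟨q, pc, (σ.cl p).phase + 1, fun _ => none⟩ := by simp [hσ, State.call]
    exact ⟨by rw [h]; exact hm,
      Or.inr ⟨by rw [h], by rw [h]; simp, by rw [h]; exact hw⟩,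
      by rw [h]; simp⟩
  · left
    have h : σ'.cl p = σ.cl p := by simp [hσ, State.call, hp]
    exact ⟨by rw [h], by rw [h], by rw [h], by rw [h]; tauto, (hev p hp).1, (hev p hp).2⟩

theorem moves_goto {σ σ' : State V W R G S C E} {ev : Option (Event V W R G C)}
    {p₀ : Client W R G} {q : List (C × Status)} {pc : PC V W C}
    (hσ : σ'.cl = (σ.goto p₀ q pc).cl) (hm : Move sys σ σ' p₀ ev pc q) (hw : ¬ pc.Waits)
    (hev : ∀ p, p ≠ p₀ → (∀ o, ev ≠ some (.inv p o)) ∧ ∀ r, ev ≠ some (.resp p r))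
    (p : Client W R G) : Rests σ σ' p ev ∨ Moves sys σ σ' p ev := by
  by_cases hp : p = p₀
  · subst hp
    right
    have h : σ'.cl p = { σ.cl p with cseq := q, pc := pc } := by simp [hσ, State.goto]
    exact ⟨by rw [h]; exact hm, Or.inl ⟨by rw [h], by rw [h]; exact hw⟩, by rw [h]; tauto⟩
  · left
    have h : σ'.cl p = σ.cl p := by simp [hσ, State.goto, hp]
    exact ⟨by rw [h], by rw [h], by rw [h], by rw [h]; tauto, (hev p hp).1, (hev p hp).2⟩

/-- Every step is the start of a communication phase of a client, a local step of a client, the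
delivery of a reply, or the receipt of a message by a server. -/
theorem Step.kind {σ σ' : State V W R G S C E} {ev : Option (Event V W R G C)}
    (h : Step sys σ ev σ') :
    (∃ p q pc c b, σ'.cl = (σ.call sys p q pc c b).cl ∧ σ'.net = (σ.call sys p q pc c b).net ∧
      Move sys σ σ' p ev pc q ∧ pc.Waits ∧ Asks sys q pc c b ∧
      ∀ p', p' ≠ p → (∀ o, ev ≠ some (.inv p' o)) ∧ ∀ r, ev ≠ some (.resp p' r)) ∨
    (∃ p q pc, σ'.cl = (σ.goto p q pc).cl ∧ σ'.net = σ.net ∧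
      Move sys σ σ' p ev pc q ∧ ¬ pc.Waits ∧
      ∀ p', p' ≠ p → (∀ o, ev ≠ some (.inv p' o)) ∧ ∀ r, ev ≠ some (.resp p' r)) ∨
    (ev = none ∧ ∃ p ph s r N, σ.net = .rep p ph s r ::ₘ N ∧ σ' = σ.receive p ph s r N) ∨
    (ev = none ∧ ∃ s c N N' out st' m, σ.net = m ::ₘ N ∧ N' = N + out ∧
      Serves sys σ s c st' out ∧ σ' = σ.serve s c st' N') := by
  cases h with
  | invoke p₀ o q x hq hpc hp' hfresh hx =>
    exact Or.inl ⟨_, _, _, _, _, rfl, rfl, .invoke o q hq hpc hp' hfresh, trivial,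
      ⟨x, hx, rfl, rfl⟩, fun p hp => by simp [Ne.symm hp]⟩
  | readNext_some p₀ κ i q x y hq hpc hx hy =>
    have hi := lt_length_of_getElem? hx
    exact Or.inl ⟨_, _, _, _, _, rfl, rfl, .readNext_some κ i q x y hq hpc hx hy, trivial,
      ⟨x, y, by rw [getElem?_assign _ _ _ (by omega)]; simp [hx],
        by rw [getElem?_assign _ _ _ (by omega)]; simp, rfl, rfl⟩, by simp⟩
  | putNext_done p₀ κ i q x y hq hpc hx hy hack =>
    exact Or.inl ⟨_, _, _, _, _, rfl, rfl,
      .putNext_done κ i q x y hq hpc hx hy hack, trivial,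
      ⟨y, hy, rfl, rfl⟩, by simp⟩
  | start_read p₀ i q x y hq hpc hx hn hy =>
    exact Or.inl ⟨_, _, _, _, _, rfl, rfl, .start_read i q x hq hpc hx hn, trivial,
      ⟨y, hy, rfl, rfl⟩, by simp⟩
  | start_write p₀ v i q x y hq hpc hx hn hy =>
    exact Or.inl ⟨_, _, _, _, _, rfl, rfl, .start_write v i q x hq hpc hx hn, trivial,
      ⟨y, hy, rfl, rfl⟩, by simp⟩
  | start_reconfig p₀ c i q x hq hpc hx hn =>
    exact Or.inr (Or.inl ⟨p₀, _, _, rfl, rfl, .start_reconfig c i q hq hpc, id, by simp⟩)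
  | check_done p₀ o t v ν i q x hq hpc hx hn hν =>
    exact Or.inr (Or.inl ⟨p₀, _, _, rfl, rfl, .check_done o t v ν i q x hq hpc hx hn hν, id,
      by simp⟩)
  | check_again p₀ o t v ν i q x y hq hpc hx hn hν hy =>
    exact Or.inl ⟨_, _, _, _, _, rfl, rfl, .check_again o t v ν i q hq hpc, trivial,
      ⟨y, hy, rfl, rfl⟩, by simp⟩
  | getTag_next p₀ o M i q x y t hq hpc hx ht hy =>
    exact Or.inl ⟨_, _, _, _, _, rfl, rfl,
      .getTag_next o M i q x y t hq hpc hx ht hy, trivial,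
      ⟨y, hy, rfl, rfl⟩, by simp⟩
  | getTag_write w v M i q x t tm cm hq hpc hx hi ht hm =>
    exact Or.inl ⟨_, _, _, _, _, rfl, rfl,
      .getTag_write w rfl v M i q x t tm cm hq hpc hx hi ht hm, trivial,
      ⟨x, getLast?_eq_some_of_getElem? hx hi, rfl, rfl⟩, by simp⟩
  | getTag_reconfig p₀ c M i q x t tm cm hq hpc hx hi ht hm =>
    exact Or.inl ⟨_, _, _, _, _, rfl, rfl,
      .getTag_reconfig c M i q x t tm cm hq hpc hx hi ht hm, trivial,
      ⟨x, getLast?_eq_some_of_getElem? hx hi, rfl, rfl⟩, by simp⟩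
  | getData_next p₀ M i q x y t v hq hpc hx hd hy =>
    exact Or.inl ⟨_, _, _, _, _, rfl, rfl,
      .getData_next M i q x y t v hq hpc hx hd hy, trivial,
      ⟨y, hy, rfl, rfl⟩, by simp⟩
  | getData_last p₀ M i q x t tm v vm hq hpc hx hi hd hm =>
    exact Or.inl ⟨_, _, _, _, _, rfl, rfl,
      .getData_last M i q x t tm v vm hq hpc hx hi hd hm, trivial,
      ⟨x, getLast?_eq_some_of_getElem? hx hi, rfl, rfl⟩, by simp⟩
  | putData_done p₀ o t v q x y hq hpc hx hack hy =>
    exact Or.inl ⟨_, _, _, _, _, rfl, rfl, .putData_done o t v q x hq hpc hx hack, trivial,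
      ⟨y, hy, rfl, rfl⟩, by simp⟩
  | propose p₀ c q x hq hpc hx =>
    exact Or.inr (Or.inl ⟨p₀, _, _, rfl, rfl, .propose c q hq hpc, id, by simp⟩)
  | decide p₀ c d q x hq hpc hx hd =>
    exact Or.inl ⟨_, _, _, _, _, rfl, rfl, .decide c d q x hq hpc hx (by simp), trivial,
      ⟨x, (d, .P), getElem?_length_append_singleton hx _, by simp, rfl, rfl⟩, by simp⟩
  | putNew_done p₀ c q x y hq hpc hx hack hy =>
    exact Or.inl ⟨_, _, _, _, _, rfl, rfl, .putNew_done c q x hq hpc hx hack, trivial,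
      ⟨y, hy, rfl, rfl⟩, by simp⟩
  | forward_done p₀ t cm q x y hq hpc hx hack hy =>
    obtain ⟨z, hz, hzy⟩ := getElem?_set_last hx hy .F
    exact Or.inl ⟨_, _, _, _, _, rfl, rfl, .forward_done t cm q x hq hpc hx hack, trivial,
      ⟨z, (x.1, .F), hz, getLast?_set_last hx _, hzy, rfl⟩, by simp⟩
  | putFinal_done p₀ q x hq hpc hx hack =>
    exact Or.inr (Or.inl ⟨p₀, _, _, rfl, rfl, .putFinal_done q hq hpc, id, by simp⟩)
  | respond p₀ r q hq hpc =>
    exact Or.inr (Or.inl ⟨p₀, _, _, rfl, rfl, .respond r q hq hpc, id,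
      fun p hp => by simp [Ne.symm hp]⟩)
  | deliver_req p ph s c b N out st' hnet h =>
    exact Or.inr (Or.inr (Or.inr ⟨rfl, s, c, N, _, out, st', _, hnet, rfl,
      Or.inl ⟨p, ph, b, by simp [hnet], h⟩, rfl⟩))
  | deliver_fwd s₁ c₁ t e s c g ph N out st' hnet h =>
    exact Or.inr (Or.inr (Or.inr ⟨rfl, s, c, N, _, out, st', _, hnet, rfl,
      Or.inr ⟨s₁, c₁, t, e, g, ph, by simp [hnet], h⟩, rfl⟩))
  | deliver_rep p ph s r N hnet =>
    exact Or.inr (Or.inr (Or.inl ⟨rfl, p, ph, s, r, N, hnet, rfl⟩))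

/-- From the point of view of a single client, a step of the system is either a step of this client
or leaves everything but its replies unchanged. -/
theorem Step.client {σ σ' : State V W R G S C E} {ev : Option (Event V W R G C)}
    (h : Step sys σ ev σ') (p : Client W R G) :
    Rests σ σ' p ev ∨ Moves sys σ σ' p ev := by
  classical
  rcases h.kind with ⟨p₀, q, pc, c, b, hcl, -, hm, hw, -, hev⟩ | ⟨p₀, q, pc, hcl, -, hm, hw, hev⟩ |
    ⟨rfl, p₀, ph, s, r, N, hnet, rfl⟩ | ⟨rfl, s, c, N, N', out, st', m, hnet, hN, hs, rfl⟩
  · exact moves_call hcl hm hw hev p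
  · exact moves_goto hcl hm hw hev p
  · left
    by_cases hph : ph = (σ.cl p₀).phase ∧ p = p₀
    · obtain ⟨hph, rfl⟩ := hph
      refine ⟨by simp [State.receive, hph], by simp [State.receive, hph],
        by simp [State.receive, hph], ?_, by simp, by simp⟩
      intro s' r' h
      simp only [State.receive, hph, if_true, Function.update_self] at h
      by_cases hs : s' = s
      · subst hs
        rw [Function.update_self] at h
        cases h
        right; rw [hnet, hph]; exact Multiset.mem_cons_self _ _
      · rw [Function.update_of_ne hs] at h
        exact Or.inl h
    · have : (σ.receive p₀ ph s r N).cl p = σ.cl p := by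
        by_cases h : ph = (σ.cl p₀).phase
        · have hp : p ≠ p₀ := fun hp => hph ⟨h, hp⟩
          simp [State.receive, h, hp]
        · simp [State.receive, h]
      exact ⟨by rw [this], by rw [this], by rw [this], by rw [this]; tauto, by simp, by simp⟩
  · exact Or.inl ⟨rfl, rfl, rfl, fun s r h => Or.inl h, by simp, by simp⟩

/-- The server state after a step. -/
theorem Step.server {σ σ' : State V W R G S C E} {ev : Option (Event V W R G C)}
    (h : Step sys σ ev σ') (s : S) (c : C) :
    σ'.srv s c = σ.srv s c ∨ ∃ out, Serves sys σ s c (σ'.srv s c) out := by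
  classical
  obtain hσ | ⟨s₀, c₀, N', out, st', hs, rfl⟩ : σ'.srv = σ.srv ∨ ∃ s₀ c₀ N' out st',
      Serves sys σ s₀ c₀ st' out ∧ σ' = σ.serve s₀ c₀ st' N' := by
    cases h with
    | deliver_req p ph s c b N out st' hnet h =>
      exact Or.inr ⟨s, c, _, out, st', Or.inl ⟨p, ph, b, by simp [hnet], h⟩, rfl⟩
    | deliver_fwd s₁ c₁ t e s c g ph N out st' hnet h =>
      exact Or.inr ⟨s, c, _, out, st', Or.inr ⟨s₁, c₁, t, e, g, ph, by simp [hnet], h⟩, rfl⟩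
    | _ => exact Or.inl rfl
  · exact Or.inl (by rw [hσ])
  · by_cases h₁ : s = s₀
    · subst h₁
      by_cases h₂ : c = c₀
      · subst h₂
        exact Or.inr ⟨out, by simpa [State.serve] using hs⟩
      · exact Or.inl (by simp [State.serve, h₂])
    · exact Or.inl (by simp [State.serve, h₁])

/-- The origin of a message: a client that enters a communication phase, or a server. -/
theorem Step.net {σ σ' : State V W R G S C E} {ev : Option (Event V W R G C)}
    (h : Step sys σ ev σ') {m : Msg W R G S C E} (hm : m ∈ σ'.net) :
    m ∈ σ.net ∨
    (∃ p c b, ∃ s ∈ (sys.cfg c).servers, m = .req p (σ'.cl p).phase s c (b s) ∧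
        (σ'.cl p).phase = (σ.cl p).phase + 1 ∧ Asks sys (σ'.cl p).cseq (σ'.cl p).pc c b) ∨
    ∃ s c out, m ∈ out ∧ Serves sys σ s c (σ'.srv s c) out := by
  rcases h.kind with ⟨p, q, pc, c, b, hcl, hnet, -, -, ha, -⟩ | ⟨p, q, pc, -, hnet, -⟩ |
    ⟨rfl, p, ph, s, r, N, hnet, rfl⟩ | ⟨rfl, s, c, N, N', out, st', m', hnet, rfl, hs, rfl⟩
  · have h : σ'.cl p = ⟨q, pc, (σ.cl p).phase + 1, fun _ => none⟩ := by simp [hcl, State.call]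
    rw [hnet] at hm
    rcases Multiset.mem_add.1 hm with hm | hm
    · exact Or.inl hm
    · obtain ⟨s, hs, rfl⟩ := Multiset.mem_map.1 hm
      exact Or.inr (Or.inl ⟨p, c, b, s, hs, by rw [h], by rw [h], by rw [h]; exact ha⟩)
  · exact Or.inl (hnet ▸ hm)
  · exact Or.inl (by rw [hnet]; exact Multiset.mem_cons_of_mem hm)
  · rcases Multiset.mem_add.1 hm with hm | hm
    · exact Or.inl (by rw [hnet]; exact Multiset.mem_cons_of_mem hm)
    · exact Or.inr (Or.inr ⟨s, c, out, hm, by simpa [State.serve] using hs⟩)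

/-- A step changes the set of configurations submitted for reconfiguration and the consensus
instances only by an invocation, a proposal or a decision. -/
theorem Step.shared {σ σ' : State V W R G S C E} {ev : Option (Event V W R G C)}
    (h : Step sys σ ev σ') :
    (σ'.introduced = σ.introduced ∧ σ'.proposed = σ.proposed ∧ σ'.decided = σ.decided ∧
      (∀ p c, ev ≠ some (.inv p (.reconfig c)))) ∨
    (∃ p c, σ'.introduced = σ.introduced ∪ {c} ∧ σ'.proposed = σ.proposed ∧
      σ'.decided = σ.decided ∧ ev = some (.inv p (.reconfig c)) ∧ c ∉ σ.introduced) ∨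
    (∃ p c x, σ'.introduced = σ.introduced ∧ ev = none ∧
      (∀ d a, d ∈ σ'.proposed a ↔ d ∈ σ.proposed a ∨ (d = c ∧ a = x)) ∧
      σ'.decided = σ.decided ∧ (σ.cl p).pc = .propose c ∧ (σ'.cl p).pc = .decide c) ∨
    (∃ d a, σ'.introduced = σ.introduced ∧ ev = none ∧ σ'.proposed = σ.proposed ∧
      (∀ a', a' ≠ a → σ'.decided a' = σ.decided a') ∧ σ'.decided a = some d ∧
      (σ.decided a = some d ∨ (σ.decided a = none ∧ d ∈ σ.proposed a))) := by
  classical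
  cases h with
  | invoke p o q x hq hpc hp hfresh hx =>
    cases o with
    | reconfig c =>
      refine Or.inr (Or.inl ⟨p, c, ?_, rfl, rfl, rfl, hfresh c rfl⟩)
      ext a; simp [eq_comm]
    | _ => refine Or.inl ⟨?_, rfl, rfl, by simp⟩; ext a; simp
  | propose p c q x hq hpc hx =>
    refine Or.inr (Or.inr (Or.inl ⟨p, c, x.1, rfl, rfl, ?_, rfl, hpc, by simp [State.goto]⟩))
    intro d a
    by_cases h : a = x.1
    · subst h; simp [or_comm]
    · simp [h]
  | decide p c d q x hq hpc hx hd =>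
    exact Or.inr (Or.inr (Or.inr ⟨d, x.1, rfl, rfl, rfl, fun a' ha => by simp [ha],
      by simp, hd⟩))
  | respond => exact Or.inl ⟨rfl, rfl, rfl, by simp⟩
  | _ => exact Or.inl ⟨rfl, rfl, rfl, by simp⟩

/-! ### Servers -/

/-- The tag `t` occurs in `List`. -/
def SrvState.Has (st : SrvState W G S C E) (t : Tag W) : Prop := ∃ o, (t, o) ∈ st.list

/-- Trimming keeps all tags. -/
theorem exists_mem_insertTrim {δ : ℕ} {L : TagList W E} {t t' : Tag W} {e : E} :
    (∃ o, (t', o) ∈ insertTrim δ L t e) ↔ t' = t ∨ ∃ o, (t', o) ∈ L := by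
  classical
  have h : (∃ o, (t', o) ∈ insert (t, some e) L) ↔ t' = t ∨ ∃ o, (t', o) ∈ L := by
    constructor
    · rintro ⟨o, ho⟩
      rcases Finset.mem_insert.1 ho with h | h
      · exact Or.inl (congrArg Prod.fst h)
      · exact Or.inr ⟨o, h⟩
    · rintro (rfl | ⟨o, ho⟩)
      · exact ⟨some e, Finset.mem_insert_self _ _⟩
      · exact ⟨o, Finset.mem_insert_of_mem ho⟩
  rw [← h]
  unfold insertTrim
  dsimp only
  split_ifs with hc
  · constructor
    · rintro ⟨o, ho⟩
      obtain ⟨x, hx, hxo⟩ := Finset.mem_image.1 ho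
      have : x.1 = t' := by split_ifs at hxo <;> exact congrArg Prod.fst hxo
      exact ⟨x.2, by rw [← this]; convert hx⟩
    · rintro ⟨o, ho⟩
      by_cases ho' : IsOldest (insert (t, some e) L) t'
      · exact ⟨none, Finset.mem_image.2 ⟨(t', o), by convert ho, by rw [if_pos]; convert ho'⟩⟩
      · exact ⟨o, Finset.mem_image.2 ⟨(t', o), by convert ho, by rw [if_neg]; convert ho'⟩⟩
  · simp only [Finset.mem_insert]

/-- Trimming only erases coded elements. -/
theorem mem_of_mem_insertTrim {δ : ℕ} {L : TagList W E} {t t' : Tag W} {e e' : E}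
    (h : (t', some e') ∈ insertTrim δ L t e) : (t' = t ∧ e' = e) ∨ (t', some e') ∈ L := by
  classical
  have : (t', some e') ∈ insert (t, some e) L := by
    unfold insertTrim at h
    dsimp only at h
    split_ifs at h with hc
    · obtain ⟨x, hx, hxo⟩ := Finset.mem_image.1 h
      split_ifs at hxo
      · simp at hxo
      · rw [← hxo]; convert hx
    · convert h
  rcases Finset.mem_insert.1 this with h | h
  · simp only [Prod.mk.injEq, Option.some.injEq] at h
    exact Or.inl h
  · exact Or.inr h

theorem FwdStore.has {s' : S} {c' : C} {st st₁ : SrvState W G S C E} {s : S} {c : C} {t : Tag W}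
    {e : E} (h : FwdStore sys s' c' st s c t e st₁) {t' : Tag W} (ht : st.Has t') :
    st₁.Has t' := by
  cases h with
  | known => exact ht
  | collect => exact ht
  | decode => exact exists_mem_insertTrim.2 (Or.inr ht)

theorem FwdStore.nextC {s' : S} {c' : C} {st st₁ : SrvState W G S C E} {s : S} {c : C}
    {t : Tag W} {e : E} (h : FwdStore sys s' c' st s c t e st₁) : st₁.nextC = st.nextC := by
  cases h <;> rfl

theorem Serves.has {σ : State V W R G S C E} {s : S} {c : C} {st' : SrvState W G S C E}
    {out : Multiset (Msg W R G S C E)} (h : Serves sys σ s c st' out) {t : Tag W}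
    (ht : (σ.srv s c).Has t) : st'.Has t := by
  rcases h with ⟨p, ph, b, -, h⟩ | ⟨s₀, c₀, t', e, g, ph, -, h⟩
  · cases h with
    | putData => exact exists_mem_insertTrim.2 (Or.inr ht)
    | _ => exact ht
  · cases h with
    | ignore => exact ht
    | wait _ _ h₁ => exact h₁.has ht
    | ack _ _ h₁ => exact h₁.has ht

theorem Serves.nextC {σ : State V W R G S C E} {s : S} {c : C} {st' : SrvState W G S C E}
    {out : Multiset (Msg W R G S C E)} (h : Serves sys σ s c st' out) :
    st'.nextC = (σ.srv s c).nextC ∨ ∃ p ph x, .req p ph s c (.writeConfig x) ∈ σ.net ∧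
      st'.nextC = updNext (σ.srv s c).nextC x := by
  rcases h with ⟨p, ph, b, hb, h⟩ | ⟨s₀, c₀, t', e, g, ph, -, h⟩
  · cases h with
    | writeConfig => exact Or.inr ⟨_, _, _, hb, rfl⟩
    | _ => exact Or.inl rfl
  · cases h with
    | ignore => exact Or.inl rfl
    | wait _ _ h₁ => exact Or.inl h₁.nextC
    | ack _ _ h₁ => exact Or.inl h₁.nextC

theorem updNext_ne_none (x : Option (C × Status)) (y : C × Status) : updNext x y ≠ none := by
  rcases x with _ | ⟨d, _ | _⟩ <;> simp [updNext]

theorem updNext_eq (x : Option (C × Status)) (y : C × Status) :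
    updNext x y = some y ∨ updNext x y = x := by
  rcases x with _ | ⟨d, _ | _⟩ <;> simp [updNext]

theorem SrvRecv.rep_eq {s : S} {c : C} {st st' : SrvState W G S C E} {p : Client W R G} {ph : ℕ}
    {b : Req W C E} {out : Multiset (Msg W R G S C E)} (h : SrvRecv sys s c st p ph b st' out)
    {p' : Client W R G} {ph' : ℕ} {s' : S} {r : Rep W C E} (hr : .rep p' ph' s' r ∈ out) :
    p' = p ∧ ph' = ph ∧ s' = s := by
  cases h <;> simp at hr <;> tauto

theorem SrvFwd.rep_eq {s' : S} {c' : C} {st st' : SrvState W G S C E} {s : S} {c : C} {t : Tag W}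
    {e : E} {g : G} {ph : ℕ} {out : Multiset (Msg W R G S C E)}
    (h : SrvFwd sys s' c' st s c t e g ph st' out)
    {p : Client W R G} {ph' : ℕ} {s₁ : S} {r : Rep W C E} (hr : .rep p ph' s₁ r ∈ out) :
    p = .recon g ∧ ph' = ph ∧ s₁ = s' ∧ r = .ack ∧ st'.Has t := by
  cases h <;> simp at hr
  rename_i hl
  exact ⟨hr.1, hr.2.1, hr.2.2.1, hr.2.2.2, hl⟩

namespace Execution

variable (ξ : Execution W R G sys)

/-! ### Traces -/

theorem client (n : ℕ) (p : Client W R G) :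
    Rests (ξ.st n) (ξ.st (n + 1)) p (ξ.ev n) ∨ Moves sys (ξ.st n) (ξ.st (n + 1)) p (ξ.ev n) := by
  rcases ξ.step n with h | ⟨he, h⟩
  · exact h.client p
  · rw [h, he]
    exact Or.inl ⟨rfl, rfl, rfl, fun _ _ h => Or.inl h, by simp, by simp⟩

theorem server (n : ℕ) (s : S) (c : C) :
    (ξ.st (n + 1)).srv s c = (ξ.st n).srv s c ∨
      ∃ out, Serves sys (ξ.st n) s c ((ξ.st (n + 1)).srv s c) out := by
  rcases ξ.step n with h | ⟨he, h⟩
  · exact h.server s c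
  · exact Or.inl (by rw [h])

theorem net (n : ℕ) {m : Msg W R G S C E} (hm : m ∈ (ξ.st (n + 1)).net) :
    m ∈ (ξ.st n).net ∨
    (∃ p c b, ∃ s ∈ (sys.cfg c).servers, m = .req p ((ξ.st (n + 1)).cl p).phase s c (b s) ∧
        ((ξ.st (n + 1)).cl p).phase = ((ξ.st n).cl p).phase + 1 ∧
        Asks sys ((ξ.st (n + 1)).cl p).cseq ((ξ.st (n + 1)).cl p).pc c b) ∨
    ∃ s c out, m ∈ out ∧ Serves sys (ξ.st n) s c ((ξ.st (n + 1)).srv s c) out := by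
  rcases ξ.step n with h | ⟨he, h⟩
  · exact h.net hm
  · exact Or.inl (by rwa [h] at hm)

theorem phase_mono (p : Client W R G) : Monotone fun n => ((ξ.st n).cl p).phase := by
  refine monotone_nat_of_le_succ fun n => ?_
  rcases ξ.client n p with h | h
  · exact h.phase.ge
  · rcases h.phase with h | h <;> simp [h.1]

theorem phase_start_unique {p : Client W R G} {a a' : ℕ}
    (h : ((ξ.st (a + 1)).cl p).phase = ((ξ.st a).cl p).phase + 1)
    (h' : ((ξ.st (a' + 1)).cl p).phase = ((ξ.st a').cl p).phase + 1)
    (he : ((ξ.st (a + 1)).cl p).phase = ((ξ.st (a' + 1)).cl p).phase) : a = a' := by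
  have hm := ξ.phase_mono p
  rcases lt_trichotomy a a' with hlt | rfl | hlt
  · have : ((ξ.st (a + 1)).cl p).phase ≤ ((ξ.st a').cl p).phase := hm hlt
    omega
  · rfl
  · have : ((ξ.st (a' + 1)).cl p).phase ≤ ((ξ.st a).cl p).phase := hm hlt
    omega

theorem has_mono {n m : ℕ} (h : n ≤ m) {s : S} {c : C} {t : Tag W}
    (ht : ((ξ.st n).srv s c).Has t) : ((ξ.st m).srv s c).Has t := by
  induction m, h using Nat.le_induction with
  | base => exact ht
  | succ m _ ih =>
    rcases ξ.server m s c with h | ⟨out, h⟩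
    · rwa [h]
    · exact h.has ih

theorem nextC_mono {n m : ℕ} (h : n ≤ m) {s : S} {c : C}
    (ht : ((ξ.st n).srv s c).nextC ≠ none) : ((ξ.st m).srv s c).nextC ≠ none := by
  induction m, h using Nat.le_induction with
  | base => exact ht
  | succ m _ ih =>
    rcases ξ.server m s c with h | ⟨out, h⟩
    · rwa [h]
    · rcases h.nextC with h | ⟨_, _, x, _, h⟩
      · rwa [h]
      · rw [h]; exact updNext_ne_none _ _

/-- The request was sent when its sender entered the communication phase that it names. -/
theorem req_origin {n : ℕ} {p : Client W R G} {ph : ℕ} {s : S} {c : C} {b : Req W C E}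
    (h : .req p ph s c b ∈ (ξ.st n).net) :
    ∃ a < n, ((ξ.st (a + 1)).cl p).phase = ((ξ.st a).cl p).phase + 1 ∧
      ((ξ.st (a + 1)).cl p).phase = ph ∧ s ∈ (sys.cfg c).servers ∧
      ∃ bf, b = bf s ∧ Asks sys ((ξ.st (a + 1)).cl p).cseq ((ξ.st (a + 1)).cl p).pc c bf := by
  induction n with
  | zero => rw [ξ.init] at h; simp [State.init] at h
  | succ n ih =>
    rcases ξ.net n h with h | ⟨p', c', bf, s', hs, hm, hph, ha⟩ | ⟨s', c', out, ho, hs⟩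
    · obtain ⟨a, ha, h⟩ := ih h
      exact ⟨a, by omega, h⟩
    · cases hm
      exact ⟨n, by omega, hph, rfl, hs, bf, rfl, ha⟩
    · generalize (ξ.st (n + 1)).srv s' c' = st' at hs
      rcases hs with ⟨p, ph, b, -, h⟩ | ⟨s₀, c₀, t', e, g, ph, -, h⟩
      · cases h <;> simp at ho
      · cases h <;> simp at ho

/-- A forwarded element was taken from the list of its sender on request of the reconfigurer that it
names. -/
theorem fwd_origin {n : ℕ} {s : S} {c : C} {t : Tag W} {e : E} {s' : S} {c' : C} {g : G} {ph : ℕ}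
    (h : .fwd s c t e s' c' g ph ∈ (ξ.st n).net) :
    ∃ m < n, .req (.recon g) ph s c (.reqFwd t c') ∈ (ξ.st m).net ∧
      (t, some e) ∈ ((ξ.st m).srv s c).list ∧ s' ∈ (sys.cfg c').servers := by
  induction n with
  | zero => rw [ξ.init] at h; simp [State.init] at h
  | succ n ih =>
    rcases ξ.net n h with h | ⟨p', c', bf, s', hs, hm, hph, ha⟩ | ⟨s', c', out, ho, hs⟩
    · obtain ⟨a, ha, h⟩ := ih h
      exact ⟨a, by omega, h⟩
    · cases hm
    · generalize (ξ.st (n + 1)).srv s' c' = st' at hs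
      rcases hs with ⟨p, ph, b, hb, h⟩ | ⟨s₀, c₀, t', e, g, ph, -, h⟩
      · cases h <;> simp at ho
        rename_i he
        obtain ⟨ha, rfl, rfl, rfl, rfl, rfl, rfl, rfl⟩ := ho
        exact ⟨n, by omega, hb, he, ha⟩
      · cases h <;> simp at ho

/-- At step `m` the server `s` sends the reply `r` to the phase `ph` of `p`: in response to a
request of `p`, or, as an acknowledgement to a reconfigurer, upon a forwarded element whose tag is
then in its list. -/
def Replies (m : ℕ) (p : Client W R G) (ph : ℕ) (s : S) (r : Rep W C E) : Prop :=
  (∃ c b out, .req p ph s c b ∈ (ξ.st m).net ∧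
    SrvRecv sys s c ((ξ.st m).srv s c) p ph b ((ξ.st (m + 1)).srv s c) out ∧
    .rep p ph s r ∈ out) ∨
  ∃ g s₀ c₀ t e c, p = .recon g ∧ r = .ack ∧ .fwd s₀ c₀ t e s c g ph ∈ (ξ.st m).net ∧
    ((ξ.st (m + 1)).srv s c).Has t

theorem rep_origin {n : ℕ} {p : Client W R G} {ph : ℕ} {s : S} {r : Rep W C E}
    (h : .rep p ph s r ∈ (ξ.st n).net) : ∃ m < n, ξ.Replies m p ph s r := by
  induction n with
  | zero => rw [ξ.init] at h; simp [State.init] at h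
  | succ n ih =>
    rcases ξ.net n h with h | ⟨p', c', bf, s', hs, hm, hph, ha⟩ | ⟨s', c', out, ho, hs⟩
    · obtain ⟨a, ha, h⟩ := ih h
      exact ⟨a, by omega, h⟩
    · cases hm
    · refine ⟨n, by omega, ?_⟩
      rcases hs with ⟨p', ph', b, hb, h⟩ | ⟨s₀, c₀, t', e, g, ph', hb, h⟩
      · obtain ⟨rfl, rfl, rfl⟩ := h.rep_eq ho
        exact Or.inl ⟨c', b, out, hb, h, ho⟩
      · obtain ⟨rfl, rfl, rfl, rfl, ht⟩ := h.rep_eq ho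
        exact Or.inr ⟨g, s₀, c₀, t', e, c', rfl, rfl, hb, ht⟩

theorem replies_origin {n : ℕ} {p : Client W R G} {s : S} {r : Rep W C E}
    (h : ((ξ.st n).cl p).replies s = some r) :
    ∃ m < n, ξ.Replies m p ((ξ.st n).cl p).phase s r := by
  induction n with
  | zero => rw [ξ.init] at h; simp [State.init] at h
  | succ n ih =>
    have key : ((ξ.st (n + 1)).cl p).phase = ((ξ.st n).cl p).phase ∧
        (((ξ.st n).cl p).replies s = some r ∨
          .rep p ((ξ.st n).cl p).phase s r ∈ (ξ.st n).net) := by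
      rcases ξ.client n p with h' | h'
      · exact ⟨h'.phase, h'.replies s r h⟩
      · rcases h'.phase with h'' | h''
        · exact ⟨h''.1, Or.inl (h'.replies s r h)⟩
        · rw [h''.2.1 s] at h; cases h
    rw [key.1]
    rcases key.2 with h | h
    · obtain ⟨m, hm, h⟩ := ih h
      exact ⟨m, by omega, h⟩
    · obtain ⟨m, hm, h⟩ := ξ.rep_origin h
      exact ⟨m, by omega, h⟩

/-- A waiting client has not changed its control state since it entered its current phase. -/
theorem waits_start {n : ℕ} {p : Client W R G} (hw : ((ξ.st n).cl p).pc.Waits) :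
    ∃ a < n, ((ξ.st (a + 1)).cl p).phase = ((ξ.st a).cl p).phase + 1 ∧
      ∀ m, a < m → m ≤ n → ((ξ.st m).cl p).pc = ((ξ.st n).cl p).pc ∧
        ((ξ.st m).cl p).cseq = ((ξ.st n).cl p).cseq ∧
        ((ξ.st m).cl p).phase = ((ξ.st n).cl p).phase := by
  induction n with
  | zero => rw [ξ.init] at hw; simp [State.init, PC.Waits] at hw
  | succ n ih =>
    rcases ξ.client n p with h | h
    · rw [h.pc] at hw
      obtain ⟨a, ha, h1, h2⟩ := ih hw
      refine ⟨a, by omega, h1, fun m hm hmn => ?_⟩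
      rcases Nat.of_le_succ hmn with hmn | rfl
      · rw [h.pc, h.cseq, h.phase]; exact h2 m hm hmn
      · exact ⟨rfl, rfl, rfl⟩
    · rcases h.phase with h' | h'
      · exact absurd hw h'.2
      · refine ⟨n, by omega, h'.1, fun m hm hmn => ?_⟩
        have : m = n + 1 := by omega
        subst this; exact ⟨rfl, rfl, rfl⟩

/-- The replies that a waiting client holds were sent after the state with index `a` in which it
entered its current phase, and they answer the request of this phase. -/
structure Since (n : ℕ) (p : Client W R G) (a : ℕ) : Prop where
  le : a ≤ n
  const : ∀ m, a ≤ m → m ≤ n → ((ξ.st m).cl p).pc = ((ξ.st n).cl p).pc ∧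
    ((ξ.st m).cl p).cseq = ((ξ.st n).cl p).cseq
  replies : ∀ s r, ((ξ.st n).cl p).replies s = some r → ∃ m, a ≤ m ∧ m < n ∧
    ((∃ c bf out, Asks sys ((ξ.st n).cl p).cseq ((ξ.st n).cl p).pc c bf ∧
      s ∈ (sys.cfg c).servers ∧
      SrvRecv sys s c ((ξ.st m).srv s c) p ((ξ.st n).cl p).phase (bf s)
        ((ξ.st (m + 1)).srv s c) out ∧
      .rep p ((ξ.st n).cl p).phase s r ∈ out) ∨
    ∃ s₀ c₀ t c bf, Asks sys ((ξ.st n).cl p).cseq ((ξ.st n).cl p).pc c₀ bf ∧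
      bf s₀ = .reqFwd t c ∧ r = .ack ∧ ((ξ.st (m + 1)).srv s c).Has t)

/-- A request names its phase, and a phase starts only once; so whatever answers the current phase
of a client was caused by the request that started it. -/
theorem exists_since {n : ℕ} {p : Client W R G} (hw : ((ξ.st n).cl p).pc.Waits) :
    ∃ a, ξ.Since n p a := by
  obtain ⟨a, han, ha, hc⟩ := ξ.waits_start hw
  refine ⟨a + 1, han, fun m h₁ h₂ => ⟨(hc m h₁ h₂).1, (hc m h₁ h₂).2.1⟩, fun s r hr => ?_⟩
  have asks : ∀ {k s' c b}, .req p ((ξ.st n).cl p).phase s' c b ∈ (ξ.st k).net → a < k ∧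
      s' ∈ (sys.cfg c).servers ∧
      ∃ bf, b = bf s' ∧ Asks sys ((ξ.st n).cl p).cseq ((ξ.st n).cl p).pc c bf := by
    intro k s' c b h
    obtain ⟨a', hk, h1, h2, h3, bf, h4, h5⟩ := ξ.req_origin h
    have := ξ.phase_start_unique ha h1 (by rw [h2]; exact (hc _ (by omega) han).2.2)
    subst this
    have h6 := hc (a + 1) (by omega) han
    exact ⟨hk, h3, bf, h4, by rw [← h6.1, ← h6.2.1]; exact h5⟩
  obtain ⟨m, hm, hr⟩ := ξ.replies_origin hr
  rcases hr with ⟨c, b, out, hb, h, ho⟩ | ⟨g, s₀, c₀, t, e, c, rfl, rfl, hf, ht⟩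
  · obtain ⟨hk, hs, bf, rfl, hA⟩ := asks hb
    exact ⟨m, hk, hm, Or.inl ⟨c, bf, out, hA, hs, h, ho⟩⟩
  · obtain ⟨k, hkm, hreq, -, -⟩ := ξ.fwd_origin hf
    obtain ⟨hk, hs, bf, hb, hA⟩ := asks hreq
    exact ⟨m, by omega, hm, Or.inr ⟨s₀, c₀, t, c, bf, hA, hb.symm, rfl, ht⟩⟩

end Execution

/-! ### Intersection of server sets -/

/-- Two sets of servers that a data access primitive may wait for have `k` servers in common. -/
theorem Config.k_le_card_filter (c : Config V S E) {T T' : Finset S} (hT : T ⊆ c.servers)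
    (hT' : T' ⊆ c.servers) (h : T.card = c.threshold) (h' : T'.card = c.threshold)
    (P : S → Prop) [DecidablePred P] (hP : ∀ s ∈ T, s ∈ T' → P s) : c.k ≤ (T.filter P).card := by
  classical
  have h1 := Finset.card_union_add_card_inter T T'
  have h2 := Finset.card_le_card (Finset.union_subset hT hT')
  have h3 : (T ∩ T').card ≤ (T.filter P).card := Finset.card_le_card fun s hs => by
    rw [Finset.mem_inter] at hs
    exact Finset.mem_filter.2 ⟨hs.1, hP s hs.1 hs.2⟩
  have h4 : c.servers.card + c.k ≤ 2 * c.threshold := by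
    have := le_smul_ceilDiv (α := ℕ) (β := ℕ) (a := 2) (b := c.servers.card + c.k) (by norm_num)
    simpa [Config.threshold] using this
  omega

namespace Execution

variable (ξ : Execution W R G sys)

/-! ### Communication phases -/

/-- All servers of some quorum of `c` know a next configuration. -/
def Linked (n : ℕ) (c : C) : Prop :=
  ∃ Q ∈ (sys.cfg c).quorums, ∀ s ∈ Q, ((ξ.st n).srv s c).nextC ≠ none

/-- Some tag that is at least `t` occurs in the lists of `⌈(n + k) / 2⌉` servers of `c`. -/
def Stored (n : ℕ) (c : C) (t : Tag W) : Prop :=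
  ∃ t', t ≤ t' ∧ ∃ T ⊆ (sys.cfg c).servers, T.card = (sys.cfg c).threshold ∧
    ∀ s ∈ T, ((ξ.st n).srv s c).Has t'

variable {ξ}

theorem Linked.mono {n m : ℕ} {c : C} (h : ξ.Linked n c) (hm : n ≤ m) : ξ.Linked m c := by
  obtain ⟨Q, hQ, h⟩ := h
  exact ⟨Q, hQ, fun s hs => ξ.nextC_mono hm (h s hs)⟩

theorem Stored.mono {n m : ℕ} {c : C} {t : Tag W} (h : ξ.Stored n c t) (hm : n ≤ m) :
    ξ.Stored m c t := by
  obtain ⟨t', ht, T, hT, hc, h⟩ := h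
  exact ⟨t', ht, T, hT, hc, fun s hs => ξ.has_mono hm (h s hs)⟩

theorem Stored.le {n : ℕ} {c : C} {t t' : Tag W} (h : ξ.Stored n c t) (ht : t' ≤ t) :
    ξ.Stored n c t' := by
  obtain ⟨t₁, ht₁, h⟩ := h
  exact ⟨t₁, ht.trans ht₁, h⟩

/-- The servers' answers in `read-next-config`. -/
theorem Since.readNext {n a : ℕ} {p : Client W R G} (h : ξ.Since n p a) {κ : Cont V W C} {i : ℕ}
    (hpc : ((ξ.st n).cl p).pc = .readNext κ i) {x : C × Status}
    (hx : ((ξ.st n).cl p).cseq[i]? = some x) {s : S} {y : Option (C × Status)}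
    (hr : ((ξ.st n).cl p).replies s = some (.nextC y)) :
    ∃ m, a ≤ m ∧ m < n ∧ ((ξ.st m).srv s x.1).nextC = y := by
  obtain ⟨m, ham, hmn, ⟨c, bf, out, hA, hs, h, ho⟩ | ⟨s₀, c₀, t, c, bf, hA, hb, -⟩⟩ :=
    h.replies s _ hr
  · rw [hpc] at hA
    obtain ⟨x', hx', rfl, rfl⟩ := hA
    rw [hx] at hx'; cases hx'
    refine ⟨m, ham, hmn, ?_⟩
    generalize (ξ.st (m + 1)).srv s x.1 = st' at h
    cases h
    simpa [eq_comm] using ho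
  · rw [hpc] at hA
    obtain ⟨x', hx', rfl, rfl⟩ := hA
    cases hb

/-- Quorum intersection: if a quorum answers `⊥`, then no quorum knew a successor when the phase
began. -/
theorem Since.not_linked {n a : ℕ} {p : Client W R G} (h : ξ.Since n p a) {κ : Cont V W C} {i : ℕ}
    (hpc : ((ξ.st n).cl p).pc = .readNext κ i) {x : C × Status}
    (hx : ((ξ.st n).cl p).cseq[i]? = some x)
    (hn : NextResult sys ((ξ.st n).cl p) x.1 none) : ¬ ξ.Linked a x.1 := by
  rintro ⟨Q', hQ', hl⟩
  obtain ⟨Q, hQ, y, hy, ⟨_, _, _, _, h'⟩ | ⟨_, _, _, _, _, h'⟩ | ⟨hnone, -⟩⟩ := hn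
  · cases h'
  · cases h'
  · obtain ⟨s, hs, hs'⟩ := (sys.cfg x.1).quorum_inter Q hQ Q' hQ'
    obtain ⟨m, ham, -, hm⟩ := h.readNext hpc hx (hy s hs)
    exact ξ.nextC_mono ham (hl s hs') (hm.trans (hnone s hs))

theorem nextResult_some {n : ℕ} {p : Client W R G} {κ : Cont V W C} {i : ℕ}
    (hpc : ((ξ.st n).cl p).pc = .readNext κ i) {x y : C × Status}
    (hx : ((ξ.st n).cl p).cseq[i]? = some x)
    (hy : NextResult sys ((ξ.st n).cl p) x.1 (some y)) :
    ∃ m ≤ n, ∃ s, ((ξ.st m).srv s x.1).nextC = some y := by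
  obtain ⟨a, ha⟩ := ξ.exists_since (n := n) (p := p) (by rw [hpc]; trivial)
  have key : ∃ s, ((ξ.st n).cl p).replies s = some (.nextC (some y)) := by
    obtain ⟨Q, hQ, f, hf, ⟨s, hs, d, hd, hy⟩ | ⟨-, s, hs, d, hd, hy⟩ | ⟨-, hy⟩⟩ := hy
    · exact ⟨s, by rw [hf s hs, hd, hy]⟩
    · exact ⟨s, by rw [hf s hs, hd, hy]⟩
    · cases hy
  obtain ⟨s, hs⟩ := key
  obtain ⟨m, -, hm, h⟩ := ha.readNext hpc hx hs
  exact ⟨m, hm.le, s, h⟩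

/-- A completed `put-config` links the configuration that it addresses. -/
theorem linked_of_acked {n : ℕ} {p : Client W R G} {x : C × Status}
    (hw : ((ξ.st n).cl p).pc.Waits)
    (hA : ∀ c b, Asks sys ((ξ.st n).cl p).cseq ((ξ.st n).cl p).pc c b →
      c = x.1 ∧ ∃ y, b = fun _ => .writeConfig y)
    (hack : AckedByQuorum sys ((ξ.st n).cl p) x.1) : ξ.Linked n x.1 := by
  obtain ⟨a, ha⟩ := ξ.exists_since hw
  obtain ⟨Q, hQ, hack⟩ := hack
  refine ⟨Q, hQ, fun s hs => ?_⟩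
  obtain ⟨m, ham, hmn, ⟨c, bf, out, hA', -, h, ho⟩ | ⟨s₀, c₀, t, c, bf, hA', hb, -⟩⟩ :=
    ha.replies s _ (hack s hs)
  · obtain ⟨rfl, y, rfl⟩ := hA _ _ hA'
    refine ξ.nextC_mono (Nat.succ_le_of_lt hmn) ?_
    generalize (ξ.st (m + 1)).srv s x.1 = st' at h
    cases h
    exact updNext_ne_none _ _
  · obtain ⟨rfl, y, rfl⟩ := hA _ _ hA'
    cases hb

theorem putNext_linked {n : ℕ} {p : Client W R G} {x : C × Status} {κ : Cont V W C} {i : ℕ}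
    (hpc : ((ξ.st n).cl p).pc = .putNext κ i) (hx : ((ξ.st n).cl p).cseq[i]? = some x)
    (hack : AckedByQuorum sys ((ξ.st n).cl p) x.1) : ξ.Linked n x.1 := by
  refine linked_of_acked (by rw [hpc]; trivial) (fun c b hA => ?_) hack
  rw [hpc] at hA
  obtain ⟨x', y, hx', -, rfl, rfl⟩ := hA
  rw [hx] at hx'; cases hx'
  exact ⟨rfl, _, rfl⟩

theorem putNew_linked {n : ℕ} {p : Client W R G} {x : C × Status} {c : C}
    (hpc : ((ξ.st n).cl p).pc = .putNew c)
    (hx : ((ξ.st n).cl p).cseq[((ξ.st n).cl p).cseq.length - 2]? = some x)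
    (hack : AckedByQuorum sys ((ξ.st n).cl p) x.1) : ξ.Linked n x.1 := by
  refine linked_of_acked (by rw [hpc]; trivial) (fun c b hA => ?_) hack
  rw [hpc] at hA
  obtain ⟨x', y, hx', -, rfl, rfl⟩ := hA
  rw [hx] at hx'; cases hx'
  exact ⟨rfl, _, rfl⟩

theorem putData_stored {n : ℕ} {p : Client W R G} {x : C × Status} {o : Op V C} {t : Tag W} {v : V}
    (hpc : ((ξ.st n).cl p).pc = .putData o t v)
    (hx : ((ξ.st n).cl p).cseq.getLast? = some x)
    (hack : AckedByThreshold sys ((ξ.st n).cl p) x.1) : ξ.Stored n x.1 t := by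
  obtain ⟨a, ha⟩ := ξ.exists_since (n := n) (p := p) (by rw [hpc]; trivial)
  obtain ⟨T, hT, hc, hack⟩ := hack
  refine ⟨t, le_rfl, T, hT, hc, fun s hs => ?_⟩
  obtain ⟨m, ham, hmn, ⟨c, bf, out, hA, -, h, ho⟩ | ⟨s₀, c₀, t, c, bf, hA, hb, -⟩⟩ :=
    ha.replies s _ (hack s hs)
  · rw [hpc] at hA
    obtain ⟨x', hx', rfl, rfl⟩ := hA
    rw [hx] at hx'; cases hx'
    refine ξ.has_mono (Nat.succ_le_of_lt hmn) ?_
    generalize (ξ.st (m + 1)).srv s x.1 = st' at h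
    cases h
    exact exists_mem_insertTrim.2 (Or.inl rfl)
  · rw [hpc] at hA
    obtain ⟨x', hx', rfl, rfl⟩ := hA
    cases hb

/-- The acknowledgements of a transfer come from servers of the new configuration that have the tag,
no matter which reconfigurer's request made them store it. -/
theorem forward_stored {n : ℕ} {p : Client W R G} {x : C × Status} {t : Tag W} {cm : C}
    (hpc : ((ξ.st n).cl p).pc = .forward t cm)
    (hx : ((ξ.st n).cl p).cseq.getLast? = some x)
    (hack : AckedByThreshold sys ((ξ.st n).cl p) x.1) : ξ.Stored n x.1 t := by
  obtain ⟨a, ha⟩ := ξ.exists_since (n := n) (p := p) (by rw [hpc]; trivial)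
  obtain ⟨T, hT, hc, hack⟩ := hack
  refine ⟨t, le_rfl, T, hT, hc, fun s hs => ?_⟩
  obtain ⟨m, ham, hmn, ⟨c, bf, out, hA, -, h, ho⟩ | ⟨s₀, c₀, t, c, bf, hA, hb, -, ht⟩⟩ :=
    ha.replies s _ (hack s hs)
  · rw [hpc] at hA
    obtain ⟨x', hx', rfl, rfl⟩ := hA
    generalize (ξ.st (m + 1)).srv s c = st' at h
    cases h <;> simp at ho
  · rw [hpc] at hA
    obtain ⟨x', hx', rfl, rfl⟩ := hA
    rw [hx] at hx'; cases hx'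
    cases hb
    exact ξ.has_mono (Nat.succ_le_of_lt hmn) ht

/-- The servers that answered have one in common with those that store the tag. -/
theorem Since.le_of_tagResult {n a : ℕ} {p : Client W R G} (h : ξ.Since n p a) {o : Op V C}
    {M : Set (Tag W × C)} {i : ℕ} (hpc : ((ξ.st n).cl p).pc = .getTag o M i) {x : C × Status}
    (hx : ((ξ.st n).cl p).cseq[i]? = some x) {t t' : Tag W}
    (ht : TagResult sys ((ξ.st n).cl p) x.1 t) (hst : ξ.Stored a x.1 t') : t' ≤ t := by
  classical
  obtain ⟨T, hT, hTc, τ, hτ, -, htop⟩ := ht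
  obtain ⟨t₁, ht₁, T', hT', hTc', hhas⟩ := hst
  have hk := (sys.cfg x.1).k_le_card_filter hT hT' hTc hTc' (· ∈ T') fun _ _ h => h
  obtain ⟨s, hs⟩ := Finset.card_pos.1 ((sys.cfg x.1).k_pos.trans_le hk)
  obtain ⟨hs, hs'⟩ := Finset.mem_filter.1 hs
  refine ht₁.trans (le_trans ?_ (htop ⟨s, hs, rfl⟩))
  obtain ⟨m, ham, hmn, ⟨c, bf, out, hA, -, h, ho⟩ | ⟨s₀, c₀, t, c, bf, hA, hb, -⟩⟩ :=
    h.replies s _ (hτ s hs)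
  · rw [hpc] at hA
    obtain ⟨x', hx', rfl, rfl⟩ := hA
    rw [hx] at hx'; cases hx'
    have := ξ.has_mono ham (hhas s hs')
    generalize (ξ.st (m + 1)).srv s x.1 = st' at h
    cases h
    rename_i hg
    simp at ho
    rw [ho]
    exact hg.2 this
  · rw [hpc] at hA
    obtain ⟨x', hx', rfl, rfl⟩ := hA
    cases hb

theorem Since.list {n a : ℕ} {p : Client W R G} (h : ξ.Since n p a)
    {M : Set (Tag W × V)} {i : ℕ} (hpc : ((ξ.st n).cl p).pc = .getData M i) {x : C × Status}
    (hx : ((ξ.st n).cl p).cseq[i]? = some x) {s : S} {L : TagList W E}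
    (hr : ((ξ.st n).cl p).replies s = some (.list L)) :
    ∃ m, a ≤ m ∧ m < n ∧ s ∈ (sys.cfg x.1).servers ∧ ((ξ.st m).srv s x.1).list = L := by
  obtain ⟨m, ham, hmn, ⟨c, bf, out, hA, hs, h, ho⟩ | ⟨s₀, c₀, t, c, bf, hA, hb, -⟩⟩ :=
    h.replies s _ hr
  · rw [hpc] at hA
    obtain ⟨x', hx', rfl, rfl⟩ := hA
    rw [hx] at hx'; cases hx'
    refine ⟨m, ham, hmn, hs, ?_⟩
    generalize (ξ.st (m + 1)).srv s x.1 = st' at h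
    cases h
    simpa [eq_comm] using ho
  · rw [hpc] at hA
    obtain ⟨x', hx', rfl, rfl⟩ := hA
    cases hb

/-- The servers that answered have `k` in common with those that store the tag, so it occurs in `k`
lists, possibly without coded elements. That the result is the largest such tag is what makes
`get-data` safe. -/
theorem Since.le_of_dataResult {n a : ℕ} {p : Client W R G} (h : ξ.Since n p a)
    {M : Set (Tag W × V)} {i : ℕ} (hpc : ((ξ.st n).cl p).pc = .getData M i) {x : C × Status}
    (hx : ((ξ.st n).cl p).cseq[i]? = some x) {t t' : Tag W} {v : V}
    (ht : DataResult sys ((ξ.st n).cl p) x.1 t v) (hst : ξ.Stored a x.1 t') : t' ≤ t := by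
  classical
  obtain ⟨T, hT, hTc, L, hL, ⟨-, htop⟩, -⟩ := ht
  obtain ⟨t₁, ht₁, T', hT', hTc', hhas⟩ := hst
  refine ht₁.trans (htop ?_)
  refine (sys.cfg x.1).k_le_card_filter hT hT' hTc hTc' _ fun s hs hs' => ?_
  obtain ⟨m, ham, -, -, hm⟩ := h.list hpc hx (hL s hs)
  rw [← hm]
  exact ξ.has_mono ham (hhas s hs')

end Execution

/-! ### Consensus -/

/-- The client is going to propose the configuration `c`. -/
def PC.Offers : PC V W C → C → Prop
  | .readNext (.start (.reconfig c)) _, c' => c = c'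
  | .putNext (.start (.reconfig c)) _, c' => c = c'
  | .propose c, c' => c = c'
  | _, _ => False

/-- Each configuration is proposed to one consensus instance only, and the initial one to none. This
rests on the rule that a configuration is submitted for reconfiguration at most once. -/
structure ConsensusInv (sys : System V S C E) (σ : State V W R G S C E) : Prop where
  initial : sys.c0 ∈ σ.introduced
  offers : ∀ p c, (σ.cl p).pc.Offers c → c ∈ σ.introduced ∧ c ≠ sys.c0 ∧ ∀ a, c ∉ σ.proposed a
  offers_unique : ∀ p p' c, (σ.cl p).pc.Offers c → (σ.cl p').pc.Offers c → p = p'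
  proposed : ∀ a d, d ∈ σ.proposed a → d ∈ σ.introduced ∧ d ≠ sys.c0
  proposed_unique : ∀ a a' d, d ∈ σ.proposed a → d ∈ σ.proposed a' → a = a'
  decided : ∀ a d, σ.decided a = some d → d ∈ σ.proposed a

namespace Execution

variable {ξ : Execution W R G sys}

theorem offers_of_succ {n : ℕ} {p : Client W R G} {c : C}
    (h : ((ξ.st (n + 1)).cl p).pc.Offers c) :
    ((ξ.st n).cl p).pc.Offers c ∨ ξ.ev n = some (.inv p (.reconfig c)) := by
  rcases ξ.client n p with h' | h'
  · rw [h'.pc] at h; exact Or.inl h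
  · have hm := h'.move
    generalize ((ξ.st (n + 1)).cl p).pc = pc at h hm
    generalize ((ξ.st (n + 1)).cl p).cseq = q' at hm
    generalize hev : ξ.ev n = ev at hm ⊢
    cases hm with
    | invoke o q hq hpc hp hfresh =>
      cases o with
      | reconfig c' => obtain rfl : c' = c := h; exact Or.inr rfl
      | _ => exact h.elim
    | readNext_some κ i q x y hq hpc =>
      left; rw [hpc]
      rcases κ with o | _
      · cases o <;> exact h
      · exact h.elim
    | putNext_done κ i q x y hq hpc =>
      left; rw [hpc]
      rcases κ with o | _
      · cases o <;> exact h
      · exact h.elim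
    | start_reconfig c' i q hq hpc => left; rw [hpc]; exact h
    | _ => exact h.elim

theorem consensusInv (ξ : Execution W R G sys) (n : ℕ) : ConsensusInv sys (ξ.st n) := by
  induction n with
  | zero =>
    rw [ξ.init]
    exact ⟨rfl, fun _ _ h => h.elim, fun _ _ _ h => h.elim, fun _ _ h => h.elim,
      fun _ _ _ h => h.elim, fun _ _ h => by simp [State.init] at h⟩
  | succ n ih =>
    have hsh : _ ∨ _ := (ξ.step n).imp Step.shared id
    rcases hsh with (⟨hi, hp, hd, hev⟩ | ⟨p, c, hi, hp, hd, hev, hc⟩ |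
      ⟨p, c, x, hi, hev, hp, hd, hpc, hpc'⟩ | ⟨d, a, hi, hev, hp, hd, hda, hda'⟩) | ⟨-, h⟩
    · have ho : ∀ p c, ((ξ.st (n + 1)).cl p).pc.Offers c → ((ξ.st n).cl p).pc.Offers c :=
        fun p c h => (offers_of_succ h).resolve_right (hev p c)
      exact ⟨hi ▸ ih.initial, fun p c h => hi ▸ hp ▸ ih.offers p c (ho p c h),
        fun p p' c h h' => ih.offers_unique p p' c (ho p c h) (ho p' c h'),
        hi ▸ hp ▸ ih.proposed, hp ▸ ih.proposed_unique, hp ▸ hd ▸ ih.decided⟩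
    · have ho : ∀ p' c', ((ξ.st (n + 1)).cl p').pc.Offers c' →
          ((ξ.st n).cl p').pc.Offers c' ∨ (p' = p ∧ c' = c) := fun p' c' h =>
        (offers_of_succ h).imp_right fun h => by
          rw [hev] at h; simp at h; exact ⟨h.1.symm, h.2.symm⟩
      refine ⟨hi ▸ Or.inl ih.initial, fun p' c' h => ?_, fun p₁ p₂ c' h₁ h₂ => ?_,
        fun a d h => ?_, hp ▸ ih.proposed_unique, hp ▸ hd ▸ ih.decided⟩
      · rw [hi, hp]
        rcases ho p' c' h with h | ⟨rfl, rfl⟩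
        · have := ih.offers p' c' h
          exact ⟨Or.inl this.1, this.2⟩
        · exact ⟨Or.inr rfl, fun h => hc (h ▸ ih.initial), fun a h => hc (ih.proposed a _ h).1⟩
      · rcases ho _ _ h₁ with h₁ | ⟨rfl, rfl⟩ <;> rcases ho _ _ h₂ with h₂ | ⟨h₂, h₃⟩
        · exact ih.offers_unique _ _ _ h₁ h₂
        · exact absurd (ih.offers _ _ h₁).1 (h₃ ▸ hc)
        · exact absurd (ih.offers _ _ h₂).1 hc
        · exact h₂.symm
      · rw [hp] at h
        rw [hi]
        exact ⟨Or.inl (ih.proposed a d h).1, (ih.proposed a d h).2⟩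
    · have ho : ∀ p' c', ((ξ.st (n + 1)).cl p').pc.Offers c' →
          ((ξ.st n).cl p').pc.Offers c' ∧ c' ≠ c := by
        intro p' c' h
        have h₁ := (offers_of_succ h).resolve_right (by rw [hev]; simp)
        refine ⟨h₁, ?_⟩
        rintro rfl
        obtain rfl := ih.offers_unique p' p c' h₁ (by rw [hpc]; rfl)
        rw [hpc'] at h
        exact h
      have hc := ih.offers p c (by rw [hpc]; rfl)
      refine ⟨hi ▸ ih.initial, fun p' c' h => ?_, fun p₁ p₂ c' h₁ h₂ =>
        ih.offers_unique _ _ _ (ho _ _ h₁).1 (ho _ _ h₂).1, fun a d h => ?_,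
        fun a a' d h h' => ?_, fun a d h => ?_⟩
      · have := ih.offers p' c' (ho p' c' h).1
        refine ⟨hi ▸ this.1, this.2.1, fun a h' => ?_⟩
        rcases (hp _ _).1 h' with h' | h'
        · exact this.2.2 a h'
        · exact (ho p' c' h).2 h'.1
      · rw [hi]
        rcases (hp _ _).1 h with h | ⟨rfl, -⟩
        · exact ih.proposed a d h
        · exact ⟨hc.1, hc.2.1⟩
      · rcases (hp _ _).1 h with h | ⟨rfl, rfl⟩ <;> rcases (hp _ _).1 h' with h' | ⟨h₁, h₂⟩
        · exact ih.proposed_unique _ _ _ h h'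
        · exact absurd (h₁ ▸ h) (hc.2.2 a)
        · exact absurd h' (hc.2.2 a')
        · exact h₂.symm
      · exact (hp _ _).2 (Or.inl (ih.decided a d (hd ▸ h)))
    · have ho : ∀ p c, ((ξ.st (n + 1)).cl p).pc.Offers c → ((ξ.st n).cl p).pc.Offers c :=
        fun p c h => (offers_of_succ h).resolve_right (by rw [hev]; simp)
      refine ⟨hi ▸ ih.initial, fun p c h => hi ▸ hp ▸ ih.offers p c (ho p c h),
        fun p p' c h h' => ih.offers_unique p p' c (ho p c h) (ho p' c h'),
        hi ▸ hp ▸ ih.proposed, hp ▸ ih.proposed_unique, fun a' d' h => ?_⟩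
      rw [hp]
      by_cases ha : a' = a
      · subst ha
        rw [hda] at h; cases h
        rcases hda' with h | h
        · exact ih.decided _ _ h
        · exact h.2
      · exact ih.decided _ _ (hd a' ha ▸ h)
    · rw [h]; exact ih

theorem decided_succ {n : ℕ} {a d : C} (h : (ξ.st n).decided a = some d) :
    (ξ.st (n + 1)).decided a = some d := by
  have hsh : _ ∨ _ := (ξ.step n).imp Step.shared id
  rcases hsh with (⟨-, -, hd, -⟩ | ⟨p, c, -, -, hd, -⟩ | ⟨p, c, x, -, -, -, hd, -⟩ |
      ⟨d', a', -, -, -, hd, hda, hda'⟩) | ⟨-, h'⟩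
  · rw [hd, h]
  · rw [hd, h]
  · rw [hd, h]
  · by_cases ha : a = a'
    · subst ha
      rcases hda' with h' | ⟨h', -⟩
      · rw [hda, ← h', h]
      · rw [h] at h'; cases h'
    · rw [hd a ha, h]
  · rw [h', h]

theorem decided_mono {n m : ℕ} (hm : n ≤ m) {a d : C} (h : (ξ.st n).decided a = some d) :
    (ξ.st m).decided a = some d := by
  induction m, hm using Nat.le_induction with
  | base => exact h
  | succ m _ ih => exact decided_succ ih

theorem decided_unique {n m : ℕ} {a d d' : C} (h : (ξ.st n).decided a = some d)
    (h' : (ξ.st m).decided a = some d') : d = d' := by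
  have h₁ := decided_mono (le_max_left n m) h
  rw [decided_mono (le_max_right n m) h'] at h₁
  exact (Option.some.inj h₁).symm

/-- A configuration succeeds at most one other. -/
theorem decided_injective {n m : ℕ} {a a' d : C} (h : (ξ.st n).decided a = some d)
    (h' : (ξ.st m).decided a' = some d) : a = a' :=
  have I := ξ.consensusInv (max n m)
  I.proposed_unique _ _ d (I.decided _ _ (decided_mono (le_max_left n m) h))
    (I.decided _ _ (decided_mono (le_max_right n m) h'))

theorem decided_ne_c0 {n : ℕ} {a d : C} (h : (ξ.st n).decided a = some d) : d ≠ sys.c0 :=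
  have I := ξ.consensusInv n
  (I.proposed _ _ (I.decided _ _ h)).2

/-- `Conf ξ j c`: in the global sequence of configurations, in which the successor of a
configuration is the decision of its consensus instance, `c` has the index `j`. -/
inductive Conf (ξ : Execution W R G sys) : ℕ → C → Prop
  | zero : Conf ξ 0 sys.c0
  | succ {j n : ℕ} {a d : C} (h : Conf ξ j a) (hd : (ξ.st n).decided a = some d) :
      Conf ξ (j + 1) d

theorem Conf.unique {j : ℕ} {c c' : C} (h : ξ.Conf j c) (h' : ξ.Conf j c') : c = c' := by
  induction h generalizing c' with
  | zero => cases h'; rfl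
  | succ _ hd ih =>
    cases h' with
    | succ h' hd' =>
      obtain rfl := ih h'
      exact decided_unique hd hd'

theorem Conf.index_unique {i j : ℕ} {c : C} (h : ξ.Conf i c) (h' : ξ.Conf j c) : i = j := by
  induction h generalizing j with
  | zero =>
    cases h' with
    | zero => rfl
    | succ _ hd => exact absurd rfl (decided_ne_c0 hd)
  | succ _ hd ih =>
    cases h' with
    | zero => exact absurd rfl (decided_ne_c0 hd)
    | succ h' hd' =>
      obtain rfl := decided_injective hd hd'
      rw [ih h']

end Execution

/-! ### Configuration sequences -/

/-- The client performs `add-config`, `update-config` or `finalize-config`, and has appended a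
configuration to its sequence. -/
def PC.Installs : PC V W C → Prop
  | .putNew _ | .forward _ _ | .putFinal | .getTag (.reconfig _) _ _ => True
  | _ => False

namespace Execution

variable (ξ : Execution W R G sys)

/-- A reconfigurer has completed `update-config` for its last configuration `c`. -/
def Finalizes (m : ℕ) (c : C) : Prop :=
  ∃ p t cm x, ((ξ.st m).cl p).pc = .forward t cm ∧ ((ξ.st m).cl p).cseq.getLast? = some x ∧
    x.1 = c ∧ AckedByThreshold sys ((ξ.st m).cl p) c

/-- `c` has been finalized before the state with index `n`; the initial configuration counts as
finalized from the start. -/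
def Finalized (n : ℕ) (c : C) : Prop := c = sys.c0 ∨ ∃ m < n, ξ.Finalizes m c

/-- `y` is a legitimate successor entry of the configuration `c`. -/
def Marked (n : ℕ) (c : C) (y : C × Status) : Prop :=
  (ξ.st n).decided c = some y.1 ∧ (y.2 = .F → ξ.Finalized n y.1)

/-- All pointers to next configurations follow the decisions of the consensus instances, and only
finalized configurations are marked as such. -/
structure SeqInv (n : ℕ) : Prop where
  zero : ∀ p, ((ξ.st n).cl p).cseq[0]? = some (sys.c0, .F)
  marked : ∀ p i x y, ((ξ.st n).cl p).cseq[i]? = some x → ((ξ.st n).cl p).cseq[i + 1]? = some y →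
    ξ.Marked n x.1 y
  two_le : ∀ p, ((ξ.st n).cl p).pc.Installs → 2 ≤ ((ξ.st n).cl p).cseq.length
  nextC : ∀ s c y, ((ξ.st n).srv s c).nextC = some y → ξ.Marked n c y
  req : ∀ p ph s c y, .req p ph s c (.writeConfig y) ∈ (ξ.st n).net → ξ.Marked n c y

variable {ξ}

theorem Marked.mono {n m : ℕ} {c : C} {y : C × Status} (h : ξ.Marked n c y) (hm : n ≤ m) :
    ξ.Marked m c y :=
  ⟨decided_mono hm h.1, fun hy => (h.2 hy).imp_right fun ⟨k, hk, h⟩ => ⟨k, by omega, h⟩⟩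

theorem getElem?_concat {α : Type*} (q : List α) (z : α) (i : ℕ) :
    (q ++ [z])[i]? = if i = q.length then some z else q[i]? := by
  split_ifs with h
  · subst h; simp
  · rcases lt_or_gt_of_ne h with h | h
    · rw [List.getElem?_append_left h]
    · rw [List.getElem?_eq_none (by simp; omega), List.getElem?_eq_none (by omega)]

/-- The part of `SeqInv` that concerns the configuration sequences of clients. -/
theorem SeqInv.step_cseq {n : ℕ} (ih : ∀ m ≤ n, ξ.SeqInv m) (p : Client W R G) :
    ((ξ.st (n + 1)).cl p).cseq[0]? = some (sys.c0, .F) ∧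
    (∀ i x y, ((ξ.st (n + 1)).cl p).cseq[i]? = some x →
      ((ξ.st (n + 1)).cl p).cseq[i + 1]? = some y → ξ.Marked (n + 1) x.1 y) ∧
    (((ξ.st (n + 1)).cl p).pc.Installs → 2 ≤ ((ξ.st (n + 1)).cl p).cseq.length) := by
  have I := ih n le_rfl
  have old : ∀ i x y, ((ξ.st n).cl p).cseq[i]? = some x → ((ξ.st n).cl p).cseq[i + 1]? = some y →
      ξ.Marked (n + 1) x.1 y := fun i x y hx hy => (I.marked p i x y hx hy).mono n.le_succ
  have h0 := I.zero p
  have h2 := I.two_le p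
  rcases ξ.client n p with h | h
  · rw [h.cseq, h.pc]
    exact ⟨h0, old, h2⟩
  · have hm := h.move
    generalize ((ξ.st (n + 1)).cl p).pc = pc at hm ⊢
    generalize ((ξ.st (n + 1)).cl p).cseq = q' at hm ⊢
    generalize hev : ξ.ev n = ev at hm
    have hlen := lt_length_of_getElem? h0
    cases hm with
    | readNext_some κ i q x y hq hpc hx hy =>
      rw [hq] at h0 old hlen
      have hi := lt_length_of_getElem? hx
      obtain ⟨m, hmn, s, hs⟩ := nextResult_some hpc (by rw [hq]; exact hx) hy
      have hM : ξ.Marked (n + 1) x.1 y := ((ih m hmn).nextC s _ _ hs).mono (by omega)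
      simp only [getElem?_assign q (i + 1) y (by omega)]
      refine ⟨by simpa using h0, fun j u w hu hw => ?_, fun h => h.elim⟩
      by_cases hj : j = i
      · subst hj
        simp at hu hw
        rw [hx] at hu; cases hu; cases hw
        exact hM
      · rw [if_neg (by omega)] at hw
        by_cases hj' : j = i + 1
        · subst hj'
          rw [if_pos rfl] at hu; cases hu
          have := lt_length_of_getElem? hw
          have hz : q[i + 1]? = some q[i + 1] := List.getElem?_eq_getElem _
          -- The overwritten entry and the new one are both the decision of the same consensus
          -- instance, so only the status changes.
          have h₁ := (old i x _ hx hz).1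
          rw [hM.1] at h₁
          rw [Option.some.inj h₁]
          exact old _ _ _ hz hw
        · rw [if_neg hj'] at hu
          exact old j u w hu hw
    | decide c d q x hq hpc hx hd =>
      rw [hq] at h0 old hlen
      simp only [getElem?_concat]
      refine ⟨by rw [if_neg (by omega)]; exact h0, fun j u w hu hw => ?_,
        fun h => by simp; omega⟩
      split_ifs at hu hw with h₁ h₂ h₃
      · omega
      · rw [List.getElem?_eq_none (by omega)] at hw; cases hw
      · cases hw
        rw [List.getLast?_eq_getElem?] at hx
        have : q.length - 1 = j := by omega
        rw [this, hu] at hx; cases hx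
        exact ⟨hd, fun h => by cases h⟩
      · exact old j u w hu hw
    | forward_done t cm q x hq hpc hx hack =>
      rw [hq] at h0 old hlen
      have h2 := h2 (by rw [hpc]; trivial)
      rw [hq] at h2
      have hx' := hx
      rw [List.getLast?_eq_getElem?] at hx'
      refine ⟨by rw [List.getElem?_set_ne (by omega)]; exact h0, fun j u w hu hw => ?_,
        fun h => by simpa using h2⟩
      have hj := lt_length_of_getElem? hw
      rw [List.length_set] at hj
      rw [List.getElem?_set_ne (by omega)] at hu
      by_cases h : q.length - 1 = j + 1
      · rw [h] at hx' hw
        rw [List.getElem?_set_self hj] at hw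
        cases hw
        exact ⟨(old j u x hu hx').1, fun _ => Or.inr ⟨n, by omega, p, t, cm, x, hpc,
          by rw [hq]; exact hx, rfl, hack⟩⟩
      · rw [List.getElem?_set_ne h] at hw
        exact old j u w hu hw
    | putNew_done c q x hq hpc =>
      subst hq
      exact ⟨h0, old, fun _ => h2 (by rw [hpc]; trivial)⟩
    | getTag_next o M i q x y t hq hpc =>
      subst hq
      exact ⟨h0, old, fun h => h2 (by rw [hpc]; cases o <;> exact h)⟩
    | getTag_reconfig c M i q x t tm cm hq hpc =>
      subst hq
      exact ⟨h0, old, fun _ => h2 (by rw [hpc]; trivial)⟩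
    | _ =>
      rename ((ξ.st n).cl p).cseq = _ => hq
      subst hq
      exact ⟨h0, old, fun h => h.elim⟩

theorem seqInv (ξ : Execution W R G sys) (n : ℕ) : ξ.SeqInv n := by
  induction n using Nat.strong_induction_on with
  | _ n ih =>
  rcases n with _ | n
  · have h := ξ.init
    refine ⟨fun p => ?_, fun p i x y hx hy => ?_, fun p hp => ?_, fun s c y hy => ?_,
      fun p ph s c y hy => ?_⟩
    · rw [h]; rfl
    · rw [h] at hy; simp [State.init] at hy
    · rw [h] at hp; exact hp.elim
    · rw [h] at hy; simp [State.init, SrvState.init] at hy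
    · rw [h] at hy; simp [State.init] at hy
  · have ih' : ∀ m ≤ n, ξ.SeqInv m := fun m hm => ih m (by omega)
    have I := ih' n le_rfl
    have hs := SeqInv.step_cseq ih'
    refine ⟨fun p => (hs p).1, fun p => (hs p).2.1, fun p => (hs p).2.2, fun s c y hy => ?_,
      fun p ph s c y hy => ?_⟩
    · rcases ξ.server n s c with h | ⟨out, h⟩
      · rw [h] at hy
        exact (I.nextC s c y hy).mono n.le_succ
      · rcases h.nextC with h | ⟨p, ph, x, hx, h⟩
        · rw [h] at hy
          exact (I.nextC s c y hy).mono n.le_succ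
        · rcases updNext_eq ((ξ.st n).srv s c).nextC x with h' | h'
          · rw [h, h'] at hy; cases hy
            exact (I.req _ _ _ _ _ hx).mono n.le_succ
          · rw [h, h'] at hy
            exact (I.nextC s c y hy).mono n.le_succ
    · rcases ξ.net n hy with h | ⟨p', c', b, s', -, hm, -, hA⟩ | ⟨s', c', out, ho, hs⟩
      · exact (I.req p ph s c y h).mono n.le_succ
      · obtain ⟨-, hmk, h2⟩ := hs p'
        simp only [Msg.req.injEq] at hm
        obtain ⟨rfl, rfl, rfl, rfl, hb⟩ := hm
        have key : ∃ i x, ((ξ.st (n + 1)).cl p).cseq[i]? = some x ∧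
            ((ξ.st (n + 1)).cl p).cseq[i + 1]? = some y ∧ c = x.1 := by
          generalize ((ξ.st (n + 1)).cl p).pc = pc at hA h2
          have last : ∀ {x y' : C × Status}, pc.Installs →
              ((ξ.st (n + 1)).cl p).cseq[((ξ.st (n + 1)).cl p).cseq.length - 2]? = some x →
              ((ξ.st (n + 1)).cl p).cseq.getLast? = some y' →
              ∃ i, ((ξ.st (n + 1)).cl p).cseq[i]? = some x ∧
                ((ξ.st (n + 1)).cl p).cseq[i + 1]? = some y' := by
            intro x y' hi hx hy
            have := h2 hi
            rw [List.getLast?_eq_getElem?] at hy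
            -- By `2 ≤ length` the indices `length - 2` and `length - 1` are consecutive.
            exact ⟨_, hx, by rw [← hy]; congr 1; omega⟩
          cases pc with
          | putNext κ i =>
            obtain ⟨x, y', hx, hy', rfl, rfl⟩ := hA
            cases hb
            exact ⟨i, x, hx, hy', rfl⟩
          | putNew =>
            obtain ⟨x, y', hx, hy', rfl, rfl⟩ := hA
            cases hb
            obtain ⟨i, h₁, h₂⟩ := last trivial hx hy'
            exact ⟨i, x, h₁, h₂, rfl⟩
          | putFinal =>
            obtain ⟨x, y', hx, hy', rfl, rfl⟩ := hA
            cases hb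
            obtain ⟨i, h₁, h₂⟩ := last trivial hx hy'
            exact ⟨i, x, h₁, h₂, rfl⟩
          | readNext | getTag | getData | putData | forward =>
            obtain ⟨x, hx, rfl, rfl⟩ := hA
            cases hb
          | _ => exact hA.elim
        obtain ⟨i, x, hx, hy', hc⟩ := key
        exact hc ▸ hmk i x y hx hy'
      · generalize (ξ.st (n + 1)).srv s' c' = st' at hs
        rcases hs with ⟨p, ph, b, -, h⟩ | ⟨s₀, c₀, t', e, g, ph, -, h⟩
        · cases h <;> simp at ho
        · cases h <;> simp at ho

/-- Configuration sequences are initial segments of the global sequence. -/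
theorem conf_of_cseq (ξ : Execution W R G sys) {n : ℕ} {p : Client W R G} {i : ℕ}
    {x : C × Status} (hx : ((ξ.st n).cl p).cseq[i]? = some x) : ξ.Conf i x.1 := by
  have I := ξ.seqInv n
  induction i generalizing x with
  | zero =>
    rw [I.zero p] at hx; cases hx
    exact .zero
  | succ i ih =>
    have := lt_length_of_getElem? hx
    have hz : ((ξ.st n).cl p).cseq[i]? = some ((ξ.st n).cl p).cseq[i] := List.getElem?_eq_getElem _
    exact .succ (ih hz) (I.marked p i _ _ hz hx).1

theorem finalized_of_cseq (ξ : Execution W R G sys) {n : ℕ} {p : Client W R G} {i : ℕ}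
    {c : C} (hx : ((ξ.st n).cl p).cseq[i]? = some (c, .F)) : ξ.Finalized n c := by
  have I := ξ.seqInv n
  rcases i with _ | i
  · rw [I.zero p] at hx; cases hx
    exact Or.inl rfl
  · have := lt_length_of_getElem? hx
    have hz : ((ξ.st n).cl p).cseq[i]? = some ((ξ.st n).cl p).cseq[i] := List.getElem?_eq_getElem _
    exact (I.marked p i _ _ hz hx).2 rfl

/-- The last finalized entry of a configuration sequence. -/
theorem exists_lastFinal (ξ : Execution W R G sys) (n : ℕ) (p : Client W R G) :
    ∃ c, ((ξ.st n).cl p).cseq[lastFinal ((ξ.st n).cl p).cseq]? = some (c, .F) := by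
  classical
  have := Nat.findGreatest_spec (P := fun j => ∃ c, ((ξ.st n).cl p).cseq[j]? = some (c, .F))
    (Nat.zero_le ((ξ.st n).cl p).cseq.length) ⟨sys.c0, (ξ.seqInv n).zero p⟩
  unfold lastFinal
  convert this

/-- All configurations of the sequence of a client but the last are linked, with the exception of
the one at which the client is performing `put-config`. -/
theorem linked_of_cseq (ξ : Execution W R G sys) {n : ℕ} {p : Client W R G} {i : ℕ}
    {x : C × Status} (hx : ((ξ.st n).cl p).cseq[i]? = some x)
    (hi : i + 1 < ((ξ.st n).cl p).cseq.length) :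
    ξ.Linked n x.1 ∨ (∃ κ, ((ξ.st n).cl p).pc = .putNext κ i) ∨
      ∃ c, ((ξ.st n).cl p).pc = .putNew c ∧ i + 2 = ((ξ.st n).cl p).cseq.length := by
  induction n generalizing i x with
  | zero => rw [ξ.init] at hi; simp [State.init] at hi
  | succ n ih =>
    rcases ξ.client n p with h | h
    · rw [h.cseq] at hx hi
      rw [h.cseq, h.pc]
      exact (ih hx hi).imp_left fun h => h.mono n.le_succ
    · have hm := h.move
      have hconf := ξ.conf_of_cseq hx
      generalize ((ξ.st (n + 1)).cl p).pc = pc at hm ⊢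
      generalize ((ξ.st (n + 1)).cl p).cseq = q' at hm hx hi ⊢
      generalize hev : ξ.ev n = ev at hm
      have plain : ∀ {x}, ((ξ.st n).cl p).cseq[i]? = some x →
          i + 1 < ((ξ.st n).cl p).cseq.length → (∀ κ j, ((ξ.st n).cl p).pc ≠ .putNext κ j) →
          (∀ c, ((ξ.st n).cl p).pc ≠ .putNew c) → ξ.Linked (n + 1) x.1 := by
        intro x hx hi h₁ h₂
        rcases ih hx hi with h | ⟨κ, h⟩ | ⟨c, h, -⟩
        · exact h.mono n.le_succ
        · exact absurd h (h₁ _ _)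
        · exact absurd h (h₂ _)
      cases hm with
      | readNext_some κ j q x' y hq hpc hx' hy =>
        subst hq
        have hj := lt_length_of_getElem? hx'
        rw [length_assign _ _ _ (by omega)] at hi
        by_cases hij : i = j
        · subst hij; exact Or.inr (Or.inl ⟨κ, rfl⟩)
        · rw [getElem?_assign _ _ _ (by omega)] at hx
          by_cases hij' : i = j + 1
          · rw [if_pos hij'] at hx; cases hx
            have hi' : i < ((ξ.st n).cl p).cseq.length := by omega
            have hz := List.getElem?_eq_getElem hi'
            rw [hconf.unique (ξ.conf_of_cseq hz)]
            exact Or.inl (plain hz (by omega) (by simp [hpc]) (by simp [hpc]))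
          · rw [if_neg hij'] at hx
            exact Or.inl (plain hx (by omega) (by simp [hpc]) (by simp [hpc]))
      | putNext_done κ j q x' y hq hpc hx' hy hack =>
        subst hq
        rcases ih hx hi with h | ⟨κ', h⟩ | ⟨c, h, -⟩
        · exact Or.inl (h.mono n.le_succ)
        · rw [hpc] at h; cases h
          rw [hx] at hx'; cases hx'
          exact Or.inl ((putNext_linked hpc hx hack).mono n.le_succ)
        · rw [hpc] at h; cases h
      | decide c d q x' hq hpc hx' =>
        subst hq
        rw [getElem?_concat] at hx
        simp at hi
        rw [if_neg (by omega)] at hx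
        by_cases h : i + 1 = ((ξ.st n).cl p).cseq.length
        · exact Or.inr (Or.inr ⟨c, rfl, by simp; omega⟩)
        · exact Or.inl (plain hx (by omega) (by simp [hpc]) (by simp [hpc]))
      | putNew_done c q x' hq hpc hx' hack =>
        subst hq
        rcases ih hx hi with h | ⟨κ', h⟩ | ⟨c, h, h₂⟩
        · exact Or.inl (h.mono n.le_succ)
        · rw [hpc] at h; cases h
        · have : ((ξ.st n).cl p).cseq.length - 2 = i := by omega
          rw [this] at hx'
          rw [hx] at hx'; cases hx'
          exact Or.inl ((putNew_linked hpc (by rw [this]; exact hx) hack).mono n.le_succ)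
      | forward_done t cm q x' hq hpc hx' hack =>
        subst hq
        rw [List.length_set] at hi
        rw [List.getElem?_set_ne (by omega)] at hx
        exact Or.inl (plain hx hi (by simp [hpc]) (by simp [hpc]))
      | _ =>
        rename ((ξ.st n).cl p).cseq = _ => hq
        rename ((ξ.st n).cl p).pc = _ => hpc
        subst hq
        exact Or.inl (plain hx hi (by simp [hpc]) (by simp [hpc]))

/-- `read-config` returns at the last configuration of the sequence, which was not linked when the
last phase began, in contrast to those before it. -/
theorem Since.read_end {n a : ℕ} {p : Client W R G} (h : ξ.Since n p a) {κ : Cont V W C} {i : ℕ}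
    (hpc : ((ξ.st n).cl p).pc = .readNext κ i) {x : C × Status}
    (hx : ((ξ.st n).cl p).cseq[i]? = some x)
    (hn : NextResult sys ((ξ.st n).cl p) x.1 none) :
    i + 1 = ((ξ.st n).cl p).cseq.length ∧ ¬ ξ.Linked a x.1 ∧
      ∀ j y, j < i → ((ξ.st n).cl p).cseq[j]? = some y → ξ.Linked a y.1 := by
  have hnl := h.not_linked hpc hx hn
  have ha := h.const a le_rfl h.le
  have key : ∀ j y, j + 1 < ((ξ.st n).cl p).cseq.length → ((ξ.st n).cl p).cseq[j]? = some y →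
      ξ.Linked a y.1 := by
    intro j y hj hy
    rcases ξ.linked_of_cseq (n := a) (p := p) (i := j) (x := y) (by rw [ha.2]; exact hy)
      (by rw [ha.2]; exact hj) with h | ⟨κ, h⟩ | ⟨c, h, -⟩
    · exact h
    · rw [ha.1, hpc] at h; cases h
    · rw [ha.1, hpc] at h; cases h
  have hi := lt_length_of_getElem? hx
  refine ⟨?_, hnl, fun j y hj => key j y (by omega)⟩
  by_contra hne
  exact hnl (key i x (by omega) hx)

variable (ξ)

/-! ### Collecting tags -/

/-- While the configuration `c` with index `ν` has no known successor, but all configurations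
before it are linked, the tag `t` has been stored in `c`. -/
structure Milestone (k ν : ℕ) (c : C) (t : Tag W) : Prop where
  conf : ξ.Conf ν c
  stored : ξ.Stored k c t
  not_linked : ¬ ξ.Linked k c
  linked : ∀ i c', i < ν → ξ.Conf i c' → ξ.Linked k c'

/-- `p` has queried the configurations of its sequence from the last finalized one up to the index
`i` (exclusive), starting in the state with index `b`, and the set `A` of tags it has found bounds
all tags stored by then. If `rw` holds, `p` has found, earlier in the same operation, that the
last configuration is not linked; this is the case for reads and writes, but not for
reconfigurations, which append a configuration before they query. -/
def Collects (n : ℕ) (p : Client W R G) (A : Set (Tag W)) (i : ℕ) (rw : Prop) : Prop :=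
  ∃ b ≤ n, ((ξ.st b).cl p).cseq = ((ξ.st n).cl p).cseq ∧
    (∀ j y, j + 1 < ((ξ.st n).cl p).cseq.length → ((ξ.st n).cl p).cseq[j]? = some y →
      ξ.Linked b y.1) ∧
    (rw → ∃ a ≤ b, (∀ m, a ≤ m → m ≤ n → ((ξ.st m).cl p).pc ≠ .idle) ∧
      ∀ x, ((ξ.st n).cl p).cseq.getLast? = some x → ¬ ξ.Linked a x.1) ∧
    ∀ j x t, lastFinal ((ξ.st n).cl p).cseq ≤ j → j < i → ((ξ.st n).cl p).cseq[j]? = some x →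
      ξ.Stored b x.1 t → ∃ τ ∈ A, t ≤ τ

variable {ξ}

theorem Collects.bound {n : ℕ} {p : Client W R G} {A : Set (Tag W)} {i : ℕ} {rw : Prop}
    (h : ξ.Collects n p A i rw) {B : Set (Tag W)} (hAB : ∀ τ ∈ A, ∃ τ' ∈ B, τ ≤ τ') :
    ξ.Collects n p B i rw := by
  obtain ⟨b, hb, h₁, h₂, h₃, h₄⟩ := h
  refine ⟨b, hb, h₁, h₂, h₃, fun j x t hj hi hx hs => ?_⟩
  obtain ⟨τ, hτ, hle⟩ := h₄ j x t hj hi hx hs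
  obtain ⟨τ', hτ', hle'⟩ := hAB τ hτ
  exact ⟨τ', hτ', hle.trans hle'⟩

theorem Collects.succ {n : ℕ} {p : Client W R G} {A : Set (Tag W)} {i : ℕ} {rw : Prop}
    (h : ξ.Collects n p A i rw) (hq : ((ξ.st (n + 1)).cl p).cseq = ((ξ.st n).cl p).cseq)
    (hpc : ((ξ.st (n + 1)).cl p).pc ≠ .idle) : ξ.Collects (n + 1) p A i rw := by
  obtain ⟨b, hb, h₁, h₂, h₃, h₄⟩ := h
  refine ⟨b, by omega, by rw [hq]; exact h₁, by rw [hq]; exact h₂, fun hr => ?_,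
    by rw [hq]; exact h₄⟩
  obtain ⟨a, ha, h₅, h₆⟩ := h₃ hr
  refine ⟨a, ha, fun m ham hm => ?_, by rw [hq]; exact h₆⟩
  rcases Nat.of_le_succ hm with hm | rfl
  · exact h₅ m ham hm
  · exact hpc

/-- Querying starts right after `read-config` or `add-config`. -/
theorem collects_empty {n : ℕ} {p : Client W R G} (A : Set (Tag W)) {i : ℕ} {rw : Prop}
    (hi : i = lastFinal ((ξ.st n).cl p).cseq)
    (hl : ∀ j y, j + 1 < ((ξ.st n).cl p).cseq.length → ((ξ.st n).cl p).cseq[j]? = some y →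
      ξ.Linked n y.1)
    (hr : rw → ∃ a ≤ n, (∀ m, a ≤ m → m ≤ n → ((ξ.st m).cl p).pc ≠ .idle) ∧
      ∀ x, ((ξ.st n).cl p).cseq.getLast? = some x → ¬ ξ.Linked a x.1) :
    ξ.Collects n p A i rw :=
  ⟨n, le_rfl, rfl, hl, hr, fun j x t h₁ h₂ => by omega⟩

/-- The query of the configuration with index `i` extends the collection. -/
theorem Collects.insert {n a : ℕ} {p : Client W R G} {A : Set (Tag W)} {i : ℕ} {rw : Prop}
    (hs : ξ.Since n p a) (hpc : ((ξ.st n).cl p).pc ≠ .idle) (h : ξ.Collects a p A i rw)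
    {x : C × Status} (hx : ((ξ.st n).cl p).cseq[i]? = some x) {t : Tag W}
    (ht : ∀ t', ξ.Stored a x.1 t' → t' ≤ t) :
    ξ.Collects n p (insert t A) (i + 1) rw := by
  obtain ⟨b, hb, h₁, h₂, h₃, h₄⟩ := h
  have hq := (hs.const a le_rfl hs.le).2
  rw [hq] at h₁ h₂ h₃ h₄
  refine ⟨b, hb.trans hs.le, h₁, h₂, fun hr => ?_, fun j y t' hj hi hy hst => ?_⟩
  · obtain ⟨a', ha, h₅, h₆⟩ := h₃ hr
    refine ⟨a', ha, fun m ham hm => ?_, h₆⟩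
    rcases le_total m a with hma | hma
    · exact h₅ m ham hma
    · rw [(hs.const m hma hm).1]; exact hpc
  · rcases Nat.lt_succ_iff_lt_or_eq.1 hi with hi | rfl
    · obtain ⟨τ, hτ, hle⟩ := h₄ j y t' hj hi hy hst
      exact ⟨τ, Or.inr hτ, hle⟩
    · rw [hx] at hy; cases hy
      exact ⟨t, Or.inl rfl, ht t' (hst.mono hb)⟩

/-- The collections kept in the control states `getTag` and `getData`. -/
def CollectInv (ξ : Execution W R G sys) (n : ℕ) (p : Client W R G) : Prop :=
  (∀ o M i, ((ξ.st n).cl p).pc = .getTag o M i →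
    ξ.Collects n p (Prod.fst '' M) i (∀ c, o ≠ .reconfig c)) ∧
  ∀ M i, ((ξ.st n).cl p).pc = .getData M i → ξ.Collects n p (Prod.fst '' M) i True

theorem collects_getTag {n : ℕ} {p : Client W R G} (ih : ∀ m ≤ n, ξ.CollectInv m p)
    {o : Op V C} {M : Set (Tag W × C)} {i : ℕ} (hpc : ((ξ.st n).cl p).pc = .getTag o M i)
    {x : C × Status} (hx : ((ξ.st n).cl p).cseq[i]? = some x) {t : Tag W}
    (ht : TagResult sys ((ξ.st n).cl p) x.1 t) :
    ξ.Collects n p (Prod.fst '' insert (t, x.1) M) (i + 1) (∀ c, o ≠ .reconfig c) := by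
  obtain ⟨a, ha⟩ := ξ.exists_since (n := n) (p := p) (by rw [hpc]; trivial)
  have h := (ih a ha.le).1 o M i (by rw [(ha.const a le_rfl ha.le).1, hpc])
  rw [Set.image_insert_eq]
  exact h.insert ha (by simp [hpc]) hx fun t' h' => ha.le_of_tagResult hpc hx ht h'

theorem collects_getData {n : ℕ} {p : Client W R G} (ih : ∀ m ≤ n, ξ.CollectInv m p)
    {M : Set (Tag W × V)} {i : ℕ} (hpc : ((ξ.st n).cl p).pc = .getData M i)
    {x : C × Status} (hx : ((ξ.st n).cl p).cseq[i]? = some x) {t : Tag W} {v : V}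
    (ht : DataResult sys ((ξ.st n).cl p) x.1 t v) :
    ξ.Collects n p (Prod.fst '' insert (t, v) M) (i + 1) True := by
  obtain ⟨a, ha⟩ := ξ.exists_since (n := n) (p := p) (by rw [hpc]; trivial)
  have h := (ih a ha.le).2 M i (by rw [(ha.const a le_rfl ha.le).1, hpc])
  rw [Set.image_insert_eq]
  exact h.insert ha (by simp [hpc]) hx fun t' h' => ha.le_of_dataResult hpc hx ht h'

theorem linked_of_pc {n : ℕ} {p : Client W R G} (h₁ : ∀ κ i, ((ξ.st n).cl p).pc ≠ .putNext κ i)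
    (h₂ : ∀ c, ((ξ.st n).cl p).pc ≠ .putNew c) (j : ℕ) (y : C × Status)
    (hj : j + 1 < ((ξ.st n).cl p).cseq.length) (hy : ((ξ.st n).cl p).cseq[j]? = some y) :
    ξ.Linked n y.1 := by
  rcases ξ.linked_of_cseq hy hj with h | ⟨κ, h⟩ | ⟨c, h, -⟩
  · exact h
  · exact absurd h (h₁ _ _)
  · exact absurd h (h₂ _)

theorem exists_not_linked {n : ℕ} {p : Client W R G} {κ : Cont V W C} {i : ℕ} {x : C × Status}
    (hpc : ((ξ.st n).cl p).pc = .readNext κ i) (hx : ((ξ.st n).cl p).cseq[i]? = some x)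
    (hn : NextResult sys ((ξ.st n).cl p) x.1 none)
    (hq : ((ξ.st (n + 1)).cl p).cseq = ((ξ.st n).cl p).cseq)
    (hpc' : ((ξ.st (n + 1)).cl p).pc ≠ .idle) :
    ∃ a ≤ n + 1, (∀ m, a ≤ m → m ≤ n + 1 → ((ξ.st m).cl p).pc ≠ .idle) ∧
      ∀ x, ((ξ.st (n + 1)).cl p).cseq.getLast? = some x → ¬ ξ.Linked a x.1 := by
  obtain ⟨a, ha⟩ := ξ.exists_since (n := n) (p := p) (by rw [hpc]; trivial)
  obtain ⟨hi, hnl, -⟩ := ha.read_end hpc hx hn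
  refine ⟨a, by have := ha.le; omega, fun m ham hm => ?_, fun y hy => ?_⟩
  · rcases Nat.of_le_succ hm with hm | rfl
    · rw [(ha.const m ham hm).1, hpc]; simp
    · exact hpc'
  · rw [hq, getLast?_eq_some_of_getElem? hx hi] at hy
    cases hy
    exact hnl

theorem collectInv (ξ : Execution W R G sys) (n : ℕ) (p : Client W R G) : ξ.CollectInv n p := by
  induction n using Nat.strong_induction_on with
  | _ n ih =>
  rcases n with _ | n
  · constructor <;> intros <;> rename_i h <;> rw [ξ.init] at h <;> cases h
  · have ih' : ∀ m ≤ n, ξ.CollectInv m p := fun m hm => ih m (by omega)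
    rcases ξ.client n p with h | h
    · exact ⟨fun o M i hpc => ((ih' n le_rfl).1 o M i (h.pc ▸ hpc)).succ h.cseq (by simp [hpc]),
        fun M i hpc => ((ih' n le_rfl).2 M i (h.pc ▸ hpc)).succ h.cseq (by simp [hpc])⟩
    · have hm := h.move
      constructor
      · intro o M i hpc'
        rw [hpc'] at hm
        generalize hq' : ((ξ.st (n + 1)).cl p).cseq = q' at hm
        generalize hev : ξ.ev n = ev at hm
        cases hm with
        | start_write v j q x hq hpc hx hn =>
          subst hq
          exact collects_empty _ (by rw [hq']) (linked_of_pc (by simp [hpc']) (by simp [hpc']))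
            fun _ => exists_not_linked hpc hx hn hq' (by simp [hpc'])
        | getTag_next o M j q x y t hq hpc hx ht hy =>
          subst hq
          exact (collects_getTag ih' hpc hx ht).succ hq' (by simp [hpc'])
        | putNew_done c q x hq hpc hx hack =>
          subst hq
          exact collects_empty _ (by rw [hq']) (linked_of_pc (by simp [hpc']) (by simp [hpc']))
            fun h => absurd rfl (h c)
      · intro M i hpc'
        rw [hpc'] at hm
        generalize hq' : ((ξ.st (n + 1)).cl p).cseq = q' at hm
        generalize hev : ξ.ev n = ev at hm
        cases hm with
        | start_read j q x hq hpc hx hn =>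
          subst hq
          exact collects_empty _ (by rw [hq']) (linked_of_pc (by simp [hpc']) (by simp [hpc']))
            fun _ => exists_not_linked hpc hx hn hq' (by simp [hpc'])
        | getData_next M j q x y t v hq hpc hx ht hy =>
          subst hq
          exact (collects_getData ih' hpc hx ht).succ hq' (by simp [hpc'])

theorem IsMaxPair.bound {X : Type*} {M : Set (Tag W × X)} {t : Tag W} {x : X}
    (h : IsMaxPair M t x) : ∀ τ ∈ Prod.fst '' M, ∃ τ' ∈ ({t} : Set (Tag W)), τ ≤ τ' := by
  rintro _ ⟨y, hy, rfl⟩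
  exact ⟨t, rfl, h.2 y hy⟩

/-- The tag that a reconfigurer transfers bounds the tags that were stored before. -/
theorem collects_forward (ξ : Execution W R G sys) {n : ℕ} {p : Client W R G} {t : Tag W} {cm : C}
    (hpc : ((ξ.st n).cl p).pc = .forward t cm) :
    ξ.Collects n p {t} ((ξ.st n).cl p).cseq.length False := by
  induction n with
  | zero => rw [ξ.init] at hpc; cases hpc
  | succ n ih =>
    rcases ξ.client n p with h | h
    · rw [h.cseq]
      exact (ih (h.pc ▸ hpc)).succ h.cseq (by simp [hpc])
    · have hm := h.move
      rw [hpc] at hm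
      generalize hq' : ((ξ.st (n + 1)).cl p).cseq = q' at hm
      generalize hev : ξ.ev n = ev at hm
      cases hm with
      | getTag_reconfig c M i q x t tm cm hq hpc' hx hi ht hm =>
        subst hq
        rw [← hi]
        obtain ⟨b, h₁, h₂, h₃, -, h₄⟩ :=
          (collects_getTag (fun m _ => ξ.collectInv m p) hpc' hx ht).bound (IsMaxPair.bound hm)
        exact Collects.succ ⟨b, h₁, h₂, h₃, False.elim, h₄⟩ hq' (by simp [hpc])

/-- A collection that begins after a milestone finds its tag or a larger one, provided that the
configurations finalized before have taken it over. -/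
theorem exists_le_of_collects {b : ℕ} {p : Client W R G} {k ν : ℕ} {c : C}
    {t : Tag W} (hM : ξ.Milestone k ν c t) (hkb : k ≤ b)
    (hfin : ∀ m < b, ∀ j d, ξ.Finalizes m d → ξ.Conf j d → ν < j → ξ.Stored m d t)
    {q : List (C × Status)} (hq : ((ξ.st b).cl p).cseq = q) (hν : ν < q.length)
    {A : Set (Tag W)}
    (h : ∀ j x t, lastFinal q ≤ j → j < q.length → q[j]? = some x → ξ.Stored b x.1 t →
      ∃ τ ∈ A, t ≤ τ) : ∃ τ ∈ A, t ≤ τ := by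
  subst hq
  rcases le_or_gt (lastFinal ((ξ.st b).cl p).cseq) ν with hμ | hμ
  -- The configuration of the milestone itself is queried.
  · have hy := List.getElem?_eq_getElem hν
    refine h ν _ t hμ hν hy ?_
    rw [(ξ.conf_of_cseq hy).unique hM.conf]
    exact hM.stored.mono hkb
  -- The first configuration queried is a later one that has been finalized.
  · obtain ⟨d, hd⟩ := ξ.exists_lastFinal b p
    have hc := ξ.conf_of_cseq hd
    refine h _ _ t le_rfl (lt_length_of_getElem? hd) hd ?_
    rcases ξ.finalized_of_cseq hd with h0 | ⟨m, hm, hf⟩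
    · have := hc.index_unique (h0 ▸ Conf.zero)
      omega
    · exact (hfin m hm _ d hf hc hμ).mono hm.le

/-- `update-config` preserves the tags of milestones: a configuration that follows the one of the
milestone has taken over its tag, or a larger one, before it is finalized. -/
theorem Milestone.stored_of_finalizes {k ν : ℕ} {c : C} {t : Tag W} (hM : ξ.Milestone k ν c t)
    {m j : ℕ} {d : C} (hf : ξ.Finalizes m d) (hd : ξ.Conf j d) (hj : ν < j) : ξ.Stored m d t := by
  induction m using Nat.strong_induction_on generalizing j d with
  | _ m ih =>
  obtain ⟨p, t', cm, x, hpc, hx, rfl, hack⟩ := hf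
  obtain ⟨b, hbm, hq, hl, -, hcov⟩ := ξ.collects_forward hpc
  have hx' := hx
  rw [List.getLast?_eq_getElem?] at hx'
  have hlen := lt_length_of_getElem? hx'
  obtain rfl := hd.index_unique (ξ.conf_of_cseq hx')
  have hν : ν < ((ξ.st m).cl p).cseq.length := by omega
  have hy := List.getElem?_eq_getElem hν
  have hlk := hl ν _ (by omega) hy
  rw [(ξ.conf_of_cseq hy).unique hM.conf] at hlk
  -- When the query began, the configuration of the milestone was linked, being not the last one.
  have hkb : k ≤ b := by
    by_contra hc
    exact hM.not_linked (hlk.mono (by omega))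
  obtain ⟨τ, rfl, hτ⟩ := exists_le_of_collects hM hkb
    (fun m' hm' j d hf hd hj => ih m' (by omega) hf hd hj) hq hν hcov
  exact (forward_stored hpc hx hack).le hτ

/-- A read or write that is invoked after a milestone finds its tag or a larger one. -/
theorem Milestone.exists_le {k ν : ℕ} {c : C} {t : Tag W} (hM : ξ.Milestone k ν c t) {n : ℕ}
    {p : Client W R G} {A : Set (Tag W)}
    (h : ξ.Collects n p A ((ξ.st n).cl p).cseq.length True) {i₀ : ℕ}
    (hi₀ : ((ξ.st i₀).cl p).pc = .idle) (hn : i₀ ≤ n) (hk : k ≤ i₀) : ∃ τ ∈ A, t ≤ τ := by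
  obtain ⟨b, hbm, hq, hl, hrw, hcov⟩ := h
  obtain ⟨a, hab, hidle, hnl⟩ := hrw trivial
  -- The client was idle at the invocation, but not since `a`.
  have hka : k ≤ a := by
    by_contra hc
    exact hidle i₀ (by omega) hn hi₀
  -- Otherwise the last configuration precedes the one of the milestone and is linked at `k`.
  have hν : ν < ((ξ.st n).cl p).cseq.length := by
    by_contra hc
    have h0 := lt_length_of_getElem? ((ξ.seqInv n).zero p)
    have hlt : ((ξ.st n).cl p).cseq.length - 1 < ((ξ.st n).cl p).cseq.length := by omega
    have hy := List.getElem?_eq_getElem hlt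
    refine hnl _ (by rw [List.getLast?_eq_getElem?]; exact hy) ?_
    exact (hM.linked _ _ (by omega) (ξ.conf_of_cseq hy)).mono hka
  exact exists_le_of_collects hM (hka.trans hab)
    (fun m _ j d hf hd hj => hM.stored_of_finalizes hf hd hj) hq hν hcov

end Execution

/-! ### Operations -/

/-- The control state may occur in the operation `o`. -/
def PC.Of (o : Op V C) : PC V W C → Prop
  | .idle => False
  | .readNext (.start o') _ | .putNext (.start o') _ | .getTag o' _ _ => o' = o
  | .readNext (.check o' _ _ _) _ | .putNext (.check o' _ _ _) _ | .putData o' _ _ =>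
      o' = o ∧ ∀ c, o ≠ .reconfig c
  | .getData _ _ => o = .read
  | .propose c | .decide c | .putNew c => o = .reconfig c
  | .forward _ _ | .putFinal => ∃ c, o = .reconfig c
  | .ret _ => True

/-- The client propagates the value `v` with the tag `t`. -/
def PC.Carries (t : Tag W) (v : V) : PC V W C → Prop
  | .putData _ t' v' | .readNext (.check _ t' v' _) _ | .putNext (.check _ t' v' _) _ =>
      t' = t ∧ v' = v
  | _ => False

namespace Execution

variable (ξ : Execution W R G sys)

/-- In the state with index `n` the client `p` performs the operation `o` invoked at `i`. -/
structure Active (n : ℕ) (p : Client W R G) (i : ℕ) (o : Op V C) : Prop where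
  lt : i < n
  inv : ξ.ev i = some (.inv p o)
  no_resp : ∀ m, i < m → m < n → ∀ r, ξ.ev m ≠ some (.resp p r)

/-- The operation invoked at `i` propagates the value `v` with the tag `t`. -/
def Tagged (i : ℕ) (t : Tag W) (v : V) : Prop :=
  ∃ n p o, ξ.Active n p i o ∧ ((ξ.st n).cl p).pc.Carries t v

variable {ξ}

theorem of_inv {n : ℕ} {p : Client W R G} {o : Op V C} (h : ξ.ev n = some (.inv p o)) :
    ((ξ.st n).cl p).pc = .idle ∧ Permits p o ∧
      ∃ i, ((ξ.st (n + 1)).cl p).pc = .readNext (.start o) i := by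
  rcases ξ.client n p with h' | h'
  · exact absurd h (h'.inv o)
  · have hm := h'.move
    generalize ((ξ.st (n + 1)).cl p).pc = pc at hm ⊢
    generalize ((ξ.st (n + 1)).cl p).cseq = q' at hm
    rw [h] at hm
    cases hm with
    | invoke o q hq hpc hp hfresh => exact ⟨hpc, hp, _, rfl⟩

theorem of_resp {n : ℕ} {p : Client W R G} {r : Res V} (h : ξ.ev n = some (.resp p r)) :
    ((ξ.st n).cl p).pc = .ret r := by
  rcases ξ.client n p with h' | h'
  · exact absurd h (h'.resp r)
  · have hm := h'.move
    generalize ((ξ.st (n + 1)).cl p).pc = pc at hm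
    generalize ((ξ.st (n + 1)).cl p).cseq = q' at hm
    rw [h] at hm
    cases hm with
    | respond r q hq hpc => exact hpc

theorem Active.mono {n m : ℕ} {p : Client W R G} {i : ℕ} {o : Op V C} (h : ξ.Active n p i o)
    (hi : i < m) (hm : m ≤ n) : ξ.Active m p i o :=
  ⟨hi, h.inv, fun k h₁ h₂ => h.no_resp k h₁ (by omega)⟩

theorem Active.permits {n : ℕ} {p : Client W R G} {i : ℕ} {o : Op V C} (h : ξ.Active n p i o) :
    Permits p o := (of_inv h.inv).2.1

/-- The control state of a client tells which operation it performs. -/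
theorem Active.pc_of {n : ℕ} {p : Client W R G} {i : ℕ} {o : Op V C} (h : ξ.Active n p i o) :
    ((ξ.st n).cl p).pc.Of o := by
  induction n with
  | zero => exact absurd h.lt (by omega)
  | succ n ih =>
    rcases Nat.lt_succ_iff_lt_or_eq.1 h.lt with hi | rfl
    · have ih := ih (h.mono hi n.le_succ)
      rcases ξ.client n p with h' | h'
      · rw [h'.pc]; exact ih
      · have hm := h'.move
        have hr := h.no_resp n hi (by omega)
        generalize ((ξ.st (n + 1)).cl p).pc = pc at hm ⊢
        generalize ((ξ.st (n + 1)).cl p).cseq = q' at hm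
        generalize ξ.ev n = ev at hm hr
        cases hm with
        | invoke o q hq hpc => rw [hpc] at ih; exact ih.elim
        | readNext_some κ i q x y hq hpc => rw [hpc] at ih; cases κ <;> exact ih
        | putNext_done κ i q x y hq hpc => rw [hpc] at ih; cases κ <;> exact ih
        | respond r => exact absurd rfl (hr r)
        | check_done => trivial
        | putFinal_done => trivial
        | start_read i q x hq hpc => rw [hpc] at ih; exact ih.symm
        | start_write v i q x hq hpc => rw [hpc] at ih; exact ih
        | start_reconfig c i q hq hpc => rw [hpc] at ih; exact ih.symm
        | check_again o t v ν i q hq hpc => rw [hpc] at ih; exact ih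
        | getTag_next o M i q x y t hq hpc => rw [hpc] at ih; exact ih
        | getTag_write w hp v M i q x t tm cm hq hpc =>
          rw [hpc] at ih; obtain rfl := ih; exact ⟨rfl, by simp⟩
        | getTag_reconfig c M i q x t tm cm hq hpc => rw [hpc] at ih; exact ⟨c, ih.symm⟩
        | getData_next M i q x y t v hq hpc => rw [hpc] at ih; exact ih
        | getData_last M i q x t tm v vm hq hpc =>
          rw [hpc] at ih; obtain rfl := ih; exact ⟨rfl, by simp⟩
        | putData_done o t v q x hq hpc => rw [hpc] at ih; exact ih
        | propose c q hq hpc => rw [hpc] at ih; exact ih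
        | decide c d q x hq hpc => rw [hpc] at ih; exact ih
        | putNew_done c q x hq hpc => rw [hpc] at ih; exact ih.symm
        | forward_done t cm q x hq hpc => rw [hpc] at ih; exact ih
    · obtain ⟨-, -, j, hj⟩ := of_inv h.inv
      rw [hj]; rfl

theorem Active.pc_ne_idle {n : ℕ} {p : Client W R G} {i : ℕ} {o : Op V C}
    (h : ξ.Active n p i o) : ((ξ.st n).cl p).pc ≠ .idle := by
  intro h'
  have := h.pc_of
  rw [h'] at this
  exact this

theorem exists_active {n : ℕ} {p : Client W R G} (h : ((ξ.st n).cl p).pc ≠ .idle) :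
    ∃ i o, ξ.Active n p i o := by
  induction n with
  | zero => rw [ξ.init] at h; exact absurd rfl h
  | succ n ih =>
    have key : ((ξ.st n).cl p).pc ≠ .idle → (∀ r, ξ.ev n ≠ some (.resp p r)) →
        ∃ i o, ξ.Active (n + 1) p i o := by
      intro h₁ h₂
      obtain ⟨i, o, hA⟩ := ih h₁
      refine ⟨i, o, by have := hA.lt; omega, hA.inv, fun m hm hm' => ?_⟩
      rcases Nat.lt_succ_iff_lt_or_eq.1 hm' with hm' | rfl
      · exact hA.no_resp m hm hm'
      · exact h₂
    rcases ξ.client n p with h' | h'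
    · exact key (h'.pc ▸ h) h'.resp
    · have hm := h'.move
      generalize ((ξ.st (n + 1)).cl p).pc = pc at hm h
      generalize ((ξ.st (n + 1)).cl p).cseq = q' at hm
      generalize hev : ξ.ev n = ev at hm key
      cases hm with
      | invoke o => exact ⟨n, o, by omega, hev, fun m _ _ => by omega⟩
      | respond => exact absurd rfl h
      | _ =>
        rename ((ξ.st n).cl p).pc = _ => hpc
        exact key (by simp [hpc]) (by simp)

/-- A client invokes an operation only after its previous one has been completed. -/
theorem exists_responds {i i' : ℕ} {p : Client W R G} {o o' : Op V C}
    (h : ξ.ev i = some (.inv p o)) (h' : ξ.ev i' = some (.inv p o')) (hlt : i < i') :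
    ∃ j r, ξ.Responds i j r ∧ j < i' := by
  classical
  have hex : ∃ m, i < m ∧ m < i' ∧ ∃ r, ξ.ev m = some (.resp p r) := by
    by_contra hc
    push Not at hc
    exact (Active.pc_ne_idle ⟨hlt, h, fun m h₁ h₂ r => hc m h₁ h₂ r⟩) (of_inv h').1
  obtain ⟨h₁, h₂, r, hr⟩ := Nat.find_spec hex
  refine ⟨Nat.find hex, r, ⟨h₁, p, o, h, hr, fun m hm hm' r' hr' => ?_⟩, h₂⟩
  exact Nat.find_min hex hm' ⟨hm, by omega, r', hr'⟩

theorem Responds.active {i j : ℕ} {r : Res V} (h : ξ.Responds i j r) :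
    ∃ p o, ξ.Active j p i o ∧ ξ.ev j = some (.resp p r) := by
  obtain ⟨hlt, p, o, h₁, h₂, h₃⟩ := h
  exact ⟨p, o, ⟨hlt, h₁, h₃⟩, h₂⟩

/-- An operation does not change the pair that it propagates. -/
theorem Active.carries {n m : ℕ} {p : Client W R G} {i : ℕ} {o : Op V C} (hm : ξ.Active m p i o)
    (hn : i < n) (hnm : n ≤ m) {t : Tag W} {v : V} (h : ((ξ.st n).cl p).pc.Carries t v) :
    ((ξ.st m).cl p).pc.Carries t v ∨ ∃ r, ((ξ.st m).cl p).pc = .ret r := by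
  induction m, hnm using Nat.le_induction with
  | base => exact Or.inl h
  | succ m hnm ih =>
    have ih := ih (hm.mono (by omega) m.le_succ)
    have hr := hm.no_resp m (by omega) (by omega)
    rcases ξ.client m p with h' | h'
    · rw [h'.pc]; exact ih
    · have hmv := h'.move
      generalize ((ξ.st (m + 1)).cl p).pc = pc at hmv ⊢
      generalize ((ξ.st (m + 1)).cl p).cseq = q' at hmv
      generalize ξ.ev m = ev at hmv hr
      cases hmv with
      | readNext_some κ i q x y hq hpc =>
        rw [hpc] at ih
        have ih := ih.resolve_right (by simp)
        cases κ
        · exact ih.elim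
        · exact Or.inl ih
      | putNext_done κ i q x y hq hpc =>
        rw [hpc] at ih
        have ih := ih.resolve_right (by simp)
        cases κ
        · exact ih.elim
        · exact Or.inl ih
      | check_done => exact Or.inr ⟨_, rfl⟩
      | putFinal_done => exact Or.inr ⟨_, rfl⟩
      | respond r => exact absurd rfl (hr r)
      | check_again o t v ν i q hq hpc =>
        rw [hpc] at ih
        exact Or.inl (ih.resolve_right (by simp))
      | putData_done o t v q x hq hpc =>
        rw [hpc] at ih
        exact Or.inl (ih.resolve_right (by simp))
      | _ =>
        rename ((ξ.st m).cl p).pc = _ => hpc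
        rw [hpc] at ih
        simp [PC.Carries] at ih

theorem Tagged.unique {i : ℕ} {t t' : Tag W} {v v' : V} (h : ξ.Tagged i t v)
    (h' : ξ.Tagged i t' v') : t = t' ∧ v = v' := by
  obtain ⟨n, p, o, hA, hc⟩ := h
  obtain ⟨n', p', o', hA', hc'⟩ := h'
  have hp := hA.inv.symm.trans hA'.inv
  simp only [Option.some.injEq, Event.inv.injEq] at hp
  obtain ⟨rfl, rfl⟩ := hp
  have det : ∀ {pc : PC V W C} {t t' : Tag W} {v v' : V}, pc.Carries t v → pc.Carries t' v' →
      t = t' ∧ v = v' := by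
    intro pc t t' v v' h h'
    cases pc with
    | putData => exact ⟨h.1.symm.trans h'.1, h.2.symm.trans h'.2⟩
    | readNext κ =>
      cases κ
      · exact h.elim
      · exact ⟨h.1.symm.trans h'.1, h.2.symm.trans h'.2⟩
    | putNext κ =>
      cases κ
      · exact h.elim
      · exact ⟨h.1.symm.trans h'.1, h.2.symm.trans h'.2⟩
    | _ => exact h.elim
  rcases le_total n n' with hle | hle
  · rcases hA'.carries hA.lt hle hc with h | ⟨r, h⟩
    · exact det h hc'
    · rw [h] at hc'; exact hc'.elim
  · rcases hA.carries hA'.lt hle hc' with h | ⟨r, h⟩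
    · exact det hc h
    · rw [h] at hc; exact hc.elim

theorem Tag.lt_inc (t : Tag W) (w : W) : t < Tag.inc t w := by
  rw [Prod.Lex.lt_iff]
  left; simp [Tag.inc]

/-- The pair that an operation propagates was formed from the collection that it made: in the last
state of this collection, a writer bounds it by the tag that it increments, and a reader by the tag
itself. -/
theorem Tagged.origin {i : ℕ} {t : Tag W} {v : V} (h : ξ.Tagged i t v) :
    ∃ n p o, ξ.Active n p i o ∧
      ((∃ w tm, p = .writer w ∧ o = .write v ∧ t = Tag.inc tm w ∧
        ξ.Collects n p {tm} ((ξ.st n).cl p).cseq.length True) ∨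
      (o = .read ∧ ξ.Collects n p {t} ((ξ.st n).cl p).cseq.length True)) := by
  obtain ⟨n, p, o, hA, hc⟩ := h
  induction n with
  | zero => exact absurd hA.lt (by omega)
  | succ n ih =>
    rcases Nat.lt_succ_iff_lt_or_eq.1 hA.lt with hi | rfl
    · have ih := ih (hA.mono hi n.le_succ)
      have hof := (hA.mono hi n.le_succ).pc_of
      rcases ξ.client n p with h' | h'
      · rw [h'.pc] at hc; exact ih hc
      · have hm := h'.move
        generalize ((ξ.st (n + 1)).cl p).pc = pc at hm hc
        generalize hq' : ((ξ.st (n + 1)).cl p).cseq = q' at hm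
        generalize ξ.ev n = ev at hm
        cases hm with
        | readNext_some κ i q x y hq hpc =>
          rw [hpc] at ih
          exact ih (by cases κ <;> exact hc)
        | putNext_done κ i q x y hq hpc =>
          rw [hpc] at ih
          exact ih (by cases κ <;> exact hc)
        | check_again o t v ν i q hq hpc => rw [hpc] at ih; exact ih hc
        | putData_done o t v q x hq hpc => rw [hpc] at ih; exact ih hc
        | getTag_write w hp v' M i q x t' tm cm hq hpc hx hi ht hm =>
          subst hq
          obtain ⟨rfl, rfl⟩ := hc
          rw [hpc] at hof
          obtain rfl := hof
          refine ⟨n, p, _, hA.mono ‹_› n.le_succ, Or.inl ⟨w, tm, hp, rfl, rfl, ?_⟩⟩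
          rw [← hi]
          obtain ⟨b, h₁, h₂, h₃, h₄, h₅⟩ :=
            (collects_getTag (fun m _ => ξ.collectInv m p) hpc hx ht).bound (IsMaxPair.bound hm)
          exact ⟨b, h₁, h₂, h₃, fun _ => h₄ (by simp), h₅⟩
        | getData_last M i q x t' tm v' vm hq hpc hx hi ht hm =>
          subst hq
          obtain ⟨rfl, rfl⟩ := hc
          rw [hpc] at hof
          obtain rfl := hof
          refine ⟨n, p, _, hA.mono ‹_› n.le_succ, Or.inr ⟨rfl, ?_⟩⟩
          rw [← hi]
          exact (collects_getData (fun m _ => ξ.collectInv m p) hpc hx ht).bound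
            (IsMaxPair.bound hm)
        | invoke o => exact hc.elim
        | _ => exact hc.elim
    · obtain ⟨-, -, j, hj⟩ := of_inv hA.inv
      rw [hj] at hc; exact hc.elim

/-- An operation propagates a tag that is at least that of every milestone before its invocation,
and larger if it is a write. -/
theorem Tagged.milestone_le {i : ℕ} {t : Tag W} {v : V} (h : ξ.Tagged i t v) {k ν : ℕ} {c : C}
    {t' : Tag W} (hM : ξ.Milestone k ν c t') (hk : k ≤ i) :
    t' ≤ t ∧ (ξ.IsWrite i → t' < t) := by
  obtain ⟨n, p, o, hA, ⟨w, tm, rfl, rfl, rfl, hc⟩ | ⟨rfl, hc⟩⟩ := h.origin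
  · obtain ⟨_, rfl, hle⟩ := hM.exists_le hc (of_inv hA.inv).1 hA.lt.le hk
    have := hle.trans_lt (Tag.lt_inc _ w)
    exact ⟨this.le, fun _ => this⟩
  · obtain ⟨_, rfl, hle⟩ := hM.exists_le hc (of_inv hA.inv).1 hA.lt.le hk
    refine ⟨hle, ?_⟩
    rintro ⟨v, p', h⟩
    rw [hA.inv] at h; cases h

/-- When a client in the propagation loop looks for new configurations, its tag is stored in the
configuration with the index `ν`, which was the last one at the preceding `put-data`. -/
theorem stored_of_check (ξ : Execution W R G sys) {n : ℕ} {p : Client W R G} {o : Op V C}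
    {t : Tag W} {v : V} {ν i : ℕ}
    (hpc : ((ξ.st n).cl p).pc = .readNext (.check o t v ν) i ∨
      ((ξ.st n).cl p).pc = .putNext (.check o t v ν) i) : ∃ c, ξ.Conf ν c ∧ ξ.Stored n c t := by
  induction n generalizing i with
  | zero => rw [ξ.init] at hpc; rcases hpc with h | h <;> cases h
  | succ n ih =>
    have next : ∀ i, (((ξ.st n).cl p).pc = .readNext (.check o t v ν) i ∨
        ((ξ.st n).cl p).pc = .putNext (.check o t v ν) i) →
        ∃ c, ξ.Conf ν c ∧ ξ.Stored (n + 1) c t := by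
      intro i h
      obtain ⟨c, hc, hs⟩ := ih h
      exact ⟨c, hc, hs.mono n.le_succ⟩
    rcases ξ.client n p with h | h
    · rw [h.pc] at hpc
      exact next i hpc
    · have hm := h.move
      generalize ((ξ.st (n + 1)).cl p).pc = pc at hm hpc
      generalize hq' : ((ξ.st (n + 1)).cl p).cseq = q' at hm
      generalize ξ.ev n = ev at hm
      rcases hpc with rfl | rfl
      · cases hm with
        | putNext_done κ j q x y hq hpc => exact next _ (Or.inr hpc)
        | putData_done o t v q x hq hpc hx hack =>
          subst hq
          refine ⟨x.1, ξ.conf_of_cseq (n := n) (p := p) ?_,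
            (putData_stored hpc hx hack).mono n.le_succ⟩
          rw [← hx, List.getLast?_eq_getElem?]
      · cases hm with
        | readNext_some κ j q x y hq hpc => exact next _ (Or.inl hpc)

/-- When a read or write is about to return, its tag has passed a milestone. -/
theorem Active.ret {n : ℕ} {p : Client W R G} {i : ℕ} {o : Op V C} (h : ξ.Active n p i o)
    (ho : ∀ c, o ≠ .reconfig c) {r : Res V} (hr : ((ξ.st n).cl p).pc = .ret r) :
    ∃ t v, ξ.Tagged i t v ∧ r = result o v ∧ ∃ k ≤ n, ∃ ν c, ξ.Milestone k ν c t := by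
  induction n with
  | zero => exact absurd h.lt (by omega)
  | succ n ih =>
    rcases Nat.lt_succ_iff_lt_or_eq.1 h.lt with hi | rfl
    · have hA := h.mono hi n.le_succ
      have hof := hA.pc_of
      rcases ξ.client n p with h' | h'
      · obtain ⟨t, v, h₁, h₂, k, hk, h₃⟩ := ih hA (h'.pc ▸ hr)
        exact ⟨t, v, h₁, h₂, k, by omega, h₃⟩
      · have hm := h'.move
        rw [hr] at hm
        generalize hq' : ((ξ.st (n + 1)).cl p).cseq = q' at hm
        generalize ξ.ev n = ev at hm
        cases hm with
        | check_done o' t v ν j q x hq hpc hx hn hν =>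
          subst hq
          rw [hpc] at hof
          obtain ⟨rfl, -⟩ := hof
          obtain ⟨a, ha⟩ := ξ.exists_since (n := n) (p := p) (by rw [hpc]; trivial)
          obtain ⟨hj, hnl, hl⟩ := ha.read_end hpc hx hn
          obtain ⟨c, hc, hs⟩ := ξ.stored_of_check (n := a) (p := p)
            (Or.inl ((ha.const a le_rfl ha.le).1.trans hpc))
          have hjν : j = ν := by omega
          subst hjν
          obtain rfl := hc.unique (ξ.conf_of_cseq hx)
          refine ⟨t, v, ⟨n, p, _, hA, by rw [hpc]; exact ⟨rfl, rfl⟩⟩, rfl, a,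
            by have := ha.le; omega, j, _, hc, hs, hnl, fun i' c' hi' hc' => ?_⟩
          have hlt : i' < ((ξ.st n).cl p).cseq.length := by omega
          have hy := List.getElem?_eq_getElem hlt
          rw [hc'.unique (ξ.conf_of_cseq hy)]
          exact hl i' _ hi' hy
        | putFinal_done q hq hpc =>
          rw [hpc] at hof
          obtain ⟨c, rfl⟩ := hof
          exact absurd rfl (ho c)
    · obtain ⟨-, -, j, hj⟩ := of_inv h.inv
      rw [hj] at hr; cases hr

variable (ξ)

/-! ### Values -/

/-- `v` is the value that belongs to the tag `t`: the initial value, or a value written. -/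
def Val (t : Tag W) (v : V) : Prop :=
  (t = tag0 ∧ v = sys.v0) ∨ ∃ i, ξ.IsWrite i ∧ ξ.Tagged i t v

variable {ξ}

/-- Tags increase from a complete operation to a later one. -/
theorem Precedes.tag_le {i i' : ℕ} (h : ξ.Precedes i i') (hi : ξ.IsRead i ∨ ξ.IsWrite i)
    {t t' : Tag W} {v v' : V} (ht : ξ.Tagged i t v) (ht' : ξ.Tagged i' t' v') :
    t ≤ t' ∧ (ξ.IsWrite i' → t < t') := by
  obtain ⟨j, r, hr, hj⟩ := h
  obtain ⟨p, o, hA, hev⟩ := hr.active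
  have ho : ∀ c, o ≠ .reconfig c := by
    rintro c rfl
    rcases hi with ⟨p', h⟩ | ⟨v, p', h⟩ <;> rw [hA.inv] at h <;> cases h
  obtain ⟨t₁, v₁, h₁, -, k, hk, ν, c, hM⟩ := hA.ret ho (of_resp hev)
  obtain ⟨rfl, -⟩ := ht.unique h₁
  exact ht'.milestone_le hM (hk.trans hj.le)

theorem Tagged.writer {i : ℕ} {t : Tag W} {v : V} (h : ξ.Tagged i t v) (hi : ξ.IsWrite i) :
    ∃ w tm, ξ.ev i = some (.inv (.writer w) (.write v)) ∧ t = Tag.inc tm w := by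
  obtain ⟨n, p, o, hA, ⟨w, tm, rfl, rfl, rfl, -⟩ | ⟨rfl, -⟩⟩ := h.origin
  · exact ⟨w, tm, hA.inv, rfl⟩
  · obtain ⟨v, p', h⟩ := hi
    rw [hA.inv] at h; cases h

/-- Different writes have different tags. -/
theorem write_eq_of_tag_eq {i i' : ℕ} (hi : ξ.IsWrite i) (hi' : ξ.IsWrite i') {t : Tag W}
    {v v' : V} (h : ξ.Tagged i t v) (h' : ξ.Tagged i' t v') : i = i' := by
  obtain ⟨w, tm, hw, ht⟩ := h.writer hi
  obtain ⟨w', tm', hw', ht'⟩ := h'.writer hi'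
  have hww : w = w' := by
    have := congrArg (fun t => (ofLex t).2) (ht.symm.trans ht')
    simpa [Tag.inc] using this
  subst hww
  rcases lt_trichotomy i i' with hlt | rfl | hlt
  · obtain ⟨j, r, hr, hj⟩ := exists_responds hw hw' hlt
    exact absurd ((Precedes.tag_le ⟨j, r, hr, hj⟩ (Or.inr hi) h h').2 hi') (lt_irrefl _)
  · rfl
  · obtain ⟨j, r, hr, hj⟩ := exists_responds hw' hw hlt
    exact absurd ((Precedes.tag_le ⟨j, r, hr, hj⟩ (Or.inr hi') h' h).2 hi) (lt_irrefl _)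

theorem Tagged.tag0_lt {i : ℕ} {t : Tag W} {v : V} (h : ξ.Tagged i t v) (hi : ξ.IsWrite i) :
    tag0 < t := by
  obtain ⟨w, tm, -, rfl⟩ := h.writer hi
  rw [Prod.Lex.lt_iff]
  left; simp [Tag.inc, tag0]

/-- The tag of a write is larger than `tag0`, and no two writes have the same. -/
theorem Val.unique {t : Tag W} {v v' : V} (h : ξ.Val t v) (h' : ξ.Val t v') : v = v' := by
  rcases h with ⟨rfl, rfl⟩ | ⟨i, hi, h⟩ <;> rcases h' with ⟨h₀, rfl⟩ | ⟨i', hi', h'⟩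
  · rfl
  · exact absurd (h'.tag0_lt hi') (lt_irrefl _)
  · exact absurd (h₀ ▸ h.tag0_lt hi) (lt_irrefl _)
  · obtain rfl := write_eq_of_tag_eq hi hi' h h'
    exact (h.unique h').2

variable (ξ) in
/-- `e` is the coded element at the server `s` of `c` of the value that belongs to the tag `t`. -/
def Coded (c : C) (s : S) (t : Tag W) (e : E) : Prop :=
  ∃ v, ξ.Val t v ∧ e = (sys.cfg c).enc s v

/-- Decoding `k` coded elements for the same tag yields the value of the tag, as they are all
elements of this value. -/
theorem val_of_decodes {c : C} {t : Tag W} {X : Set (S × E)} {v : V}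
    (hX : ∀ a ∈ X, a.1 ∈ (sys.cfg c).servers ∧ ξ.Coded c a.1 t a.2)
    (h : (sys.cfg c).Decodes X v) : ξ.Val t v := by
  obtain ⟨A, hA, hk, -, rfl⟩ := h
  obtain ⟨a, ha⟩ := Finset.card_pos.1 ((sys.cfg c).k_pos.trans_le hk.ge)
  obtain ⟨-, v, hv, -⟩ := hX a (hA ha)
  rw [(sys.cfg c).dec_enc v A hk fun b hb => ?_]
  · exact hv
  · obtain ⟨hs, v', hv', he⟩ := hX b (hA hb)
    rw [hv'.unique hv] at he
    exact ⟨hs, he⟩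

variable (ξ) in
/-- All coded elements in the system are those of the values that belong to their tags, and clients
hold only such values. The elements in `D` for the initial tag are exempt: they belong to servers
that need not be among those of the configuration, and they are never decoded, since the initial tag
is in every list. -/
structure ValInv (n : ℕ) : Prop where
  list : ∀ s c t e, (t, some e) ∈ ((ξ.st n).srv s c).list → ξ.Coded c s t e
  D : ∀ s c t c' s' e, (t, c', s', some e) ∈ ((ξ.st n).srv s c).D →
    t = tag0 ∨ (s' ∈ (sys.cfg c').servers ∧ ξ.Coded c' s' t e)
  put : ∀ p ph s c t e, .req p ph s c (.putData t e) ∈ (ξ.st n).net → ξ.Coded c s t e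
  fwd : ∀ s c t e s' c' g ph, .fwd s c t e s' c' g ph ∈ (ξ.st n).net →
    s ∈ (sys.cfg c).servers ∧ ξ.Coded c s t e
  getData : ∀ p M i, ((ξ.st n).cl p).pc = .getData M i → ∀ y ∈ M, ξ.Val y.1 y.2
  carries : ∀ p t v, ((ξ.st n).cl p).pc.Carries t v → ξ.Val t v

theorem has_tag0 (ξ : Execution W R G sys) (n : ℕ) (s : S) (c : C) :
    ((ξ.st n).srv s c).Has tag0 := by
  refine ξ.has_mono (Nat.zero_le n) ?_
  rw [ξ.init]
  exact ⟨_, Finset.mem_singleton_self _⟩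

theorem val_of_dataResult {n : ℕ} (ih : ∀ m ≤ n, ξ.ValInv m) {p : Client W R G}
    {M : Set (Tag W × V)} {i : ℕ} (hpc : ((ξ.st n).cl p).pc = .getData M i) {x : C × Status}
    (hx : ((ξ.st n).cl p).cseq[i]? = some x) {t : Tag W} {v : V}
    (hd : DataResult sys ((ξ.st n).cl p) x.1 t v) : ξ.Val t v := by
  obtain ⟨a, ha⟩ := ξ.exists_since (n := n) (p := p) (by rw [hpc]; trivial)
  obtain ⟨T, hT, -, L, hL, -, -, hdec⟩ := hd
  refine val_of_decodes (fun b hb => ?_) hdec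
  obtain ⟨m, -, hm, hs, hlist⟩ := ha.list hpc hx (hL b.1 hb.1)
  refine ⟨hs, (ih m hm.le).list _ _ _ _ ?_⟩
  rw [hlist]
  exact hb.2

/-- The part of `ValInv` that concerns the states of clients. -/
theorem ValInv.step_client {n : ℕ} (ih : ∀ m ≤ n, ξ.ValInv m) (p : Client W R G) :
    (∀ M i, ((ξ.st (n + 1)).cl p).pc = .getData M i → ∀ y ∈ M, ξ.Val y.1 y.2) ∧
    ∀ t v, ((ξ.st (n + 1)).cl p).pc.Carries t v → ξ.Val t v := by
  have I := ih n le_rfl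
  rcases ξ.client n p with h | h
  · rw [h.pc]
    exact ⟨I.getData p, I.carries p⟩
  · have hm := h.move
    constructor
    · intro M i hpc'
      rw [hpc'] at hm
      generalize ((ξ.st (n + 1)).cl p).cseq = q' at hm
      generalize ξ.ev n = ev at hm
      cases hm with
      | start_read => simp
      | getData_next M j q x y t v hq hpc hx hd hy =>
        subst hq
        rintro z (rfl | hz)
        · exact val_of_dataResult ih hpc hx hd
        · exact I.getData p M j hpc z hz
    · intro t v hc
      have hact := exists_active (ξ := ξ) (n := n + 1) (p := p)
      have hof : ∀ {i o}, ξ.Active (n + 1) p i o → ((ξ.st (n + 1)).cl p).pc.Of o :=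
        fun h => h.pc_of
      have htag : ∀ {i o}, ξ.Active (n + 1) p i o → ξ.Tagged i t v := fun h => ⟨_, p, _, h, hc⟩
      generalize ((ξ.st (n + 1)).cl p).pc = pc at hm hc hact hof
      generalize ((ξ.st (n + 1)).cl p).cseq = q' at hm
      generalize ξ.ev n = ev at hm
      cases hm with
      | readNext_some κ i q x y hq hpc =>
        refine I.carries p t v ?_
        rw [hpc]
        cases κ <;> exact hc
      | putNext_done κ i q x y hq hpc =>
        refine I.carries p t v ?_
        rw [hpc]
        cases κ <;> exact hc
      | check_again o t v ν i q hq hpc =>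
        refine I.carries p _ _ ?_
        rw [hpc]; exact hc
      | putData_done o t v q x hq hpc =>
        refine I.carries p _ _ ?_
        rw [hpc]; exact hc
      | getTag_write w hp v' M i q x t' tm cm hq hpc hx hi ht hm =>
        obtain ⟨i₀, o, hA⟩ := hact (by simp)
        obtain ⟨rfl, -⟩ := hof hA
        exact Or.inr ⟨i₀, ⟨_, p, hA.inv⟩, htag hA⟩
      | getData_last M i q x t' tm v' vm hq hpc hx hi hd hm =>
        subst hq
        obtain ⟨rfl, rfl⟩ := hc
        rcases hm.1 with h | h
        · cases h
          exact val_of_dataResult ih hpc hx hd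
        · exact I.getData p M i hpc _ h
      | invoke => exact hc.elim
      | _ => exact hc.elim

/-- The receipt of a forwarded element preserves `ValInv` at the server. -/
theorem ValInv.fwdStore {n : ℕ} (I : ξ.ValInv n) {s : S} {c : C} {s₀ : S} {c₀ : C} {t : Tag W}
    {e : E} {g : G} {ph : ℕ} (hf : .fwd s₀ c₀ t e s c g ph ∈ (ξ.st n).net)
    {st₁ : SrvState W G S C E} (h : FwdStore sys s c ((ξ.st n).srv s c) s₀ c₀ t e st₁) :
    (∀ t e, (t, some e) ∈ st₁.list → ξ.Coded c s t e) ∧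
    ∀ t c' s' e, (t, c', s', some e) ∈ st₁.D →
      t = tag0 ∨ (s' ∈ (sys.cfg c').servers ∧ ξ.Coded c' s' t e) := by
  have hD : ∀ t' c' s' e', (t', c', s', some e') ∈
      insert (t, c₀, s₀, some e) ((ξ.st n).srv s c).D →
      t' = tag0 ∨ (s' ∈ (sys.cfg c').servers ∧ ξ.Coded c' s' t' e') := by
    rintro t' c' s' e' (h | h)
    · cases h
      exact Or.inr (I.fwd _ _ _ _ _ _ _ _ hf)
    · exact I.D _ _ _ _ _ _ h
  cases h with
  | known => exact ⟨I.list s c, I.D s c⟩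
  | collect D' h hD' =>
    subst hD'
    exact ⟨I.list s c, hD⟩
  | decode D' v h hD' hdec =>
    subst hD'
    -- The server decodes only tags that are not in its list.
    have ht : t ≠ tag0 := by
      rintro rfl
      obtain ⟨o, ho⟩ := ξ.has_tag0 n s c
      exact h o ho
    constructor
    · intro t' e' h'
      rcases mem_of_mem_insertTrim h' with ⟨rfl, rfl⟩ | h'
      · exact ⟨v, val_of_decodes (fun a ha => (hD _ _ _ _ ha).resolve_left ht) hdec, rfl⟩
      · exact I.list _ _ _ _ h'
    · rintro t' c' s' e' ⟨x, hx, hx'⟩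
      dsimp only at hx'
      split_ifs at hx' with h₁
      · simp at hx'
      · subst hx'
        exact hD _ _ _ _ hx

theorem valInv (ξ : Execution W R G sys) (n : ℕ) : ξ.ValInv n := by
  induction n using Nat.strong_induction_on with
  | _ n ih =>
  rcases n with _ | n
  · have h := ξ.init
    refine ⟨fun s c t e he => ?_, fun s c t c' s' e he => ?_, fun p ph s c t e he => ?_,
      fun s c t e s' c' g ph he => ?_, fun p M i hpc => ?_, fun p t v hc => ?_⟩ <;> rw [h] at *
    · simp [State.init, SrvState.init] at he
      exact ⟨_, Or.inl ⟨he.1, rfl⟩, he.2⟩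
    · simp [State.init, SrvState.init] at he
      exact Or.inl he.1
    · simp [State.init] at he
    · simp [State.init] at he
    · cases hpc
    · exact hc.elim
  · have ih' : ∀ m ≤ n, ξ.ValInv m := fun m hm => ih m (by omega)
    have I := ih' n le_rfl
    have hcl := ValInv.step_client ih'
    have hsrv : ∀ s c, (∀ t e, (t, some e) ∈ ((ξ.st (n + 1)).srv s c).list → ξ.Coded c s t e) ∧
        ∀ t c' s' e, (t, c', s', some e) ∈ ((ξ.st (n + 1)).srv s c).D →
          t = tag0 ∨ (s' ∈ (sys.cfg c').servers ∧ ξ.Coded c' s' t e) := by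
      intro s c
      rcases ξ.server n s c with h | ⟨out, h⟩
      · rw [h]; exact ⟨I.list s c, I.D s c⟩
      · generalize (ξ.st (n + 1)).srv s c = st' at h ⊢
        rcases h with ⟨p, ph, b, hb, h⟩ | ⟨s₀, c₀, t', e, g, ph, hb, h⟩
        · cases h with
          | putData p ph t e =>
            refine ⟨fun t' e' h' => ?_, I.D s c⟩
            rcases mem_of_mem_insertTrim h' with ⟨rfl, rfl⟩ | h'
            · exact I.put _ _ _ _ _ _ hb
            · exact I.list _ _ _ _ h'
          | _ => exact ⟨I.list s c, I.D s c⟩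
        · cases h with
          | ignore => exact ⟨I.list s c, I.D s c⟩
          | wait _ _ h₁ => exact I.fwdStore hb h₁
          | ack st₁ _ h₁ => exact I.fwdStore (st₁ := st₁) hb h₁
    refine ⟨fun s c => (hsrv s c).1, fun s c => (hsrv s c).2, fun p ph s c t e he => ?_,
      fun s c t e s' c' g ph he => ?_, fun p => (hcl p).1, fun p => (hcl p).2⟩
    · rcases ξ.net n he with h | ⟨p', c', b, s', -, hm, -, hA⟩ | ⟨s', c', out, ho, hs⟩
      · exact I.put _ _ _ _ _ _ h
      · simp only [Msg.req.injEq] at hm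
        obtain ⟨rfl, rfl, rfl, rfl, hb⟩ := hm
        have hc := (hcl p).2
        generalize ((ξ.st (n + 1)).cl p).pc = pc at hA hc
        cases pc with
        | putData o t' v =>
          obtain ⟨x, hx, rfl, rfl⟩ := hA
          cases hb
          exact ⟨v, hc _ _ ⟨rfl, rfl⟩, rfl⟩
        | putNext | putNew | putFinal =>
          obtain ⟨x, y', hx, hy', rfl, rfl⟩ := hA
          cases hb
        | readNext | getTag | getData | forward =>
          obtain ⟨x, hx, rfl, rfl⟩ := hA
          cases hb
        | _ => exact hA.elim
      · generalize (ξ.st (n + 1)).srv s' c' = st' at hs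
        rcases hs with ⟨p, ph, b, -, h⟩ | ⟨s₀, c₀, t', e, g, ph, -, h⟩
        · cases h <;> simp at ho
        · cases h <;> simp at ho
    · obtain ⟨m, hm, hreq, hel, -⟩ := ξ.fwd_origin he
      obtain ⟨-, -, -, -, hs, -⟩ := ξ.req_origin hreq
      exact ⟨hs, (ih m (by omega)).list _ _ _ _ hel⟩

/-! ### Atomicity -/

/-- The tag of a read or write; it is `tag0` for an operation that has not formed a pair. -/
noncomputable def tagOf (ξ : Execution W R G sys) (i : ℕ) : Tag W :=
  open Classical in if h : ∃ t v, ξ.Tagged i t v then h.choose else tag0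

theorem Tagged.tagOf_eq {i : ℕ} {t : Tag W} {v : V} (h : ξ.Tagged i t v) : ξ.tagOf i = t := by
  have h' : ∃ t v, ξ.Tagged i t v := ⟨t, v, h⟩
  unfold tagOf
  rw [dif_pos h']
  obtain ⟨v', hv⟩ := h'.choose_spec
  exact (hv.unique h).1

theorem not_isRead_of_isWrite {i : ℕ} (h : ξ.IsWrite i) : ¬ ξ.IsRead i := by
  rintro ⟨p, hp⟩
  obtain ⟨v, p', h⟩ := h
  rw [hp] at h; cases h

/-- A complete read or write has a tag, and a read returns the value that belongs to it. -/
theorem Responds.tagged {i j : ℕ} {r : Res V} (h : ξ.Responds i j r)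
    (hi : ξ.IsRead i ∨ ξ.IsWrite i) :
    ∃ t v, ξ.Tagged i t v ∧ (ξ.IsRead i → r = .value v) := by
  obtain ⟨p, o, hA, hev⟩ := h.active
  have ho : ∀ c, o ≠ .reconfig c := by
    rintro c rfl
    rcases hi with ⟨p', h⟩ | ⟨v, p', h⟩ <;> rw [hA.inv] at h <;> cases h
  obtain ⟨t, v, ht, rfl, -⟩ := hA.ret ho (of_resp hev)
  refine ⟨t, v, ht, ?_⟩
  rintro ⟨p', h⟩
  rw [hA.inv] at h; cases h
  rfl

/-- The operations with a tag, among reads only the complete ones, are ordered by their tags, a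
write before the reads with the same tag. -/
theorem atomic (ξ : Execution W R G sys) : ξ.Atomic := by
  refine ⟨{i | (ξ.IsRead i ∧ ξ.Complete i ∨ ξ.IsWrite i) ∧ ∃ t v, ξ.Tagged i t v},
    fun i j => ξ.tagOf i < ξ.tagOf j ∨ (ξ.tagOf i = ξ.tagOf j ∧ ξ.IsWrite i ∧ ξ.IsRead j),
    ?_, ?_, ?_, ?_, ?_, ?_, ?_, ?_⟩
  · rintro i ⟨h | h, -⟩
    · exact Or.inl h.1
    · exact Or.inr h
  · rintro i hi ⟨j, r, hr⟩
    obtain ⟨t, v, ht, -⟩ := hr.tagged hi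
    exact ⟨hi.imp_left fun h => ⟨h, j, r, hr⟩, t, v, ht⟩
  · rintro i ⟨h | h, -⟩ hc
    · exact absurd h.2 hc
    · exact h
  · rintro i - (h | ⟨-, h, h'⟩)
    · exact lt_irrefl _ h
    · exact not_isRead_of_isWrite h h'
  · rintro i - j - l - (h | ⟨h, hw, hr⟩) (h' | ⟨h', hw', hr'⟩)
    · exact Or.inl (h.trans h')
    · exact Or.inl (h' ▸ h)
    · exact Or.inl (h ▸ h')
    · exact absurd hr (not_isRead_of_isWrite hw')
  -- Tags do not decrease along the real-time order, and increase at a write.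
  · rintro i ⟨hi, t, v, ht⟩ i' ⟨hi', t', v', ht'⟩ hp
    have := hp.tag_le (hi.imp_left And.left) ht ht'
    beta_reduce
    rw [ht.tagOf_eq, ht'.tagOf_eq]
    rintro (h | ⟨h, hw, -⟩)
    · exact absurd h (not_lt.2 this.1)
    · exact absurd h.symm (this.2 hw).ne
  -- Equal tags occur only at a write and the reads that return its value, or at several reads.
  · rintro i ⟨-, t, v, ht⟩ i' ⟨hi', t', v', ht'⟩ hw hne
    beta_reduce
    rw [ht.tagOf_eq, ht'.tagOf_eq]
    rcases lt_trichotomy t t' with h | rfl | h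
    · exact Or.inl (Or.inl h)
    · rcases hi' with h | h
      · exact Or.inl (Or.inr ⟨rfl, hw, h.1⟩)
      · exact absurd (write_eq_of_tag_eq hw h ht ht') hne
    · exact Or.inr (Or.inl h)
  -- The last write before a read is the one with the same tag; if the tag is `tag0`, there is none.
  · rintro i - hread j r hr
    obtain ⟨t, v, ht, hrv⟩ := hr.tagged (Or.inl hread)
    refine ⟨v, hrv hread, ?_⟩
    have hval : ξ.Val t v := by
      obtain ⟨n, p, o, -, hc⟩ := ht
      exact (ξ.valInv n).carries p t v hc
    beta_reduce
    rw [ht.tagOf_eq]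
    rcases hval with ⟨rfl, rfl⟩ | ⟨w, hw, htw⟩
    · refine Or.inr ⟨?_, rfl⟩
      rintro w ⟨-, t', v', ht'⟩ hw hlt
      have h0 := ht'.tag0_lt hw
      rw [ht'.tagOf_eq] at hlt
      rcases hlt with h | ⟨h, -⟩
      · exact lt_asymm h h0
      · exact h0.ne h.symm
    · left
      obtain ⟨w', tm, hev, -⟩ := htw.writer hw
      refine ⟨w, ⟨Or.inr hw, t, v, htw⟩, ⟨_, hev⟩, Or.inr ⟨htw.tagOf_eq, hw, hread⟩, ?_⟩
      rintro w₁ ⟨-, t₁, v₁, ht₁⟩ hw₁ hlt hne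
      rw [ht₁.tagOf_eq] at hlt ⊢
      rw [htw.tagOf_eq]
      rcases hlt with h | ⟨rfl, -⟩
      · exact Or.inl h
      · exact absurd (write_eq_of_tag_eq hw₁ hw ht₁ htw) hne

/-! ### Reconfigurers and coded elements -/

/-- A reconfigurer sends no request that carries a coded element or asks for a list. -/
theorem req_recon {n : ℕ} {g : G} {ph : ℕ} {s : S} {c : C} {b : Req W C E}
    (h : .req (.recon g) ph s c b ∈ (ξ.st n).net) :
    (∀ t e, b ≠ .putData t e) ∧ b ≠ .queryList := by
  obtain ⟨a, -, -, -, -, bf, rfl, hA⟩ := ξ.req_origin h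
  have hact := exists_active (ξ := ξ) (n := a + 1) (p := .recon g)
  have hof : ∀ {i o}, ξ.Active (a + 1) (.recon g) i o →
    ((ξ.st (a + 1)).cl (.recon g)).pc.Of o := fun h => h.pc_of
  generalize ((ξ.st (a + 1)).cl (.recon g)).pc = pc at hA hact hof
  have hop : pc ≠ .idle → ∃ c, pc.Of (.reconfig c) := by
    intro h
    obtain ⟨i, o, hA⟩ := hact h
    have hp := hA.permits
    cases o with
    | reconfig c => exact ⟨c, hof hA⟩
    | _ => exact hp.elim
  cases pc with
  | putData o t v =>
    obtain ⟨c, -, h⟩ := hop (by simp)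
    exact absurd rfl (h c)
  | getData M i =>
    obtain ⟨c, h⟩ := hop (by simp)
    cases h
  | putNext | putNew | putFinal =>
    obtain ⟨x, y', hx, hy', rfl, rfl⟩ := hA
    simp
  | readNext | getTag | forward =>
    obtain ⟨x, hx, rfl, rfl⟩ := hA
    simp
  | _ => exact hA.elim

theorem valuesBypassReconfigurers (ξ : Execution W R G sys) : ξ.ValuesBypassReconfigurers := by
  intro n g m hm ht hc
  cases m with
  | req p ph s c b =>
    obtain rfl : p = .recon g := ht
    have h := req_recon hm
    cases b with
    | putData t e => exact h.1 t e rfl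
    | _ => exact hc
  | rep p ph s b =>
    obtain rfl : p = .recon g := ht
    obtain ⟨m, -, ⟨c, b', out, hreq, hs, ho⟩ | ⟨-, -, -, -, -, -, -, rfl, -⟩⟩ := ξ.rep_origin hm
    · have h := req_recon hreq
      generalize (ξ.st (m + 1)).srv s c = st' at hs
      cases hs with
      | queryList => exact h.2 rfl
      | reqFwd_send => simp at ho
      | reqFwd_skip => simp at ho
      | _ => simp at ho; subst ho; exact hc
    · exact hc
  | fwd => exact ht

end Execution

end AresTreas

theorem mainTheorem6 {V W R G S C E : Type*} [LinearOrder W] (sys : AresTreas.System V S C E)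
    (ξ : AresTreas.Execution W R G sys) : ξ.Atomic ∧ ξ.ValuesBypassReconfigurers :=
  ⟨ξ.atomic, ξ.valuesBypassReconfigurers⟩
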